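/- Let $T$ be a tetrahedron with ordered vertices. Write $\lambda_0,\dots,\lambda_n$ for the barycentric coordinates of an $n$-simplex $F$, $\lambda^\alpha=\prod_i\lambda_i^{\alpha_i}$, $d\lambda_\sigma=d\lambda_{\sigma(1)}\wedge\dots\wedge d\lambda_{\sigma(k)}$ for strictly increasing $\sigma:\{1,\dots,k\}\to\{0,\dots,n\}$, and $\phi_\rho=\sum_{i=0}^k(-1)^i\lambda_{\rho(i)}\,d\lambda_{\rho(0)}\wedge\dots\widehat{d\lambda_{\rho(i)}}\dots\wedge d\lambda_{\rho(k)}$ for strictly increasing $\rho:\{0,\dots,k\}\to\{0,\dots,n\}$. All forms have complex coefficients. $P_r\Lambda^k(F)$ is spanned by the $\lambda^\alpha d\lambda_\sigma$ with $|\alpha|=r$, and $P_r^-\Lambda^k(F)$ by the $\lambda^\alpha\phi_\rho$ with $|\alpha|=r-1$; $\mathring P_r\Lambda^k(F)$ and $\mathring P_r^-\Lambda^k(F)$ are spanned by those of these forms for which the support of $\alpha$ together with the image of $\sigma$ (of $\rho$) is $\{0,\dots,n\}$. Sets $\mathcal A P_r\Lambda^k(F)$ and $\mathcal A P_r^-\Lambda^k(F)$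 are defined recursively, for all simplices $F$. (1) Degree zero. $\mathcal A P_0\Lambda^0(F)=\{a\}$ and $\mathcal A P_0\Lambda^n(F)=\{b\,d\lambda_1\wedge\dots\wedge d\lambda_n\}$ ($n=\dim F\ge1$), where the nonzero real numbers $a=a(F)$, $b=b(F)$ are arbitrary. If $F$ is a triangle, $\mathcal A P_0\Lambda^1(F)=\{d\lambda_0+\xi d\lambda_1+\xi^2d\lambda_2,\ d\lambda_0+\xi^2d\lambda_1+\xi d\lambda_2\}$ with $\xi=e^{2\pi i/3}$. If $F$ is a tetrahedron, $\mathcal A P_0\Lambda^1(F)=\{\psi_w,\psi_p,\psi_k\}$ and $\mathcal A P_0\Lambda^2(F)=\{\psi_w\wedge\psi_p,\psi_w\wedge\psi_k,\psi_p\wedge\psi_k\}$, where $\psi_w=d\lambda_0-d\lambda_1+d\lambda_2-d\lambda_3$, $\psi_p=d\lambda_0+d\lambda_1-d\lambda_2-d\lambda_3$, $\psi_k=d\lambda_0-d\lambda_1-d\lambda_2+d\lambda_3$. (2) Recursion. For $\dim F=m$ let $$\mathcal A\mathring P_r\Lambda^k(F)=J^{-1}\,\mathcal A P^-_{r-m+k}\Lambda^{m-k}(F),\qquad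 \mathcal A\mathring P^-_r\Lambda^k(F)=I\,\mathcal A P_{r-m+k-1}\Lambda^{m-k}(F)$$ (empty if the degree on the right is negative or $k>m$), where $I:P_s\Lambda^l(F)\to\mathring P^-_{s+l+1}\Lambda^{m-l}(F)$ and $J:\mathring P_{s+m-k}\Lambda^k(F)\to P^-_s\Lambda^{m-k}(F)$ are the linear isomorphisms with $I(\lambda^\alpha d\lambda_\sigma)=\epsilon(\sigma,\sigma^c)\lambda^\alpha\lambda_\sigma\phi_{\sigma^c}$ and $J(\lambda^\alpha\lambda_{\sigma^c}d\lambda_\sigma)=\epsilon(\sigma,\sigma^c)\lambda^\alpha\phi_{\sigma^c}$; here $\sigma^c$ is the increasing enumeration of the complement of the image of $\sigma$, $\lambda_\tau=\prod_{i\in\operatorname{im}\tau}\lambda_i$, and $\epsilon(\sigma,\sigma^c)$ is the sign of the permutation that sorts the sequence $\sigma,\sigma^c$. Then $$\mathcal A P_r\Lambda^k(F)=\bigcup_{G\subseteq F}\operatorname{ext}_{G,F}\mathcal A\mathring P_r\Lambda^k(G)\ (r\ge1),\qquad \mathcal A P_r^-\Lambda^k(F)=\bigcup_{G\subseteq F}\operatorname{ext}^-_{G,F}\mathcal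 A\mathring P_r^-\Lambda^k(G)\ (r\ge0),$$ where $G$ runs through all faces of $F$ (including $F$ itself and the vertices). With the vertices of $G$ labelled by their indices in $F$, the linear extension operators are given by $\operatorname{ext}^-_{G,F}(\lambda_G^\alpha\phi^G_\rho)=\lambda_F^\alpha\phi^F_\rho$ and $\operatorname{ext}_{G,F}(\lambda_G^\alpha d\lambda^G_\sigma)=\lambda_F^\alpha\Psi_{\sigma(1)}\wedge\dots\wedge\Psi_{\sigma(k)}$ with $\Psi_i=d\lambda^F_i-\frac{\alpha_i}{|\alpha|}\sum_{j\in G}d\lambda_j^F$. For $\mathbb K\in\{\mathbb R,\mathbb C\}$, a finite set $Q$ of forms on $T$ is called $\mathbb K$-invariant if for every affine automorphism $S$ of $T$ there are a permutation $\tau$ of $Q$ and nonzero numbers $\chi_\omega\in\mathbb K$ with $S^*\omega=\chi_\omega\,\tau(\omega)$ for all $\omega\in Q$. **Theorem.** Let $T$ be a tetrahedron and let $r\ge0$ be an integer. For $k=1,2$ the sets $\mathcal A P_r\Lambda^k(T)$ and $\mathcal A P_r^-\Lambda^k(T)$ are bases of $P_r\Lambda^k(T)$ and $P_r^-\Lambda^k(T)$,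 and they are $\mathbb C$-invariant. Moreover: * $\mathcal A P_r\Lambda^1(T)$ is $\mathbb R$-invariant if and only if $r\in\{0,1,2,4,5,8\}$; * $\mathcal A P_r^-\Lambda^1(T)$ is $\mathbb R$-invariant if and only if $r\in\{0,1,3,4,7\}$; * $\mathcal A P_r\Lambda^2(T)$ is $\mathbb R$-invariant if and only if $r\in\{0,1,2,4,5,8\}$; * $\mathcal A P_r^-\Lambda^2(T)$ is $\mathbb R$-invariant if and only if $r\in\{0,1,2,3,4,6,7,10\}$. If all the numbers $a(F)$, $b(F)$ are $\pm1$, then in these four bases every factor $\chi$ in a relation $S^*\omega=\chi\,\omega'$ between basis elements $\omega,\omega'$ has absolute value $1$. -/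

import Mathlib

open scoped BigOperators

noncomputable section

namespace FEEC

variable {E : Type*} [AddCommGroup E] [Module ℝ E]

/-! ### Simplices, barycentric coordinates, differential forms

An `n`-simplex is `Affine.Simplex ℝ E n`: an ordered list of `n + 1` affinely independent points.
For a set `fs` of `m + 1` vertex indices, `T.face h` is the subsimplex with these vertices, ordered
as in `T`; its `i`-th vertex is the vertex `fs.orderEmbOfFin h i` of `T`. -/

/-- The affine hull of a simplex. -/
abbrev hull {n : ℕ} (T : Affine.Simplex ℝ E n) : AffineSubspace ℝ E :=
  affineSpan ℝ (Set.range T.points)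

/-- The vertices of `T`, as an affine basis of the affine hull of `T`. -/
def vertexBasis {n : ℕ} (T : Affine.Simplex ℝ E n) : AffineBasis (Fin (n + 1)) ℝ (hull T) where
  toFun i := ⟨T.points i, mem_affineSpan ℝ (Set.mem_range_self i)⟩
  ind' := AffineIndependent.of_comp (hull T).subtype T.independent
  tot' := by
    have h := affineSpan_coe_preimage_eq_top (k := ℝ) (Set.range T.points)
    convert h using 2
    ext x
    constructor
    · rintro ⟨i, rfl⟩
      exact ⟨i, rfl⟩
    · rintro ⟨i, hi⟩
      exact ⟨i, Subtype.ext hi⟩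

/-- Complex valued `k`-forms on the closed simplex `T`: at every point of `T` an alternating
`k`-linear form on the tangent space of `T`. (No regularity is imposed here; all the forms that
occur below are polynomial.) -/
abbrev Form {n : ℕ} (T : Affine.Simplex ℝ E n) (k : ℕ) : Type _ :=
  T.closedInterior → (hull T).direction [⋀^Fin k]→ₗ[ℝ] ℂ

/-- The barycentric coordinate `λ_i` on `T`. -/
def bary {n : ℕ} (T : Affine.Simplex ℝ E n) (i : Fin (n + 1)) (x : T.closedInterior) : ℝ :=
  (vertexBasis T).coord i ⟨x, T.setInterior_subset_affineSpan x.2⟩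

/-- The (constant) differential `dλ_i`, a complex valued covector on the tangent space of `T`. -/
def dbary {n : ℕ} (T : Affine.Simplex ℝ E n) (i : Fin (n + 1)) : (hull T).direction →ₗ[ℝ] ℂ :=
  Complex.ofRealCLM.toLinearMap ∘ₗ ((vertexBasis T).coord i).linear

/-- The exterior product `ℓ_1 ∧ ⋯ ∧ ℓ_k` of covectors,
`(u_1, …, u_k) ↦ det (ℓ_i (u_j))`. -/
def wedge {V : Type*} [AddCommGroup V] [Module ℝ V] {k : ℕ} (ℓ : Fin k → V →ₗ[ℝ] ℂ) :
    V [⋀^Fin k]→ₗ[ℝ] ℂ :=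
  AlternatingMap.compLinearMap
    { (Matrix.detRowAlternating (n := Fin k) (R := ℂ)).toMultilinearMap.restrictScalars ℝ with
      map_eq_zero_of_eq' := fun v _ _ h hij =>
        (Matrix.detRowAlternating (n := Fin k) (R := ℂ)).map_eq_zero_of_eq v h hij }
    (LinearMap.pi ℓ)

theorem wedge_apply {V : Type*} [AddCommGroup V] [Module ℝ V] {k : ℕ} (ℓ : Fin k → V →ₗ[ℝ] ℂ)
    (u : Fin k → V) : wedge ℓ u = Matrix.det (Matrix.of fun i j => ℓ i (u j)) := by
  rw [← Matrix.det_transpose]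
  rfl

/-- The constant `k`-form on `T` with value `ℓ_1 ∧ ⋯ ∧ ℓ_k`. -/
def constForm {n k : ℕ} (T : Affine.Simplex ℝ E n) (ℓ : Fin k → (hull T).direction →ₗ[ℝ] ℂ) :
    Form T k :=
  fun _ => wedge ℓ

/-- The barycentric monomial `λ^α`, times a form. -/
def monomialMul {n k : ℕ} (T : Affine.Simplex ℝ E n) (α : Fin (n + 1) → ℕ) (ω : Form T k) :
    Form T k :=
  fun x => (∏ i, (bary T i x : ℂ) ^ α i) • ω x

/-- The barycentric alternator `dλ_σ = dλ_{σ(1)} ∧ ⋯ ∧ dλ_{σ(k)}`. -/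
def dbaryForm {n k : ℕ} (T : Affine.Simplex ℝ E n) (σ : Fin k → Fin (n + 1)) : Form T k :=
  constForm T fun i => dbary T (σ i)

/-- The Whitney form
`φ_ρ = ∑_i (-1)^i λ_{ρ(i)} dλ_{ρ(0)} ∧ ⋯ ∧ dλ_{ρ(i-1)} ∧ dλ_{ρ(i+1)} ∧ ⋯ ∧ dλ_{ρ(k)}`. -/
def whitneyForm {n k : ℕ} (T : Affine.Simplex ℝ E n) (ρ : Fin (k + 1) → Fin (n + 1)) : Form T k :=
  ∑ i : Fin (k + 1), (-1 : ℂ) ^ (i : ℕ) • monomialMul T (Pi.single (ρ i) 1) (dbaryForm T (ρ ∘ i.succAbove))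

/-! ### The finite element spaces -/

/-- The two families `P_r Λ^k` (`full`) and `P_r^- Λ^k` (`trimmed`). -/
inductive Family
  | full
  | trimmed

/-- `ℂP_r Λ^k(T)`, spanned by the `λ^α dλ_σ` with `|α| = r` and `σ` strictly increasing;
`ℂP_r^- Λ^k(T)`, spanned by the `λ^α φ_ρ` with `|α| = r - 1` and `ρ` strictly increasing. -/
def polySpace (fam : Family) (r k : ℕ) {n : ℕ} (T : Affine.Simplex ℝ E n) :
    Submodule ℂ (Form T k) :=
  match fam with
  | .full => Submodule.span ℂ {ω | ∃ (α : Fin (n + 1) → ℕ) (σ : Fin k ↪o Fin (n + 1)),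
      ∑ i, α i = r ∧ ω = monomialMul T α (dbaryForm T σ)}
  | .trimmed => Submodule.span ℂ {ω | ∃ (α : Fin (n + 1) → ℕ) (ρ : Fin (k + 1) ↪o Fin (n + 1)),
      (∑ i, α i) + 1 = r ∧ ω = monomialMul T α (whitneyForm T ρ)}

/-- `Q` is a basis of `W`. -/
def IsBasisOf {M : Type*} [AddCommGroup M] [Module ℂ M] (Q : Set M) (W : Submodule ℂ M) : Prop :=
  LinearIndepOn ℂ id Q ∧ Submodule.span ℂ Q = W

/-! ### Canonical isomorphisms and extension operators

All these operators are the linear maps with prescribed values on the canonical spanning sets.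
Each of them is given here by its graph, the linear span of the pairs
(element of the spanning set, prescribed value). -/

/-- The sign of the permutation that orders a sequence in ascending order. -/
def sortSign {N M : ℕ} (f : Fin N → Fin M) : ℂ :=
  ((Equiv.Perm.sign (Tuple.sort f) : ℤˣ) : ℤ)

/-- The indicator multiindex of the image of `σ`, so that `λ^(supp σ) = ∏_{i ∈ [σ]} λ_i`. -/
def supp {n k : ℕ} (σ : Fin k ↪o Fin (n + 1)) : Fin (n + 1) → ℕ :=
  ∑ i, Pi.single (σ i) 1

/-- The graph of the canonical isomorphism
`I : P_s Λ^l(T) → P̊^-_{s+l+1} Λ^k(T)`, `k + l = n`,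
`λ^α dλ_σ ↦ ε(σ, σᶜ) λ^α λ_σ φ_{σᶜ}`. -/
def isoIGraph {n : ℕ} (T : Affine.Simplex ℝ E n) (s l k : ℕ) :
    Submodule ℂ (Form T l × Form T k) :=
  Submodule.span ℂ {p | ∃ (α : Fin (n + 1) → ℕ) (σ : Fin l ↪o Fin (n + 1))
    (ρ : Fin (k + 1) ↪o Fin (n + 1)),
    ∑ i, α i = s ∧ IsCompl (Set.range σ) (Set.range ρ) ∧
    p = (monomialMul T α (dbaryForm T σ),
      sortSign (Fin.append σ ρ) • monomialMul T (α + supp σ) (whitneyForm T ρ))}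

/-- The graph of the canonical isomorphism
`J : P̊_{s+l} Λ^k(T) → P^-_s Λ^l(T)`, `k + l = n`,
`λ^α λ_{σᶜ} dλ_σ ↦ ε(σ, σᶜ) λ^α φ_{σᶜ}` with `|α| = s - 1`. -/
def isoJGraph {n : ℕ} (T : Affine.Simplex ℝ E n) (s l k : ℕ) :
    Submodule ℂ (Form T k × Form T l) :=
  Submodule.span ℂ {p | ∃ (α : Fin (n + 1) → ℕ) (σ : Fin k ↪o Fin (n + 1))
    (ρ : Fin (l + 1) ↪o Fin (n + 1)),
    (∑ i, α i) + 1 = s ∧ IsCompl (Set.range σ) (Set.range ρ) ∧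
    p = (monomialMul T (α + supp ρ) (dbaryForm T σ),
      sortSign (Fin.append σ ρ) • monomialMul T α (whitneyForm T ρ))}

/-- The extension by zero of a multiindex on a face. -/
def extendIndex {n m : ℕ} {fs : Finset (Fin (n + 1))} (h : fs.card = m + 1)
    (α : Fin (m + 1) → ℕ) : Fin (n + 1) → ℕ :=
  Function.extend (fs.orderEmbOfFin h) α 0

/-- The covector `Ψ_i = dλ_i - (α_i / |α|) ∑_{j ∈ F} dλ_j` on `T`. -/
def extCovector {n : ℕ} (T : Affine.Simplex ℝ E n) (fs : Finset (Fin (n + 1)))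
    (α : Fin (n + 1) → ℕ) (i : Fin (n + 1)) : (hull T).direction →ₗ[ℝ] ℂ :=
  dbary T i - ((α i : ℂ) / ((∑ j, α j : ℕ) : ℂ)) • ∑ j ∈ fs, dbary T j

/-- The graph of the extension operator `ext_{F,T}` of the family `fam`, `F = T.face h`:
`λ_F^α dλ^F_σ ↦ λ_T^α Ψ_σ` for `P_r Λ^k`, and `λ_F^α φ^F_ρ ↦ λ_T^α φ^T_ρ` for `P_r^- Λ^k`. -/
def extGraph (fam : Family) (r k : ℕ) {n m : ℕ} (T : Affine.Simplex ℝ E n)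
    {fs : Finset (Fin (n + 1))} (h : fs.card = m + 1) :
    Submodule ℂ (Form (T.face h) k × Form T k) :=
  match fam with
  | .full => Submodule.span ℂ {p | ∃ (α : Fin (m + 1) → ℕ) (σ : Fin k ↪o Fin (m + 1)),
      ∑ i, α i = r ∧
      p = (monomialMul (T.face h) α (dbaryForm (T.face h) σ),
        monomialMul T (extendIndex h α)
          (constForm T fun i => extCovector T fs (extendIndex h α) (fs.orderEmbOfFin h (σ i))))}
  | .trimmed => Submodule.span ℂ {p | ∃ (α : Fin (m + 1) → ℕ) (ρ : Fin (k + 1) ↪o Fin (m + 1)),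
      (∑ i, α i) + 1 = r ∧
      p = (monomialMul (T.face h) α (whitneyForm (T.face h) ρ),
        monomialMul T (extendIndex h α) (whitneyForm T (fs.orderEmbOfFin h ∘ ρ)))}

/-- The image of a set under the map with graph `G`. -/
def graphImage {M N : Type*} [AddCommGroup M] [Module ℂ M] [AddCommGroup N] [Module ℂ N]
    (G : Submodule ℂ (M × N)) (A : Set M) : Set N :=
  {y | ∃ x ∈ A, (x, y) ∈ G}

/-- The image of a set under the inverse of the map with graph `G`. -/
def graphInvImage {M N : Type*} [AddCommGroup M] [Module ℂ M] [AddCommGroup N] [Module ℂ N]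
    (G : Submodule ℂ (M × N)) (A : Set N) : Set M :=
  {x | ∃ y ∈ A, (x, y) ∈ G}

/-! ### The recursive construction -/

/-- `exp (2πi/3)`. -/
def ξ₃ : ℂ := Complex.exp (2 * Real.pi * Complex.I / 3)

/-- The covectors `ψ_w, ψ_p, ψ_k` on a tetrahedron. -/
def ψ (T : Affine.Simplex ℝ E 3) : Fin 3 → (hull T).direction →ₗ[ℝ] ℂ :=
  ![dbary T 0 - dbary T 1 + dbary T 2 - dbary T 3,
    dbary T 0 + dbary T 1 - dbary T 2 - dbary T 3,
    dbary T 0 - dbary T 1 - dbary T 2 + dbary T 3]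

/-- The bases `AP_0 Λ^k(T)` of the constant forms in the intermediate degrees `0 < k < n`,
for `n ≤ 3` (higher dimensions are not used). -/
def middleConstBasis : {n : ℕ} → (T : Affine.Simplex ℝ E n) → (k : ℕ) → Set (Form T k)
  | 2, T, 1 =>
      {constForm T ![dbary T 0 + ξ₃ • dbary T 1 + ξ₃ ^ 2 • dbary T 2],
        constForm T ![dbary T 0 + ξ₃ ^ 2 • dbary T 1 + ξ₃ • dbary T 2]}
  | 3, T, 1 => {constForm T ![ψ T 0], constForm T ![ψ T 1], constForm T ![ψ T 2]}
  | 3, T, 2 =>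
      {constForm T ![ψ T 0, ψ T 1], constForm T ![ψ T 0, ψ T 2], constForm T ![ψ T 1, ψ T 2]}
  | _, _, _ => ∅

/-- The bases `AP_0 Λ^k(T)` of the constant forms. On the one-dimensional real spaces of constant
functions and of constant volume forms an arbitrary real basis is admitted: `{a}`, respectively
`{b dλ_1 ∧ ⋯ ∧ dλ_n}`, with nonzero real numbers `a`, `b` that may depend on the simplex. -/
def constBasis (a b : ∀ m : ℕ, Affine.Simplex ℝ E m → ℝ) {n : ℕ} (T : Affine.Simplex ℝ E n)
    (k : ℕ) : Set (Form T k) :=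
  if k = 0 then {(a n T : ℂ) • dbaryForm T (fun _ => 0)}
  else if h : k = n then {(b n T : ℂ) • dbaryForm T (fun i : Fin k => (Fin.cast h i).succ)}
  else middleConstBasis T k

/-- The recursively constructed bases `AP_r Λ^k(T)` and `AP_r^- Λ^k(T)`: they are
`⋃_F ext_{F,T} (J⁻¹ (AP^-_{r-m+k} Λ^{m-k}(F)))`, `r ≥ 1`, and
`⋃_F ext_{F,T} (I (AP_{r-m+k-1} Λ^{m-k}(F)))`, where `F` runs through all the faces of `T`,
of any dimension `m`. Faces with `m < k`, and those for which the degree `r-m+k` or `r-m+k-1` is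
negative, contribute nothing. Below, `l = m - k`, and `s` is the lower polynomial degree. -/
def recBasis (a b : ∀ m : ℕ, Affine.Simplex ℝ E m → ℝ) :
    (fam : Family) → (r k : ℕ) → {n : ℕ} → (T : Affine.Simplex ℝ E n) → Set (Form T k)
  | .full, 0, k, _, T => constBasis a b T k
  | .full, r + 1, k, n, T =>
      ⋃ (m : ℕ) (fs : Finset (Fin (n + 1))) (h : fs.card = m + 1) (l : ℕ) (s : ℕ)
        (_ : k + l = m) (_ : s + l = r + 1),
        graphImage (extGraph .full (r + 1) k T h)
          (graphInvImage (isoJGraph (T.face h) s l k) (recBasis a b .trimmed s l (T.face h)))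
  | .trimmed, r, k, n, T =>
      ⋃ (m : ℕ) (fs : Finset (Fin (n + 1))) (h : fs.card = m + 1) (l : ℕ) (s : ℕ)
        (_ : k + l = m) (_ : s + l + 1 = r),
        graphImage (extGraph .trimmed r k T h)
          (graphImage (isoIGraph (T.face h) s l k) (recBasis a b .full s l (T.face h)))
termination_by fam r => 2 * r + (match fam with | .full => 1 | .trimmed => 0)
decreasing_by all_goals omega

/-! ### Invariance -/

/-- `S` is a symmetry of `T`: an affine automorphism (of the affine hull) that maps `T` onto `T`.
These are the maps that permute the vertices of `T`. -/
def IsSymmetry {n : ℕ} (T : Affine.Simplex ℝ E n) (S : hull T ≃ᵃ[ℝ] hull T) : Prop :=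
  ∀ x : hull T, (S x : E) ∈ T.closedInterior ↔ (x : E) ∈ T.closedInterior

/-- The pullback `S^* ω` of a form along a symmetry of `T`. -/
def pullback {n k : ℕ} {T : Affine.Simplex ℝ E n} {S : hull T ≃ᵃ[ℝ] hull T}
    (hS : IsSymmetry T S) (ω : Form T k) : Form T k :=
  fun x =>
    (ω ⟨S ⟨x, T.setInterior_subset_affineSpan x.2⟩, (hS _).2 x.2⟩).compLinearMap
      (S.linear : (hull T).direction →ₗ[ℝ] (hull T).direction)

/-- The finite set `Q` of forms is invariant under all symmetries of `T`, up to factors from the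
set `U` of complex numbers: every symmetry `S` acts by `S^* ω = χ_ω τ(ω)` for a permutation `τ` of
`Q` and numbers `χ_ω ∈ U`. -/
def IsInvariantUpTo (U : Set ℂ) {n k : ℕ} {T : Affine.Simplex ℝ E n} (Q : Set (Form T k)) : Prop :=
  Q.Finite ∧ ∀ (S : hull T ≃ᵃ[ℝ] hull T) (hS : IsSymmetry T S),
    ∃ (τ : Equiv.Perm Q) (χ : Q → ℂ), (∀ ω, χ ω ∈ U) ∧
      ∀ ω : Q, pullback hS (ω : Form T k) = χ ω • (τ ω : Form T k)

/-- `ℂ`-invariance: the factors are nonzero complex numbers. -/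
def IsCInvariant {n k : ℕ} {T : Affine.Simplex ℝ E n} (Q : Set (Form T k)) : Prop :=
  IsInvariantUpTo {z : ℂ | z ≠ 0} Q

/-- `ℝ`-invariance: the factors are nonzero real numbers. -/
def IsRInvariant {n k : ℕ} {T : Affine.Simplex ℝ E n} (Q : Set (Form T k)) : Prop :=
  IsInvariantUpTo {z : ℂ | ∃ x : ℝ, x ≠ 0 ∧ z = x} Q

/-- Whenever a symmetry of `T` maps a member of `Q` to a multiple of a member of `Q`, the factor
is a complex unit. -/
def HasUnitFactors {n k : ℕ} {T : Affine.Simplex ℝ E n} (Q : Set (Form T k)) : Prop :=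
  ∀ (S : hull T ≃ᵃ[ℝ] hull T) (hS : IsSymmetry T S), ∀ ω ∈ Q, ∀ η ∈ Q, ∀ χ : ℂ,
    pullback hS ω = χ • η → ‖χ‖ = 1

end FEEC

end

open FEEC

set_option linter.unusedSectionVars false

noncomputable section

namespace FEEC

/-! ### Bases, graphs and independent families of subspaces -/

section LinearAlgebra

variable {M N : Type*} [AddCommGroup M] [Module ℂ M] [AddCommGroup N] [Module ℂ N]

/-! Barycentric coordinates identify every simplex with the standard simplex (`toStd`) and its
affine symmetries with the permutations of its vertices (`IsSymmetry.exists_perm`,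
`exists_symmetry`, `toStd_pullback`). Everything is then proved for forms on the standard simplex.

The operators I, J and ext are prescribed on spanning sets that satisfy linear relations, so their
consistency is part of the problem. For I and J it comes from an intrinsic description (`starI`,
`starJ`): the values of one form on the edges of a face and the values of the other form at `x` on
the vectors from `x` to the complementary vertices differ only by a sign and a product of
barycentric coordinates. Each kind of value determines a form, the product can be cancelled among
homogeneous polynomials, and a permutation of the vertices changes only the sign. For ext,
consistency comes from the uniqueness of homogeneous polynomial expressions on the simplex
(`extGraph_fst_zero`), and restriction to the face is a left inverse (`pull_extGraph`).

Restriction to a face G annihilates the contribution of every face not contained in G and is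
injective on the contribution of G. This triangular structure makes the space the direct sum of the
contributions of the faces (`iSup_faceSpace`, `iSupIndep_faceSpace`). Each contribution is the
isomorphic image of a space of lower or equal degree on the face, so induction on the degree reduces
the basis property to the constant forms (`isBasisOf_stdBasis`).

All the operators commute with permutations up to sign. Hence the factors are, up to sign, those of
the constant bases: ratios of the numbers `a` or `b`, and powers of `ξ₃`, the latter only for
one-forms on triangles. Invariance over ℂ and the statement on unit factors follow
(`isEquivariant_all`).

Reality is a matter of degrees. On a triangle, full one-forms of degree r come from trimmed ones of
degree r-1, and these from full ones of degree r-3; nonreal factors occur for r ≡ 0 mod 3 (full) and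
r ≡ 2 mod 3 (trimmed). On the tetrahedron, full one-forms of degree r meet a nonreal factor on a
triangular face when r is a positive multiple of 3, and inherit one from degree r-4 through the
interior; this leaves 0, 1, 2, 4, 5, 8. For trimmed one-forms the residue is 2 and the step is again
4, which leaves 0, 1, 3, 4, 7. In positive degree, full two-forms of degree r depend on trimmed
one-forms of degree r-1, and trimmed two-forms on full one-forms of degree r-2. In the remaining
degrees some permutation multiplies a basis form by a nonreal number (`IsRotating`), which linear
independence makes incompatible with real factors. -/

theorem exists_linearMap_of_graph {C : Submodule ℂ (M × N)} {W : Submodule ℂ M}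
    (hfun : ∀ y, ((0 : M), y) ∈ C → y = 0) (hdom : ∀ x ∈ W, ∃ y, (x, y) ∈ C) :
    ∃ F : M →ₗ[ℂ] N, ∀ x ∈ W, ∀ y, (x, y) ∈ C ↔ y = F x := by
  have huniq : ∀ x y z, (x, y) ∈ C → (x, z) ∈ C → y = z := fun x y z hy hz => by
    have h := C.sub_mem hy hz
    rw [Prod.mk_sub_mk, sub_self] at h
    exact sub_eq_zero.1 (hfun _ h)
  choose f hf using fun x : W => hdom x x.2
  let f' : W →ₗ[ℂ] N :=
    { toFun := f
      map_add' := fun x y => huniq _ _ _ (hf (x + y)) (C.add_mem (hf x) (hf y))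
      map_smul' := fun c x => huniq _ _ _ (hf (c • x)) (C.smul_mem c (hf x)) }
  -- Outside `W` the extension is arbitrary; only the values on `W` matter.
  obtain ⟨F, hF⟩ := f'.exists_extend
  have hFx : ∀ x (hx : x ∈ W), F x = f ⟨x, hx⟩ := fun x hx => by
    rw [← show f' ⟨x, hx⟩ = f ⟨x, hx⟩ from rfl, ← hF]
    rfl
  refine ⟨F, fun x hx y => ⟨fun h => ?_, fun h => ?_⟩⟩
  · rw [hFx x hx]
    exact huniq _ _ _ h (hf ⟨x, hx⟩)
  · rw [h, hFx x hx]
    exact hf ⟨x, hx⟩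

theorem IsBasisOf.subset {Q : Set M} {W : Submodule ℂ M} (h : IsBasisOf Q W) {x : M}
    (hx : x ∈ Q) : x ∈ W :=
  h.2 ▸ Submodule.subset_span hx

theorem IsBasisOf.image {Q : Set M} {W : Submodule ℂ M} (h : IsBasisOf Q W) (F : M →ₗ[ℂ] N)
    (hF : ∀ x ∈ W, F x = 0 → x = 0) : IsBasisOf (F '' Q) (W.map F) := by
  refine ⟨?_, by rw [← Submodule.map_span, h.2]⟩
  have hd : Disjoint (Submodule.span ℂ (id '' Q)) (LinearMap.ker F) := by
    rw [Set.image_id, h.2, Submodule.disjoint_def]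
    exact fun x hx hx0 => hF x hx hx0
  rw [Set.image_id] at hd
  exact h.1.image hd

/-- Each step of the recursion moves a basis along a linear relation. For a relation, being
single-valued and being injective need only be tested at zero. -/
theorem IsBasisOf.graphImage {C : Submodule ℂ (M × N)} {A : Set M} {W : Submodule ℂ M}
    {Z : Submodule ℂ N} (hA : IsBasisOf A W)
    (hfun : ∀ y, ((0 : M), y) ∈ C → y = 0) (hinj : ∀ x, (x, (0 : N)) ∈ C → x = 0)
    (hdom : ∀ x ∈ W, ∃ y ∈ Z, (x, y) ∈ C) (hran : ∀ y ∈ Z, ∃ x ∈ W, (x, y) ∈ C) :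
    IsBasisOf (graphImage C A) Z := by
  obtain ⟨F, hF⟩ := exists_linearMap_of_graph hfun
    (W := W) (fun x hx => (hdom x hx).imp fun _ h => h.2)
  have h1 : FEEC.graphImage C A = F '' A := by
    ext y
    constructor
    · rintro ⟨x, hx, hxy⟩
      exact ⟨x, hx, ((hF x (hA.subset hx) y).1 hxy).symm⟩
    · rintro ⟨x, hx, rfl⟩
      exact ⟨x, hx, (hF x (hA.subset hx) _).2 rfl⟩
  have h2 : W.map F = Z := by
    ext y
    constructor
    · rintro ⟨x, hx, rfl⟩
      obtain ⟨y, hy, hxy⟩ := hdom x hx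
      rwa [← (hF x hx y).1 hxy]
    · intro hy
      obtain ⟨x, hx, hxy⟩ := hran y hy
      exact ⟨x, hx, ((hF x hx y).1 hxy).symm⟩
  rw [h1, ← h2]
  exact hA.image F fun x hx h0 => hinj x ((hF x hx 0).2 h0.symm)

theorem isBasisOf_iUnion {ι : Type*} {B : ι → Set M} {Z : ι → Submodule ℂ M}
    (hB : ∀ i, IsBasisOf (B i) (Z i)) (hZ : iSupIndep Z) :
    IsBasisOf (⋃ i, B i) (⨆ i, Z i) := by
  refine ⟨linearIndepOn_id_iUnion_finite (fun i => (hB i).1) fun i t _ hit => ?_, ?_⟩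
  · simp only [(hB _).2]
    exact hZ.disjoint_biSup hit
  · rw [Submodule.span_iUnion]
    exact iSup_congr fun i => (hB i).2

theorem isBasisOf_empty : IsBasisOf (∅ : Set M) ⊥ :=
  ⟨linearIndepOn_empty ℂ id, Submodule.span_empty⟩

/-- `K G` plays the role of the kernel of the restriction to the face `G`. In a vanishing sum,
induction on the cardinality removes the terms of the proper subsets of `G`, all other terms except
that of `G` lie in `K G`, and so the term of `G` lies in the zero intersection of `Z G` and `K G`.
-/
theorem iSupIndep_of_triangular {κ : Type*} [DecidableEq κ] {Z K : Finset κ → Submodule ℂ M}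
    (hK : ∀ G G', ¬ G' ⊆ G → Z G' ≤ K G) (hd : ∀ G, Disjoint (Z G) (K G)) : iSupIndep Z := by
  classical
  rw [iSupIndep_iff_finsetSum_eq_zero_imp_eq_zero]
  intro s v hv h0
  have key : ∀ n, ∀ G ∈ s, G.card = n → v G = 0 := by
    intro n
    induction n using Nat.strong_induction_on with
    | _ n ih =>
      intro G hG hn
      refine Submodule.disjoint_def.1 (hd G) _ (hv G hG) ?_
      rw [← Finset.add_sum_erase s v hG] at h0
      rw [eq_neg_of_add_eq_zero_left h0]
      refine neg_mem (sum_mem fun G' hG' => ?_)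
      obtain ⟨hne, hG's⟩ := Finset.mem_erase.1 hG'
      by_cases h : G' ⊆ G
      · rw [ih G'.card (hn ▸ Finset.card_lt_card (h.ssubset_of_ne hne)) G' hG's rfl]
        exact zero_mem _
      · exact hK G G' h (hv G' hG's)
  exact fun G hG => key _ G hG rfl

/-- Sorting an injective sequence costs only a sign. This allows spans over increasing sequences to
be replaced by spans over all sequences, a form that permutations of the vertices preserve. -/
theorem alternating_mem {k n : ℕ} {S : Submodule ℂ M} (A : (Fin k → Fin n) → M)
    (hperm : ∀ (s : Equiv.Perm (Fin k)) σ, A (σ ∘ s) = ((Equiv.Perm.sign s : ℤ) : ℂ) • A σ)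
    (hinj : ∀ σ, ¬ Function.Injective σ → A σ = 0) (hS : ∀ σ : Fin k ↪o Fin n, A σ ∈ S)
    (σ : Fin k → Fin n) : A σ ∈ S := by
  by_cases hσ : Function.Injective σ
  · have hmono : StrictMono (σ ∘ Tuple.sort σ) :=
      (Tuple.monotone_sort σ).strictMono_of_injective (hσ.comp (Tuple.sort σ).injective)
    have h := hperm (Tuple.sort σ)⁻¹ (σ ∘ Tuple.sort σ)
    have h2 : (σ ∘ Tuple.sort σ) ∘ ((Tuple.sort σ)⁻¹ : Equiv.Perm (Fin k)) = σ := by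
      ext i
      simp
    rw [h2] at h
    rw [h]
    exact S.smul_mem _ (hS (OrderEmbedding.ofStrictMono _ hmono))
  · rw [hinj σ hσ]
    exact zero_mem _

end LinearAlgebra

/-! ### Homogeneous polynomials on the standard simplex -/

open MvPolynomial in
-- On the simplex the coordinates sum to one, so a general polynomial may vanish there without being
-- zero. A homogeneous one cannot: dividing a positive point by its coordinate sum lands on the
-- simplex, so the polynomial vanishes on a product of infinite sets.
theorem eq_zero_of_eval_stdSimplex {ι : Type*} [Fintype ι] [Nonempty ι] {r : ℕ}
    {p : MvPolynomial ι ℂ} (hp : p.IsHomogeneous r)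
    (h : ∀ x ∈ stdSimplex ℝ ι, eval (fun i => (x i : ℂ)) p = 0) : p = 0 := by
  refine funext_set (fun _ => (fun t : ℝ => (t : ℂ)) '' Set.Ioi 0) (fun _ =>
    (Set.Ioi_infinite (0 : ℝ)).image Complex.ofReal_injective.injOn) fun x hx => ?_
  choose y hy using fun i => hx i (Set.mem_univ i)
  have hy0 : ∀ i, 0 < y i := fun i => (hy i).1
  have hs : 0 < ∑ i, y i := Finset.sum_pos (fun i _ => hy0 i) Finset.univ_nonempty
  have hx' : x = fun i => ((∑ i, y i : ℝ) : ℂ) * (((y i / ∑ i, y i : ℝ)) : ℂ) := by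
    ext i
    rw [← (hy i).2, ← Complex.ofReal_mul, mul_div_cancel₀ _ hs.ne']
  have hz := h (fun i => y i / ∑ i, y i) ⟨fun i => by have := hy0 i; positivity,
    by rw [← Finset.sum_div, div_self hs.ne']⟩
  rw [map_zero, hx', eval_eq']
  have key : ∀ d ∈ p.support, coeff d p * ∏ i, (((∑ i, y i : ℝ) : ℂ) *
      (((y i / ∑ i, y i : ℝ)) : ℂ)) ^ d i = ((∑ i, y i : ℝ) : ℂ) ^ r *
        (coeff d p * ∏ i, (((y i / ∑ i, y i : ℝ)) : ℂ) ^ d i) := fun d hd => by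
    have hdr : ∑ i, d i = r := by
      rw [← hp (mem_support_iff.1 hd), Finsupp.weight_apply, Finsupp.sum_fintype _ _ (by simp)]
      simp
    simp only [mul_pow]
    rw [Finset.prod_mul_distrib, Finset.prod_pow_eq_pow_sum, hdr]
    ring
  rw [Finset.sum_congr rfl key, ← Finset.mul_sum, ← eval_eq', hz, mul_zero]

/-! ### Determinants and complementary index sequences -/

section Det

variable {ι : Type*} [DecidableEq ι] {α β : Type*} [Fintype α] [DecidableEq α] [Fintype β]
  [DecidableEq β]

theorem det_sumElim_left (f : α ⊕ β ≃ ι) (w : β → ι → ℂ) :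
    Matrix.det (Matrix.of fun i j => Sum.elim (fun a => Pi.single (f (Sum.inl a)) 1) w i (f j)) =
      Matrix.det (Matrix.of fun i j => w i (f (Sum.inr j))) := by
  rw [← Matrix.fromBlocks_toBlocks (Matrix.of fun i j => _), Matrix.toBlocks₁₂,
    Matrix.toBlocks₁₁]
  have h1 : (Matrix.of fun (i j : α) => (Matrix.of fun i j =>
      Sum.elim (fun a => (Pi.single (f (Sum.inl a)) 1 : ι → ℂ)) w i (f j)) (Sum.inl i) (Sum.inl j))
      = 1 := by
    ext i j
    simp [Matrix.one_apply, Pi.single_apply, eq_comm]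
  have h2 : (Matrix.of fun (i : α) (j : β) => (Matrix.of fun i j =>
      Sum.elim (fun a => (Pi.single (f (Sum.inl a)) 1 : ι → ℂ)) w i (f j)) (Sum.inl i) (Sum.inr j))
      = 0 := by
    ext i j
    simp
  rw [h1, h2, Matrix.det_fromBlocks_zero₁₂, Matrix.det_one, one_mul]
  rfl

theorem det_sumElim_right (f : α ⊕ β ≃ ι) (w : α → ι → ℂ) :
    Matrix.det (Matrix.of fun i j => Sum.elim w (fun b => Pi.single (f (Sum.inr b)) 1) i (f j)) =
      Matrix.det (Matrix.of fun i j => w i (f (Sum.inl j))) := by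
  refine Eq.trans ?_ (det_sumElim_left ((Equiv.sumComm β α).trans f) w)
  rw [← Matrix.det_submatrix_equiv_self (Equiv.sumComm β α)]
  congr 1
  ext i j
  rcases i with i | i <;> simp

end Det

theorem det_reorder {ι α : Type*} [Fintype α] [DecidableEq α] (f f₀ : α ≃ ι) (v : α → ι → ℂ) :
    Matrix.det (Matrix.of fun i j => v i (f j)) =
      ((Equiv.Perm.sign (f.trans f₀.symm) : ℤ) : ℂ) *
        Matrix.det (Matrix.of fun i j => v i (f₀ j)) := by
  rw [← Matrix.det_permute' (f.trans f₀.symm)]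
  congr 1
  ext i j
  simp

/-- The sign of an enumeration of `Fin (p + q + 1)` by a sequence of length `p` followed by a
sequence of length `q + 1`. -/
def orderSign {p q : ℕ} (f : Fin p ⊕ Fin (q + 1) ≃ Fin (p + q + 1)) : ℂ :=
  ((Equiv.Perm.sign (f.trans (finSumFinEquiv (m := p) (n := q + 1)).symm) : ℤ) : ℂ)

theorem intUnit_mul_self (u : ℤˣ) : ((u : ℤ) : ℂ) * ((u : ℤ) : ℂ) = 1 := by
  rcases Int.units_eq_one_or u with h | h <;> simp [h]

theorem orderSign_mul_self {p q : ℕ} (f : Fin p ⊕ Fin (q + 1) ≃ Fin (p + q + 1)) :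
    orderSign f * orderSign f = 1 :=
  intUnit_mul_self _

theorem orderSign_ne_zero {p q : ℕ} (f : Fin p ⊕ Fin (q + 1) ≃ Fin (p + q + 1)) :
    orderSign f ≠ 0 := fun h => by simpa [h] using orderSign_mul_self f

theorem orderSign_trans {p q : ℕ} (f : Fin p ⊕ Fin (q + 1) ≃ Fin (p + q + 1))
    (π : Equiv.Perm (Fin (p + q + 1))) :
    orderSign (f.trans π) = ((Equiv.Perm.sign π : ℤ) : ℂ) * orderSign f := by
  have h : (f.trans π).trans (finSumFinEquiv (m := p) (n := q + 1)).symm =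
      (f.trans (finSumFinEquiv (m := p) (n := q + 1)).symm).trans
        (((finSumFinEquiv (m := p) (n := q + 1)).trans π).trans
          (finSumFinEquiv (m := p) (n := q + 1)).symm) := by
    ext x
    simp
  have h2 : Equiv.Perm.sign (((finSumFinEquiv (m := p) (n := q + 1)).trans π).trans
          (finSumFinEquiv (m := p) (n := q + 1)).symm) = Equiv.Perm.sign π :=
    Equiv.Perm.sign_trans_trans_symm π (finSumFinEquiv (m := p) (n := q + 1))
  rw [orderSign, h, Equiv.Perm.sign_trans, h2, orderSign]
  push_cast
  rfl

theorem sortSign_append {p q : ℕ} (f : Fin p ⊕ Fin (q + 1) ≃ Fin (p + q + 1)) :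
    sortSign (Fin.append (fun i => f (Sum.inl i)) (fun j => f (Sum.inr j))) = orderSign f := by
  have h1 : Fin.append (fun i => f (Sum.inl i)) (fun j => f (Sum.inr j)) =
      (((finSumFinEquiv (m := p) (n := q + 1)).symm.trans f :
        Equiv.Perm (Fin (p + q + 1))) : Fin (p + q + 1) → Fin (p + q + 1)) := by
    refine funext fun i => ?_
    refine Fin.addCases (fun i => ?_) (fun i => ?_) i <;> simp
  rw [h1]
  set g : Equiv.Perm (Fin (p + q + 1)) := (finSumFinEquiv (m := p) (n := q + 1)).symm.trans f
    with hg
  -- The only monotone permutation is the identity, so sorting a permutation means inverting it.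
  have h2 : g * Tuple.sort g = 1 :=
    (Equiv.Perm.monotone_iff (g * Tuple.sort g)).1 (Tuple.monotone_sort g)
  have h3 : Tuple.sort g = g⁻¹ := eq_inv_of_mul_eq_one_right h2
  unfold sortSign
  rw [h3, Equiv.Perm.sign_inv, orderSign]
  congr 2
  have := Equiv.Perm.sign_symm_trans_trans
    (f.trans (finSumFinEquiv (m := p) (n := q + 1)).symm) (finSumFinEquiv (m := p) (n := q + 1))
  rw [← this]
  congr 1
  ext x
  simp [hg]

/-- Moving the head of the second sequence to the front of the first one. -/
def shiftHead (p q : ℕ) : Fin p ⊕ Fin (q + 1) ≃ Fin (p + 1) ⊕ Fin q where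
  toFun := Sum.elim (fun i => Sum.inl i.succ) (Fin.cases (Sum.inl 0) Sum.inr)
  invFun := Sum.elim (Fin.cases (Sum.inr 0) Sum.inl) (fun j => Sum.inr j.succ)
  left_inv := by
    rintro (i | i)
    · simp
    · refine Fin.cases ?_ (fun j => ?_) i <;> simp
  right_inv := by
    rintro (i | i)
    · refine Fin.cases ?_ (fun j => ?_) i <;> simp
    · simp

/-- Consider the square matrix whose rows are the unit vectors at the `f (inl i)`, the vector `w`,
and the unit vectors at the `e (inr j)`. With columns in the order `f` the first unit vectors split
off an identity block; with columns in the order `e` the last ones do. Both sides are thus the same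
determinant, taken with columns in the standard order. Nothing relates `e` to `f`. -/
theorem orderSign_mul_det {p q : ℕ} (f : Fin p ⊕ Fin (q + 1) ≃ Fin (p + q + 1))
    (e : Fin (p + 1) ⊕ Fin q ≃ Fin (p + q + 1)) (w : Fin (p + q + 1) → ℂ) :
    orderSign f * Matrix.det (Matrix.of fun i j : Fin (q + 1) =>
        (Fin.cons w (fun j => Pi.single (e (Sum.inr j)) 1) : Fin (q + 1) → Fin (p + q + 1) → ℂ)
          j (f (Sum.inr i))) =
      orderSign ((shiftHead p q).trans e) * Matrix.det (Matrix.of fun i j : Fin (p + 1) =>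
        (Fin.cons w (fun j => Pi.single (f (Sum.inl j)) 1) : Fin (p + 1) → Fin (p + q + 1) → ℂ)
          j (e (Sum.inl i))) := by
  set v : Fin p ⊕ Fin (q + 1) → Fin (p + q + 1) → ℂ := Sum.elim
    (fun a => Pi.single (f (Sum.inl a)) 1) (Fin.cons w (fun j => Pi.single (e (Sum.inr j)) 1))
    with hv
  have h1 := det_sumElim_left f (Fin.cons w (fun j => Pi.single (e (Sum.inr j)) 1))
  have h2 := det_sumElim_right e (Fin.cons w (fun j => Pi.single (f (Sum.inl j)) 1))
  rw [← hv, det_reorder f (finSumFinEquiv (m := p) (n := q + 1))] at h1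
  have h3 : Matrix.det (Matrix.of fun i j => v i (((shiftHead p q).trans e) j)) =
      Matrix.det (Matrix.of fun i j => Sum.elim
        (Fin.cons w (fun j => Pi.single (f (Sum.inl j)) 1) : Fin (p + 1) → Fin (p + q + 1) → ℂ)
        (fun b => Pi.single (e (Sum.inr b)) 1) i (e j)) := by
    rw [← Matrix.det_submatrix_equiv_self (shiftHead p q)]
    congr 1
    ext i j
    rcases i with i | i
    · simp [hv, shiftHead]
    · refine Fin.cases ?_ (fun j => ?_) i <;> simp [hv, shiftHead]
  rw [← h3, det_reorder _ (finSumFinEquiv (m := p) (n := q + 1))] at h2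
  rw [← Matrix.det_transpose, ← Matrix.det_transpose (Matrix.of fun i j : Fin (p + 1) => _)]
  refine (congrArg (orderSign f * ·) h1.symm).trans (Eq.trans ?_
    (congrArg (orderSign ((shiftHead p q).trans e) * ·) h2))
  rw [← orderSign, ← orderSign, ← mul_assoc, ← mul_assoc, orderSign_mul_self, orderSign_mul_self]

/-- Multiplying the row of `ρ i` by `x (ρ i)`, or the column of `μ j` by `x (μ j)`, gives the same
matrix, because the entries outside the first column are Kronecker deltas. This trades the column
`x` of a Whitney form for the column of ones of an alternator. -/
theorem prod_mul_det_cons {ι : Type*} [DecidableEq ι] {q : ℕ} (x : ι → ℂ) (ρ : Fin (q + 1) → ι)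
    (μ : Fin q → ι) :
    (∏ i, x (ρ i)) * Matrix.det (Matrix.of fun i j : Fin (q + 1) =>
        (Fin.cons (fun _ => 1) (fun j => Pi.single (μ j) 1) : Fin (q + 1) → ι → ℂ) j (ρ i)) =
      (∏ j, x (μ j)) * Matrix.det (Matrix.of fun i j : Fin (q + 1) =>
        (Fin.cons x (fun j => Pi.single (μ j) 1) : Fin (q + 1) → ι → ℂ) j (ρ i)) := by
  have h : (∏ j, x (μ j)) = ∏ j : Fin (q + 1), (Fin.cons 1 (fun j => x (μ j)) : Fin (q + 1) → ℂ) j := by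
    rw [Fin.prod_univ_succ]
    simp
  rw [h, ← Matrix.det_mul_column, ← Matrix.det_mul_row]
  congr 1
  ext i j
  refine Fin.cases ?_ (fun j => ?_) j
  · simp
  · simp only [Matrix.of_apply, Fin.cons_succ, Pi.single_apply]
    split_ifs with h
    · rw [h]
    · simp

/-! ### Exterior products of covectors -/

section Wedge

variable {V W : Type*} [AddCommGroup V] [Module ℝ V] [AddCommGroup W] [Module ℝ W] {k : ℕ}

theorem wedge_comp_perm (ℓ : Fin k → V →ₗ[ℝ] ℂ) (s : Equiv.Perm (Fin k)) :
    wedge (fun i => ℓ (s i)) = ((Equiv.Perm.sign s : ℤ) : ℂ) • wedge ℓ := by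
  ext u
  rw [AlternatingMap.smul_apply, wedge_apply, wedge_apply, smul_eq_mul, ← Matrix.det_permute]
  rfl

theorem wedge_eq_zero_of_eq (ℓ : Fin k → V →ₗ[ℝ] ℂ) {i j : Fin k} (hij : i ≠ j)
    (h : ℓ i = ℓ j) : wedge ℓ = 0 := by
  ext u
  rw [wedge_apply]
  exact Matrix.det_zero_of_row_eq hij (by ext; simp [h])

theorem wedge_compLinearMap (ℓ : Fin k → V →ₗ[ℝ] ℂ) (f : W →ₗ[ℝ] V) :
    (wedge ℓ).compLinearMap f = wedge (fun i => ℓ i ∘ₗ f) := by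
  ext u
  simp [wedge_apply]

theorem wedge_update_apply (ℓ : Fin k → V →ₗ[ℝ] ℂ) (i : Fin k) (z : V →ₗ[ℝ] ℂ) (u : Fin k → V) :
    wedge (Function.update ℓ i z) u =
      ((Matrix.of fun a b => ℓ a (u b)).updateRow i fun b => z (u b)).det := by
  rw [wedge_apply]
  congr 1
  ext a b
  by_cases h : a = i
  · subst h
    simp
  · simp [h]

/-- The exterior product as a multilinear map. -/
def wedgeMultilinear (V : Type*) [AddCommGroup V] [Module ℝ V] (k : ℕ) :
    MultilinearMap ℂ (fun _ : Fin k => V →ₗ[ℝ] ℂ) (V [⋀^Fin k]→ₗ[ℝ] ℂ) where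
  toFun := wedge
  map_update_add' := by
    intro inst m i x y
    obtain rfl : inst = instDecidableEqFin k := Subsingleton.elim _ _
    ext u
    rw [AlternatingMap.add_apply, wedge_update_apply, wedge_update_apply, wedge_update_apply]
    exact Matrix.det_updateRow_add _ _ _ _
  map_update_smul' := by
    intro inst m i c x
    obtain rfl : inst = instDecidableEqFin k := Subsingleton.elim _ _
    ext u
    rw [AlternatingMap.smul_apply, wedge_update_apply, wedge_update_apply]
    exact Matrix.det_updateRow_smul _ _ _ _

@[simp] theorem wedgeMultilinear_apply (ℓ : Fin k → V →ₗ[ℝ] ℂ) :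
    wedgeMultilinear V k ℓ = wedge ℓ := rfl

theorem wedge_mem_span {ι : Type*} [Fintype ι] {e : ι → V →ₗ[ℝ] ℂ} {ℓ : Fin k → V →ₗ[ℝ] ℂ}
    (h : ∀ i, ℓ i ∈ Submodule.span ℂ (Set.range e)) :
    wedge ℓ ∈ Submodule.span ℂ (Set.range fun σ : Fin k → ι => wedge fun i => e (σ i)) := by
  choose c hc using fun i => (Submodule.mem_span_range_iff_exists_fun ℂ).1 (h i)
  have : ℓ = fun i => ∑ a, c i a • e a := funext fun i => (hc i).symm
  rw [← wedgeMultilinear_apply, this, MultilinearMap.map_sum]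
  refine sum_mem fun σ _ => ?_
  rw [MultilinearMap.map_smul_univ]
  exact Submodule.smul_mem _ _ (Submodule.subset_span ⟨σ, rfl⟩)

end Wedge

/-! ### Forms on the standard simplex -/

/-- The tangent space of the standard simplex. -/
abbrev Tangent (ι : Type*) [Fintype ι] : Submodule ℝ (ι → ℝ) :=
  LinearMap.ker (∑ i, LinearMap.proj i : (ι → ℝ) →ₗ[ℝ] ℝ)

/-- Complex valued `k`-forms on the standard simplex. -/
abbrev StdForm (ι : Type*) [Fintype ι] (k : ℕ) : Type _ :=
  stdSimplex ℝ ι → Tangent ι [⋀^Fin k]→ₗ[ℝ] ℂ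

namespace StdForm

variable {ι κ : Type*} [Fintype ι] [Fintype κ] {k l r s : ℕ}

theorem sum_tangent (u : Tangent ι) : ∑ i, u.1 i = 0 := by
  have := u.2
  rwa [LinearMap.mem_ker, LinearMap.sum_apply] at this

/-- The differential of a barycentric coordinate of the standard simplex. -/
def covec (i : ι) : Tangent ι →ₗ[ℝ] ℂ :=
  Complex.ofRealCLM.toLinearMap ∘ₗ LinearMap.proj i ∘ₗ (Tangent ι).subtype

@[simp] theorem covec_apply (i : ι) (u : Tangent ι) : covec i u = (u.1 i : ℂ) := rfl

theorem sum_covec : ∑ i, covec (ι := ι) i = 0 := by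
  ext u
  simp only [LinearMap.sum_apply, covec_apply, LinearMap.zero_apply]
  rw [← Complex.ofReal_sum, sum_tangent, Complex.ofReal_zero]

/-- The evaluation of forms at a point and at tangent vectors. -/
def evalAt (x : stdSimplex ℝ ι) (u : Fin k → Tangent ι) : StdForm ι k →ₗ[ℂ] ℂ where
  toFun ω := ω x u
  map_add' _ _ := rfl
  map_smul' _ _ := rfl

/-- Barycentric monomials. -/
def mono (α : ι → ℕ) (x : stdSimplex ℝ ι) : ℂ := ∏ i, ((x i : ℝ) : ℂ) ^ α i

theorem mono_add (α β : ι → ℕ) (x : stdSimplex ℝ ι) :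
    mono (α + β) x = mono α x * mono β x := by
  simp [mono, pow_add, Finset.prod_mul_distrib]

theorem mono_single [DecidableEq ι] (i : ι) (x : stdSimplex ℝ ι) :
    mono (Pi.single i 1) x = (x i : ℂ) := by
  rw [mono, Finset.prod_eq_single i]
  · simp
  · intro j _ hj
    simp [hj]
  · simp

theorem mono_sum_single [DecidableEq ι] {m : ℕ} (σ : Fin m → ι) (x : stdSimplex ℝ ι) :
    mono (∑ i, Pi.single (σ i) 1) x = ∏ i, (x (σ i) : ℂ) := by
  induction m with
  | zero => simp [mono]
  | succ m ih => rw [Fin.sum_univ_succ, Fin.prod_univ_succ, mono_add, mono_single, ih]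

/-- Multiplication by a barycentric monomial. -/
def monoMul (α : ι → ℕ) : StdForm ι k →ₗ[ℂ] StdForm ι k where
  toFun ω x := mono α x • ω x
  map_add' ω η := by ext; simp
  map_smul' c ω := by ext; simp [mul_left_comm]

theorem monoMul_apply (α : ι → ℕ) (ω : StdForm ι k) (x : stdSimplex ℝ ι) :
    monoMul α ω x = mono α x • ω x := rfl

/-- The barycentric alternators on the standard simplex. -/
def dForm (σ : Fin k → ι) : StdForm ι k := fun _ => wedge fun i => covec (σ i)

/-- The Whitney forms on the standard simplex. -/
def whitney [DecidableEq ι] (ρ : Fin (k + 1) → ι) : StdForm ι k :=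
  ∑ i : Fin (k + 1), (-1 : ℂ) ^ (i : ℕ) • monoMul (Pi.single (ρ i) 1) (dForm (ρ ∘ i.succAbove))

theorem dForm_apply (σ : Fin k → ι) (x : stdSimplex ℝ ι) (u : Fin k → Tangent ι) :
    dForm σ x u = Matrix.det (Matrix.of fun i j => ((u j).1 (σ i) : ℂ)) :=
  wedge_apply _ _

/-- The defining alternating sum is the expansion of this determinant along the column `x`. In this
shape, antisymmetry in `ρ` and vanishing on faces that miss a vertex of `ρ` are visible. -/
theorem whitney_apply [DecidableEq ι] (ρ : Fin (k + 1) → ι) (x : stdSimplex ℝ ι)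
    (u : Fin k → Tangent ι) :
    whitney ρ x u = Matrix.det (Matrix.of fun i j : Fin (k + 1) =>
      (((Fin.cons x (fun j => (u j).1) : Fin (k + 1) → ι → ℝ) j (ρ i) : ℝ) : ℂ)) := by
  change evalAt x u (whitney ρ) = _
  rw [Matrix.det_succ_column_zero, whitney, map_sum]
  refine Finset.sum_congr rfl fun i _ => ?_
  rw [map_smul]
  change _ • (mono _ x • dForm _ x u) = _
  rw [dForm_apply, mono_single, smul_eq_mul, smul_eq_mul, ← mul_assoc]
  rfl

theorem dForm_comp_perm (σ : Fin k → ι) (p : Equiv.Perm (Fin k)) :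
    dForm (σ ∘ p) = ((Equiv.Perm.sign p : ℤ) : ℂ) • dForm σ :=
  funext fun _ => wedge_comp_perm (fun i => covec (σ i)) p

theorem dForm_eq_zero {σ : Fin k → ι} (h : ¬ Function.Injective σ) : dForm σ = 0 := by
  simp only [Function.Injective, not_forall] at h
  obtain ⟨i, j, hij, hne⟩ := h
  exact funext fun _ => wedge_eq_zero_of_eq _ hne (by rw [hij])

theorem whitney_comp_perm [DecidableEq ι] (ρ : Fin (k + 1) → ι) (p : Equiv.Perm (Fin (k + 1))) :
    whitney (ρ ∘ p) = ((Equiv.Perm.sign p : ℤ) : ℂ) • whitney ρ := by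
  funext x
  ext u
  rw [Pi.smul_apply, AlternatingMap.smul_apply, whitney_apply, whitney_apply, smul_eq_mul,
    ← Matrix.det_permute]
  rfl

theorem whitney_eq_zero [DecidableEq ι] {ρ : Fin (k + 1) → ι} (h : ¬ Function.Injective ρ) :
    whitney ρ = 0 := by
  simp only [Function.Injective, not_forall] at h
  obtain ⟨i, j, hij, hne⟩ := h
  funext x
  ext u
  rw [whitney_apply]
  exact Matrix.det_zero_of_row_eq hne (by ext; simp [hij])

/-- The spaces `P_r Λ^k` and `P_r^- Λ^k` on the standard simplex. -/
def space (fam : Family) (r k : ℕ) (ι : Type*) [Fintype ι] [DecidableEq ι] :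
    Submodule ℂ (StdForm ι k) :=
  match fam with
  | .full => Submodule.span ℂ {ω | ∃ (α : ι → ℕ) (σ : Fin k → ι),
      ∑ i, α i = r ∧ ω = monoMul α (dForm σ)}
  | .trimmed => Submodule.span ℂ {ω | ∃ (α : ι → ℕ) (ρ : Fin (k + 1) → ι),
      (∑ i, α i) + 1 = r ∧ ω = monoMul α (whitney ρ)}

/-! ### Evaluation at edge vectors -/

variable [DecidableEq ι] [DecidableEq κ]

/-- The tangent vector from a point to a vertex. -/
def edge (p : stdSimplex ℝ ι) (i : ι) : Tangent ι :=
  ⟨Pi.single i 1 - (p : ι → ℝ), by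
    rw [LinearMap.mem_ker, LinearMap.sum_apply]
    simp⟩

theorem edge_apply (p : stdSimplex ℝ ι) (i j : ι) :
    (edge p i).1 j = (Pi.single i 1 : ι → ℝ) j - p j := rfl

theorem sum_smul_edge (p : stdSimplex ℝ ι) (u : Tangent ι) : ∑ i, u.1 i • edge p i = u := by
  ext j
  rw [AddSubmonoidClass.coe_finsetSum, Finset.sum_apply]
  simp only [SetLike.val_smul, Pi.smul_apply, edge_apply, smul_eq_mul, mul_sub,
    Finset.sum_sub_distrib, ← Finset.sum_mul, sum_tangent]
  simp [Pi.single_apply]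

/-- The vectors from a fixed point to the vertices span the tangent space: the coordinates of a
tangent vector sum to zero, so the base point drops out in `sum_smul_edge`. -/
theorem alternating_eq_zero {f : Tangent ι [⋀^Fin k]→ₗ[ℝ] ℂ} (p : stdSimplex ℝ ι)
    (h : ∀ μ : Fin k → ι, Function.Injective μ → f (fun j => edge p (μ j)) = 0) : f = 0 := by
  ext u
  have hu : u = fun j => ∑ i, (u j).1 i • edge p i := funext fun j => (sum_smul_edge p (u j)).symm
  rw [AlternatingMap.zero_apply, ← AlternatingMap.coe_multilinearMap, hu, MultilinearMap.map_sum]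
  refine Finset.sum_eq_zero fun μ _ => ?_
  rw [MultilinearMap.map_smul_univ, AlternatingMap.coe_multilinearMap]
  by_cases hμ : Function.Injective μ
  · rw [h μ hμ, smul_zero]
  · simp only [Function.Injective, not_forall] at hμ
    obtain ⟨i, j, hij, hne⟩ := hμ
    rw [f.map_eq_zero_of_eq _ (by rw [hij]) hne, smul_zero]

/-- The value of a form on the edge vectors of a `k`-dimensional face. -/
def edgeVal (τ : Fin (k + 1) → ι) (x : stdSimplex ℝ ι) : StdForm ι k →ₗ[ℂ] ℂ :=
  evalAt x fun j => edge (stdSimplex.vertex (τ 0)) (τ j.succ)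

/-- The value of a form at `x` on the vectors that point from `x` to `k` vertices. -/
def coneVal (μ : Fin k → ι) (x : stdSimplex ℝ ι) : StdForm ι k →ₗ[ℂ] ℂ :=
  evalAt x fun j => edge x (μ j)

theorem edgeVal_apply (τ : Fin (k + 1) → ι) (x : stdSimplex ℝ ι) (ω : StdForm ι k) :
    edgeVal τ x ω = ω x fun j => edge (stdSimplex.vertex (τ 0)) (τ j.succ) := rfl

theorem coneVal_apply (μ : Fin k → ι) (x : stdSimplex ℝ ι) (ω : StdForm ι k) :
    coneVal μ x ω = ω x fun j => edge x (μ j) := rfl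

theorem edgeVal_monoMul (τ : Fin (k + 1) → ι) (x : stdSimplex ℝ ι) (α : ι → ℕ)
    (ω : StdForm ι k) : edgeVal τ x (monoMul α ω) = mono α x * edgeVal τ x ω := rfl

theorem coneVal_monoMul (μ : Fin k → ι) (x : stdSimplex ℝ ι) (α : ι → ℕ)
    (ω : StdForm ι k) : coneVal μ x (monoMul α ω) = mono α x * coneVal μ x ω := rfl

theorem edge_vertex_self (i : ι) : edge (stdSimplex.vertex i) i = 0 := by
  ext j
  rw [edge_apply]
  simp

theorem eq_of_edgeVal {ω η : StdForm ι k}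
    (h : ∀ τ : Fin (k + 1) → ι, Function.Injective τ → ∀ x, edgeVal τ x ω = edgeVal τ x η) :
    ω = η := by
  rcases isEmpty_or_nonempty ι with hι | ⟨⟨i₀⟩⟩
  -- Without vertices the standard simplex has no points.
  · funext x
    have := x.2.2
    simp at this
  refine sub_eq_zero.1 (funext fun x => alternating_eq_zero (stdSimplex.vertex i₀) fun μ hμ => ?_)
  -- If the base vertex occurs in `μ`, one argument is the zero vector; otherwise `i₀` followed by
  -- `μ` is a face.
  by_cases hi : ∃ j, μ j = i₀
  · obtain ⟨j, rfl⟩ := hi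
    exact (ω x - η x).map_coord_zero j (edge_vertex_self (μ j))
  · have := h (Fin.cons i₀ μ) (Fin.cons_injective_iff.2 ⟨by simpa using hi, hμ⟩) x
    rw [edgeVal_apply, edgeVal_apply] at this
    exact sub_eq_zero.2 this

theorem eq_of_coneVal {ω η : StdForm ι k}
    (h : ∀ μ : Fin k → ι, Function.Injective μ → ∀ x, coneVal μ x ω = coneVal μ x η) :
    ω = η :=
  sub_eq_zero.1 (funext fun x => alternating_eq_zero x fun μ hμ => sub_eq_zero.2 (h μ hμ x))

/-- The vector from `x` to a vertex is a unit vector minus `x`, and adding the first column `x` of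
the determinant removes the `-x`. The value is therefore linear in `x`, which gives trimmed forms of
degree r cone values that are homogeneous of degree r. -/
theorem coneVal_whitney (ρ : Fin (k + 1) → ι) (μ : Fin k → ι) (x : stdSimplex ℝ ι) :
    coneVal μ x (whitney ρ) = Matrix.det (Matrix.of fun i j : Fin (k + 1) =>
      (Fin.cons (fun i => (x i : ℂ)) (fun j => Pi.single (μ j) 1) : Fin (k + 1) → ι → ℂ)
        j (ρ i)) := by
  rw [coneVal_apply, whitney_apply, ← Matrix.det_transpose, ← Matrix.det_transpose (Matrix.of _)]
  refine Matrix.det_eq_of_forall_row_eq_smul_add_const (Fin.cons 0 fun _ => -1) 0 (by simp)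
    fun i j => ?_
  refine Fin.cases ?_ (fun i => ?_) i
  · simp
  · simp only [Matrix.transpose_apply, Matrix.of_apply, Fin.cons_succ, Fin.cons_zero, edge_apply,
      Pi.single_apply, Complex.ofReal_sub, apply_ite Complex.ofReal, Complex.ofReal_one,
      Complex.ofReal_zero]
    ring

/-- Edges from `τ 0` are differences of unit vectors. Subtracting the row of `τ 0` from the other
rows and expanding along the column of ones turns the bordered determinant into the one on the
edges. -/
theorem edgeVal_dForm (σ : Fin k → ι) (τ : Fin (k + 1) → ι) (x : stdSimplex ℝ ι) :
    edgeVal τ x (dForm σ) = Matrix.det (Matrix.of fun i j : Fin (k + 1) =>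
      (Fin.cons (fun _ => 1) (fun j => Pi.single (σ j) 1) : Fin (k + 1) → ι → ℂ) j (τ i)) := by
  set A : Matrix (Fin (k + 1)) (Fin (k + 1)) ℂ := Matrix.of fun i j : Fin (k + 1) =>
      (Fin.cons (fun _ => 1) (fun j => Pi.single (σ j) 1) : Fin (k + 1) → ι → ℂ) j (τ i) with hA
  have h : A.det = (Matrix.of fun i j => A i j - (Fin.cons 0 fun _ => 1 : Fin (k + 1) → ℂ) i
      * A 0 j).det :=
    Matrix.det_eq_of_forall_row_eq_smul_add_const (Fin.cons 0 fun _ => 1) 0 (by simp)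
      fun i j => by simp
  rw [h, Matrix.det_succ_column_zero, Fin.sum_univ_succ, Finset.sum_eq_zero, add_zero,
    edgeVal_apply, dForm_apply, ← Matrix.det_transpose]
  · simp only [hA, Fin.val_zero, pow_zero, one_mul, Matrix.of_apply, Fin.cons_zero, zero_mul,
      sub_zero]
    congr 1
    ext i j
    simp only [Matrix.transpose_apply, Matrix.of_apply, Matrix.submatrix_apply, Fin.cons_succ,
      Fin.succAbove_zero, one_mul, edge_apply, stdSimplex.vertex_coe, Pi.single_apply,
      Complex.ofReal_sub, apply_ite Complex.ofReal, Complex.ofReal_one, Complex.ofReal_zero,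
      eq_comm]
  · intro i _
    simp [hA]

end StdForm

/-! ### Completing injective sequences to enumerations -/

theorem exists_equiv_sum_inr {α β ι : Type*} [Fintype α] [Fintype β] [Fintype ι]
    (h : Fintype.card ι = Fintype.card α + Fintype.card β) {μ : β → ι}
    (hμ : Function.Injective μ) : ∃ e : α ⊕ β ≃ ι, ∀ j, e (Sum.inr j) = μ j := by
  classical
  have hc : Fintype.card α = Fintype.card ((Set.range μ)ᶜ : Set ι) := by
    rw [Fintype.card_compl_set, Set.card_range_of_injective hμ]
    omega
  refine ⟨((Equiv.sumCongr (Fintype.equivOfCardEq hc) (Equiv.ofInjective μ hμ)).trans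
    (Equiv.sumComm _ _)).trans (Equiv.Set.sumCompl (Set.range μ)), fun j => ?_⟩
  simp

theorem exists_equiv_sum_inl {α β ι : Type*} [Fintype α] [Fintype β] [Fintype ι]
    (h : Fintype.card ι = Fintype.card α + Fintype.card β) {τ : α → ι}
    (hτ : Function.Injective τ) : ∃ e : α ⊕ β ≃ ι, ∀ j, e (Sum.inl j) = τ j := by
  obtain ⟨e, he⟩ := exists_equiv_sum_inr (α := β) (by rw [h, add_comm]) hτ
  exact ⟨(Equiv.sumComm α β).trans e, fun j => by simp [he]⟩

namespace StdForm

variable {ι κ : Type*} [Fintype ι] [Fintype κ] {k l r s : ℕ}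

/-! ### Pullbacks along maps of vertices -/

/-- The tangent map of the affine map of simplices with prescribed values on the vertices. -/
def push (g : ι → κ) : Tangent ι →ₗ[ℝ] Tangent κ :=
  ((FunOnFinite.linearMap ℝ ℝ g) ∘ₗ (Tangent ι).subtype).codRestrict (Tangent κ) fun u => by
    classical
    rw [LinearMap.mem_ker, LinearMap.sum_apply, LinearMap.comp_apply]
    simp only [LinearMap.proj_apply, FunOnFinite.linearMap_apply_apply, Submodule.subtype_apply]
    exact (Finset.sum_fiberwise Finset.univ g u.1).trans (sum_tangent u)

/-- The pullback of forms along the affine map with prescribed values on the vertices. -/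
def pull (g : ι → κ) : StdForm κ k →ₗ[ℂ] StdForm ι k where
  toFun ω x := (ω (stdSimplex.map g x)).compLinearMap (push g)
  map_add' _ _ := rfl
  map_smul' _ _ := rfl

theorem pull_apply (g : ι → κ) (ω : StdForm κ k) (x : stdSimplex ℝ ι) :
    pull g ω x = (ω (stdSimplex.map g x)).compLinearMap (push g) := rfl

theorem push_apply_eq_sum [DecidableEq κ] (g : ι → κ) (u : Tangent ι) (j : κ) :
    (push g u).1 j = ∑ i with g i = j, u.1 i :=
  FunOnFinite.linearMap_apply_apply ℝ ℝ g u.1 j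

theorem push_apply (g : ι → κ) (hg : Function.Injective g) (u : Tangent ι) (i : ι) :
    (push g u).1 (g i) = u.1 i := by
  classical
  change FunOnFinite.linearMap ℝ ℝ g u.1 (g i) = _
  rw [FunOnFinite.linearMap_apply_apply, Finset.sum_eq_single i]
  · simp +contextual [hg.eq_iff]
  · simp

theorem push_apply_of_notMem (g : ι → κ) (u : Tangent ι) {j : κ} (hj : j ∉ Set.range g) :
    (push g u).1 j = 0 := by
  classical
  change FunOnFinite.linearMap ℝ ℝ g u.1 j = _
  rw [FunOnFinite.linearMap_apply_apply]
  exact Finset.sum_eq_zero fun i hi => (hj ⟨i, (Finset.mem_filter.1 hi).2⟩).elim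

theorem map_apply (g : ι → κ) (hg : Function.Injective g) (x : stdSimplex ℝ ι) (i : ι) :
    stdSimplex.map g x (g i) = x i := by
  classical
  rw [stdSimplex.map_coe, FunOnFinite.linearMap_apply_apply, Finset.sum_eq_single i]
  · simp +contextual [hg.eq_iff]
  · simp

theorem map_apply_of_notMem (g : ι → κ) (x : stdSimplex ℝ ι) {j : κ} (hj : j ∉ Set.range g) :
    stdSimplex.map g x j = 0 := by
  classical
  rw [stdSimplex.map_coe, FunOnFinite.linearMap_apply_apply]
  exact Finset.sum_eq_zero fun i hi => (hj ⟨i, (Finset.mem_filter.1 hi).2⟩).elim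

theorem mono_map (g : ι → κ) (hg : Function.Injective g) {α : κ → ℕ}
    (hα : ∀ j, j ∉ Set.range g → α j = 0) (x : stdSimplex ℝ ι) :
    mono α (stdSimplex.map g x) = mono (α ∘ g) x := by
  classical
  have h : ∀ j ∈ Finset.univ, j ∉ Finset.univ.image g →
      ((stdSimplex.map g x j : ℝ) : ℂ) ^ α j = 1 := fun j _ hj => by
    rw [hα j (by simpa using hj), pow_zero]
  rw [mono, ← Finset.prod_subset (Finset.subset_univ _) h, Finset.prod_image hg.injOn]
  exact Finset.prod_congr rfl fun i _ => by rw [map_apply g hg, Function.comp_apply]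

theorem mono_map_eq_zero (g : ι → κ) {α : κ → ℕ} {j : κ} (hj : j ∉ Set.range g) (hα : α j ≠ 0)
    (x : stdSimplex ℝ ι) : mono α (stdSimplex.map g x) = 0 :=
  Finset.prod_eq_zero (Finset.mem_univ j) (by
    rw [map_apply_of_notMem g x hj, Complex.ofReal_zero, zero_pow hα])

theorem pull_monoMul (g : ι → κ) (hg : Function.Injective g) {α : κ → ℕ}
    (hα : ∀ j, j ∉ Set.range g → α j = 0) (ω : StdForm κ k) :
    pull g (monoMul α ω) = monoMul (α ∘ g) (pull g ω) := by
  funext x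
  ext u
  change mono α (stdSimplex.map g x) * _ = mono (α ∘ g) x * _
  rw [mono_map g hg hα]
  rfl

theorem pull_monoMul_eq_zero (g : ι → κ) {α : κ → ℕ} {j : κ} (hj : j ∉ Set.range g)
    (hα : α j ≠ 0) (ω : StdForm κ k) : pull g (monoMul α ω) = 0 := by
  funext x
  ext u
  change mono α (stdSimplex.map g x) * _ = 0
  rw [mono_map_eq_zero g hj hα, zero_mul]

theorem covec_comp_push (g : ι → κ) (hg : Function.Injective g) (i : ι) :
    covec (g i) ∘ₗ push g = covec i := by
  ext u
  simp [push_apply g hg]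

theorem covec_comp_push_of_notMem (g : ι → κ) {j : κ} (hj : j ∉ Set.range g) :
    covec j ∘ₗ push g = 0 := by
  ext u
  simp [push_apply_of_notMem g u hj]

theorem pull_const (g : ι → κ) (ℓ : Fin k → Tangent κ →ₗ[ℝ] ℂ) :
    pull g (fun _ => wedge ℓ) = fun _ => wedge fun i => ℓ i ∘ₗ push g :=
  funext fun _ => wedge_compLinearMap _ _

theorem pull_dForm (g : ι → κ) (hg : Function.Injective g) (σ : Fin k → ι) :
    pull g (dForm (g ∘ σ)) = dForm σ := by
  unfold dForm
  rw [pull_const]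
  simp only [Function.comp_apply, covec_comp_push g hg]

theorem pull_whitney [DecidableEq ι] [DecidableEq κ] (g : ι → κ) (hg : Function.Injective g)
    (ρ : Fin (k + 1) → ι) : pull g (whitney (g ∘ ρ)) = whitney ρ := by
  unfold whitney
  rw [map_sum]
  refine Finset.sum_congr rfl fun i _ => ?_
  rw [map_smul, pull_monoMul g hg, Function.comp_assoc, pull_dForm g hg]
  · rw [show Pi.single ((g ∘ ρ) i) 1 ∘ g = (Pi.single (ρ i) 1 : ι → ℕ) from
      funext fun j => by simp [Pi.single_apply, hg.eq_iff]]
  · intro j hj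
    rw [Pi.single_apply, if_neg]
    rintro rfl
    exact hj ⟨_, rfl⟩

variable [DecidableEq ι] [DecidableEq κ]

theorem push_edge (g : ι → κ) (p : stdSimplex ℝ ι) (i : ι) :
    push g (edge p i) = edge (stdSimplex.map g p) (g i) := by
  refine Subtype.ext (funext fun j => ?_)
  rw [push_apply_eq_sum, edge_apply, stdSimplex.map_coe, FunOnFinite.linearMap_apply_apply]
  simp only [edge_apply, Finset.sum_sub_distrib]
  rw [Finset.sum_pi_single' i (1 : ℝ), Pi.single_apply]
  simp [eq_comm]

theorem coneVal_pull (g : ι → κ) (μ : Fin k → ι) (x : stdSimplex ℝ ι) (ω : StdForm κ k) :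
    coneVal μ x (pull g ω) = coneVal (fun j => g (μ j)) (stdSimplex.map g x) ω := by
  rw [coneVal_apply, coneVal_apply, pull_apply, AlternatingMap.compLinearMap_apply]
  simp only [push_edge]

theorem edgeVal_pull (g : ι → κ) (τ : Fin (k + 1) → ι) (x : stdSimplex ℝ ι) (ω : StdForm κ k) :
    edgeVal τ x (pull g ω) = edgeVal (fun j => g (τ j)) (stdSimplex.map g x) ω := by
  rw [edgeVal_apply, edgeVal_apply, pull_apply, AlternatingMap.compLinearMap_apply]
  simp only [push_edge, stdSimplex.map_vertex]

theorem pull_mem_space (fam : Family) (π : Equiv.Perm ι) {ω : StdForm ι k}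
    (hω : ω ∈ space fam r k ι) : pull π ω ∈ space fam r k ι := by
  have hπ : ∀ {m : ℕ} (σ : Fin m → ι), σ = π ∘ (π.symm ∘ σ) := fun σ => by ext; simp
  have hsum : ∀ α : ι → ℕ, ∑ i, (α ∘ π) i = ∑ i, α i := fun α => Equiv.sum_comp π α
  cases fam
  · refine Submodule.span_induction ?_ (by simp) (fun x y _ _ hx hy => ?_)
      (fun c x _ hx => ?_) hω
    · rintro _ ⟨α, σ, hα, rfl⟩
      rw [pull_monoMul π π.injective (by simp), hπ σ, pull_dForm π π.injective]
      exact Submodule.subset_span ⟨_, _, by rw [hsum, hα], rfl⟩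
    · rw [map_add]
      exact add_mem hx hy
    · rw [map_smul]
      exact Submodule.smul_mem _ _ hx
  · refine Submodule.span_induction ?_ (by simp) (fun x y _ _ hx hy => ?_)
      (fun c x _ hx => ?_) hω
    · rintro _ ⟨α, σ, hα, rfl⟩
      rw [pull_monoMul π π.injective (by simp), hπ σ, pull_whitney π π.injective]
      exact Submodule.subset_span ⟨_, _, by rw [hsum, hα], rfl⟩
    · rw [map_add]
      exact add_mem hx hy
    · rw [map_smul]
      exact Submodule.smul_mem _ _ hx

/-! ### Polynomial functions on the standard simplex -/

/-- The functions on the standard simplex that are homogeneous polynomials of degree `r`. -/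
def IsHomPoly (r : ℕ) (f : stdSimplex ℝ ι → ℂ) : Prop :=
  ∃ p : MvPolynomial ι ℂ, p.IsHomogeneous r ∧
    ∀ x, f x = MvPolynomial.eval (fun i => (x i : ℂ)) p

omit [DecidableEq ι] in
theorem isHomPoly_zero : IsHomPoly r (fun _ : stdSimplex ℝ ι => 0) :=
  ⟨0, MvPolynomial.isHomogeneous_zero _ _ _, by simp⟩

omit [DecidableEq ι] in
theorem IsHomPoly.add {f g : stdSimplex ℝ ι → ℂ} (hf : IsHomPoly r f) (hg : IsHomPoly r g) :
    IsHomPoly r (fun x => f x + g x) := by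
  obtain ⟨p, hp, hfp⟩ := hf
  obtain ⟨q, hq, hgq⟩ := hg
  exact ⟨p + q, hp.add hq, fun x => by simp only [hfp, hgq, map_add]⟩

omit [DecidableEq ι] in
theorem IsHomPoly.const_mul {f : stdSimplex ℝ ι → ℂ} (hf : IsHomPoly r f) (c : ℂ) :
    IsHomPoly r (fun x => c * f x) := by
  obtain ⟨p, hp, hfp⟩ := hf
  exact ⟨MvPolynomial.C c * p, by simpa using (MvPolynomial.isHomogeneous_C ι c).mul hp,
    fun x => by simp only [hfp, map_mul, MvPolynomial.eval_C]⟩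

/-- The polynomial of a barycentric monomial. -/
def monoPoly (α : ι → ℕ) : MvPolynomial ι ℂ := MvPolynomial.monomial (Finsupp.equivFunOnFinite.symm α) 1

omit [DecidableEq ι] in
theorem monoPoly_isHomogeneous (α : ι → ℕ) : (monoPoly α).IsHomogeneous (∑ i, α i) :=
  MvPolynomial.isHomogeneous_monomial _ (by
    rw [Finsupp.degree_eq_sum]
    rfl)

omit [DecidableEq ι] in
theorem eval_monoPoly (α : ι → ℕ) (x : stdSimplex ℝ ι) :
    MvPolynomial.eval (fun i => (x i : ℂ)) (monoPoly α) = mono α x := by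
  rw [monoPoly, MvPolynomial.eval_monomial, one_mul, Finsupp.prod_fintype _ _ (by simp)]
  rfl

omit [DecidableEq ι] in
-- The monomial may vanish on the boundary of the simplex, so it cannot be cancelled pointwise. It
-- is cancelled in the polynomial ring, an integral domain.
theorem IsHomPoly.eq_zero [Nonempty ι] {f : stdSimplex ℝ ι → ℂ} (hf : IsHomPoly r f)
    {α : ι → ℕ} (h : ∀ x, mono α x * f x = 0) : ∀ x, f x = 0 := by
  obtain ⟨p, hp, hfp⟩ := hf
  have h0 : monoPoly α * p = 0 := by
    refine eq_zero_of_eval_stdSimplex ((monoPoly_isHomogeneous α).mul hp) fun x hx => ?_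
    rw [map_mul]
    have h1 := h ⟨x, hx⟩
    rw [hfp, ← eval_monoPoly] at h1
    exact h1
  have h1 : p = 0 := (mul_eq_zero.1 h0).resolve_left (by simp [monoPoly])
  intro x
  rw [hfp, h1, map_zero]

theorem isHomPoly_edgeVal {ω : StdForm ι k} (hω : ω ∈ space .full r k ι) (τ : Fin (k + 1) → ι) :
    IsHomPoly r fun x => edgeVal τ x ω := by
  refine Submodule.span_induction ?_ (by simpa using isHomPoly_zero) (fun x y _ _ hx hy => ?_)
      (fun c x _ hx => ?_) hω
  · rintro _ ⟨α, σ, rfl, rfl⟩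
    simp only [edgeVal_monoMul, edgeVal_dForm, mul_comm (mono α _)]
    exact IsHomPoly.const_mul ⟨monoPoly α, monoPoly_isHomogeneous α,
      fun x => (eval_monoPoly α x).symm⟩ _
  · simpa using hx.add hy
  · simpa using hx.const_mul c

/-- The polynomial with the values of a Whitney form on `coneVal`. -/
def whitneyPoly (ρ : Fin (k + 1) → ι) (μ : Fin k → ι) : MvPolynomial ι ℂ :=
  ∑ i : Fin (k + 1), MvPolynomial.C ((-1) ^ (i : ℕ) * Matrix.det (Matrix.of fun a b : Fin k =>
    (Pi.single (μ b) 1 : ι → ℂ) (ρ (i.succAbove a)))) * MvPolynomial.X (ρ i)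

omit [Fintype ι] in
theorem whitneyPoly_isHomogeneous (ρ : Fin (k + 1) → ι) (μ : Fin k → ι) :
    (whitneyPoly ρ μ).IsHomogeneous 1 :=
  MvPolynomial.IsHomogeneous.sum _ _ _ fun i _ => by
    rw [← zero_add 1]
    exact (MvPolynomial.isHomogeneous_C ι _).mul (MvPolynomial.isHomogeneous_X ℂ (ρ i))

theorem eval_whitneyPoly (ρ : Fin (k + 1) → ι) (μ : Fin k → ι) (x : stdSimplex ℝ ι) :
    MvPolynomial.eval (fun i => (x i : ℂ)) (whitneyPoly ρ μ) = coneVal μ x (whitney ρ) := by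
  rw [coneVal_whitney, Matrix.det_succ_column_zero, whitneyPoly, map_sum]
  refine Finset.sum_congr rfl fun i _ => ?_
  rw [map_mul, MvPolynomial.eval_C, MvPolynomial.eval_X]
  simp only [Matrix.of_apply, Fin.cons_zero, mul_right_comm _ _ ((x (ρ i) : ℝ) : ℂ)]
  rfl

theorem isHomPoly_coneVal {ω : StdForm ι k} (hω : ω ∈ space .trimmed r k ι) (μ : Fin k → ι) :
    IsHomPoly r fun x => coneVal μ x ω := by
  refine Submodule.span_induction ?_ (by simpa using isHomPoly_zero) (fun x y _ _ hx hy => ?_)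
      (fun c x _ hx => ?_) hω
  · rintro _ ⟨α, ρ, rfl, rfl⟩
    refine ⟨monoPoly α * whitneyPoly ρ μ,
      (monoPoly_isHomogeneous α).mul (whitneyPoly_isHomogeneous ρ μ), fun x => ?_⟩
    simp only [coneVal_monoMul, map_mul, eval_monoPoly, eval_whitneyPoly]
  · simpa using hx.add hy
  · simpa using hx.const_mul c

/-! ### The canonical isomorphisms -/

section Star

variable {p q : ℕ}

/-- The graph of the canonical isomorphism `I` on the standard simplex. -/
def starI (s p q : ℕ) : Submodule ℂ (StdForm (Fin (p + q + 1)) p × StdForm (Fin (p + q + 1)) q) where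
  carrier := {z | z.1 ∈ space .full s p (Fin (p + q + 1)) ∧
    ∀ (e : Fin (p + 1) ⊕ Fin q ≃ Fin (p + q + 1)) (x : stdSimplex ℝ (Fin (p + q + 1))),
      coneVal (fun j => e (Sum.inr j)) x z.2 = orderSign ((shiftHead p q).trans e) *
        (∏ i, (x (e (Sum.inl i)) : ℂ)) * edgeVal (fun i => e (Sum.inl i)) x z.1}
  zero_mem' := ⟨zero_mem _, fun e x => by simp⟩
  add_mem' := fun {a b} ha hb => ⟨add_mem ha.1 hb.1, fun e x => by
    rw [Prod.fst_add, Prod.snd_add, map_add, map_add, ha.2, hb.2, mul_add]⟩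
  smul_mem' := fun c a ha => ⟨Submodule.smul_mem _ _ ha.1, fun e x => by
    rw [Prod.smul_fst, Prod.smul_snd, map_smul, map_smul, ha.2, smul_eq_mul, smul_eq_mul,
      mul_left_comm]⟩

/-- The graph of the canonical isomorphism `J` on the standard simplex. -/
def starJ (s p q : ℕ) : Submodule ℂ (StdForm (Fin (p + q + 1)) p × StdForm (Fin (p + q + 1)) q) where
  carrier := {z | z.2 ∈ space .trimmed s q (Fin (p + q + 1)) ∧
    ∀ (e : Fin (p + 1) ⊕ Fin q ≃ Fin (p + q + 1)) (x : stdSimplex ℝ (Fin (p + q + 1))),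
      edgeVal (fun i => e (Sum.inl i)) x z.1 = orderSign ((shiftHead p q).trans e) *
        (∏ j, (x (e (Sum.inr j)) : ℂ)) * coneVal (fun j => e (Sum.inr j)) x z.2}
  zero_mem' := ⟨zero_mem _, fun e x => by simp⟩
  add_mem' := fun {a b} ha hb => ⟨add_mem ha.1 hb.1, fun e x => by
    rw [Prod.fst_add, Prod.snd_add, map_add, map_add, ha.2, hb.2, mul_add]⟩
  smul_mem' := fun c a ha => ⟨Submodule.smul_mem _ _ ha.1, fun e x => by
    rw [Prod.smul_fst, Prod.smul_snd, map_smul, map_smul, ha.2, smul_eq_mul, smul_eq_mul,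
      mul_left_comm]⟩

/-- The prescribed pairs satisfy the intrinsic relation: `orderSign_mul_det` with `w = x` moves the
Whitney determinant to the complementary vertices, and `prod_mul_det_cons` exchanges the column `x`
for the column of ones at the price of the product of coordinates. -/
theorem generator_mem_starI (f : Fin p ⊕ Fin (q + 1) ≃ Fin (p + q + 1))
    {α : Fin (p + q + 1) → ℕ} (hα : ∑ i, α i = s) :
    (monoMul α (dForm fun i => f (Sum.inl i)),
      orderSign f • monoMul (α + ∑ i, Pi.single (f (Sum.inl i)) 1)
        (whitney fun i => f (Sum.inr i))) ∈ starI s p q := by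
  refine ⟨Submodule.subset_span ⟨α, _, hα, rfl⟩, fun e x => ?_⟩
  have h1 := orderSign_mul_det f e (fun i => (x i : ℂ))
  have h2 := prod_mul_det_cons (fun i => (x i : ℂ)) (fun i => e (Sum.inl i))
    (fun i => f (Sum.inl i))
  simp only [map_smul, smul_eq_mul]
  rw [coneVal_monoMul, edgeVal_monoMul, coneVal_whitney, edgeVal_dForm, mono_add, mono_sum_single]
  linear_combination (mono α x * ∏ i, (x (f (Sum.inl i)) : ℂ)) * h1 -
    orderSign ((shiftHead p q).trans e) * mono α x * h2

/-- The same two determinant identities in the opposite roles: `orderSign_mul_det` is now applied to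
the column of ones, and the exchange of columns takes place in the Whitney determinant. -/
theorem generator_mem_starJ (f : Fin p ⊕ Fin (q + 1) ≃ Fin (p + q + 1))
    {α : Fin (p + q + 1) → ℕ} (hα : (∑ i, α i) + 1 = s) :
    (monoMul (α + ∑ i, Pi.single (f (Sum.inr i)) 1) (dForm fun i => f (Sum.inl i)),
      orderSign f • monoMul α (whitney fun i => f (Sum.inr i))) ∈ starJ s p q := by
  refine ⟨Submodule.smul_mem _ _ (Submodule.subset_span ⟨α, _, hα, rfl⟩), fun e x => ?_⟩
  have h1 := orderSign_mul_det f e (fun _ => 1)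
  have h2 := prod_mul_det_cons (fun i => (x i : ℂ)) (fun i => f (Sum.inr i))
    (fun i => e (Sum.inr i))
  have h3 := orderSign_mul_self ((shiftHead p q).trans e)
  simp only [map_smul, smul_eq_mul]
  rw [coneVal_monoMul, edgeVal_monoMul, coneVal_whitney, edgeVal_dForm, mono_add, mono_sum_single]
  set D := (Matrix.of fun i j : Fin (p + 1) => (Fin.cons (fun _ => 1)
    (fun j => Pi.single (f (Sum.inl j)) 1) : Fin (p + 1) → Fin (p + q + 1) → ℂ) j
      (e (Sum.inl i))).det
  linear_combination (-D * mono α x * ∏ i, (x (f (Sum.inr i)) : ℂ)) * h3 +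
    orderSign ((shiftHead p q).trans e) * orderSign f * mono α x * h2 -
    orderSign ((shiftHead p q).trans e) * (mono α x * ∏ i, (x (f (Sum.inr i)) : ℂ)) * h1

theorem card_aux : Fintype.card (Fin (p + q + 1)) = Fintype.card (Fin (p + 1)) +
    Fintype.card (Fin q) := by
  simp only [Fintype.card_fin]
  omega

theorem card_aux' : Fintype.card (Fin (p + q + 1)) = Fintype.card (Fin p) +
    Fintype.card (Fin (q + 1)) := by
  simp only [Fintype.card_fin]
  omega

/-- Every injective `μ` can be completed to an enumeration, so the relation prescribes all cone
values of the second form. -/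
theorem starI_fst_zero {η : StdForm (Fin (p + q + 1)) q} (h : (0, η) ∈ starI s p q) : η = 0 := by
  refine eq_of_coneVal fun μ hμ x => ?_
  obtain ⟨e, he⟩ := exists_equiv_sum_inr card_aux hμ
  have := h.2 e x
  rw [map_zero, mul_zero] at this
  rw [map_zero, ← this]
  simp only [he]

theorem starJ_snd_zero {ω : StdForm (Fin (p + q + 1)) p} (h : (ω, 0) ∈ starJ s p q) : ω = 0 := by
  refine eq_of_edgeVal fun τ hτ x => ?_
  obtain ⟨e, he⟩ := exists_equiv_sum_inl card_aux hτ
  have := h.2 e x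
  rw [map_zero, mul_zero] at this
  rw [map_zero, ← this]
  simp only [he]

/-- Here the relation yields only the products of the edge values with coordinates. That the first
component is a polynomial form, which is part of the relation, permits the cancellation. -/
theorem starI_snd_zero {ω : StdForm (Fin (p + q + 1)) p} (h : (ω, 0) ∈ starI s p q) : ω = 0 := by
  refine eq_of_edgeVal fun τ hτ x => ?_
  obtain ⟨e, he⟩ := exists_equiv_sum_inl card_aux hτ
  rw [map_zero]
  refine (isHomPoly_edgeVal h.1 τ).eq_zero (α := ∑ i, Pi.single (τ i) 1) (fun x => ?_) x
  have := h.2 e x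
  simp only [he, map_zero, mul_assoc] at this
  rw [mono_sum_single]
  exact (mul_eq_zero.1 this.symm).resolve_left (orderSign_ne_zero _)

theorem starJ_fst_zero {η : StdForm (Fin (p + q + 1)) q} (h : (0, η) ∈ starJ s p q) : η = 0 := by
  refine eq_of_coneVal fun μ hμ x => ?_
  obtain ⟨e, he⟩ := exists_equiv_sum_inr card_aux hμ
  rw [map_zero]
  refine (isHomPoly_coneVal h.1 μ).eq_zero (α := ∑ i, Pi.single (μ i) 1) (fun x => ?_) x
  have := h.2 e x
  simp only [he, map_zero, mul_assoc] at this
  rw [mono_sum_single]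
  exact (mul_eq_zero.1 this.symm).resolve_left (orderSign_ne_zero _)

/-- Following an enumeration by `π` multiplies `orderSign` by the sign of `π`, and nothing else in
the relation depends on the labelling. Thus I commutes with symmetries up to that sign. -/
theorem pull_mem_starI (π : Equiv.Perm (Fin (p + q + 1))) {ω η} (h : (ω, η) ∈ starI s p q) :
    (pull π ω, ((Equiv.Perm.sign π : ℤ) : ℂ) • pull π η) ∈ starI s p q := by
  refine ⟨pull_mem_space .full π h.1, fun e x => ?_⟩
  have h1 := h.2 (e.trans π) (stdSimplex.map π x)
  rw [← Equiv.trans_assoc, orderSign_trans] at h1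
  simp only [Equiv.trans_apply, map_apply π π.injective] at h1
  simp only [map_smul, smul_eq_mul, coneVal_pull, edgeVal_pull]
  rw [h1]
  linear_combination (orderSign ((shiftHead p q).trans e) * (∏ i, (x (e (Sum.inl i)) : ℂ)) *
    edgeVal (fun j => π (e (Sum.inl j))) (stdSimplex.map π x) ω) *
      intUnit_mul_self (Equiv.Perm.sign π)

theorem pull_mem_starJ (π : Equiv.Perm (Fin (p + q + 1))) {ω η} (h : (ω, η) ∈ starJ s p q) :
    (pull π ω, ((Equiv.Perm.sign π : ℤ) : ℂ) • pull π η) ∈ starJ s p q := by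
  refine ⟨Submodule.smul_mem _ _ (pull_mem_space .trimmed π h.1), fun e x => ?_⟩
  have h1 := h.2 (e.trans π) (stdSimplex.map π x)
  rw [← Equiv.trans_assoc, orderSign_trans] at h1
  simp only [Equiv.trans_apply, map_apply π π.injective] at h1
  simp only [map_smul, smul_eq_mul, coneVal_pull, edgeVal_pull]
  rw [h1]
  ring

end Star

end StdForm

namespace StdForm

variable {ι κ : Type*} [Fintype ι] [Fintype κ] [DecidableEq ι] [DecidableEq κ] {k l r s : ℕ}

/-! ### Extension operators -/

/-- The covectors `Ψ_j = dλ_j - (β_j / |β|) ∑_{i ∈ F} dλ_i`. -/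
def psi (fs : Finset κ) (β : κ → ℕ) (j : κ) : Tangent κ →ₗ[ℝ] ℂ :=
  covec j - ((β j : ℂ) / ((∑ i, β i : ℕ) : ℂ)) • ∑ i ∈ fs, covec i

/-- The form `λ^β Ψ_σ`. -/
def psiForm (fs : Finset κ) (β : κ → ℕ) (σ : Fin k → κ) : StdForm κ k :=
  monoMul β fun _ => wedge fun i => psi fs β (σ i)

/-- The graph of the extension operator for the face with vertices `g i`. -/
def extGraph (fam : Family) (r k : ℕ) (g : ι → κ) : Submodule ℂ (StdForm ι k × StdForm κ k) :=
  match fam with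
  | .full => Submodule.span ℂ {z | ∃ (α : ι → ℕ) (σ : Fin k → ι), ∑ i, α i = r ∧
      z = (monoMul α (dForm σ), psiForm (Finset.univ.image g) (Function.extend g α 0) (g ∘ σ))}
  | .trimmed => Submodule.span ℂ {z | ∃ (α : ι → ℕ) (ρ : Fin (k + 1) → ι), (∑ i, α i) + 1 = r ∧
      z = (monoMul α (whitney ρ), monoMul (Function.extend g α 0) (whitney (g ∘ ρ)))}

/-- The contribution of the face with vertex set `fs` in the geometric decomposition. -/
def faceSpace (fam : Family) (r k : ℕ) (fs : Finset κ) : Submodule ℂ (StdForm κ k) :=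
  match fam with
  | .full => Submodule.span ℂ {ω | ∃ (β : κ → ℕ) (σ : Fin k → κ), ∑ i, β i = r ∧
      (∀ j, j ∈ fs ↔ β j ≠ 0 ∨ j ∈ Set.range σ) ∧ ω = psiForm fs β σ}
  | .trimmed => Submodule.span ℂ {ω | ∃ (β : κ → ℕ) (ρ : Fin (k + 1) → κ), (∑ i, β i) + 1 = r ∧
      (∀ j, j ∈ fs ↔ β j ≠ 0 ∨ j ∈ Set.range ρ) ∧ ω = monoMul β (whitney ρ)}

omit [DecidableEq κ] in
theorem psi_of_eq_zero (fs : Finset κ) {β : κ → ℕ} {j : κ} (h : β j = 0) :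
    psi fs β j = covec j := by
  simp [psi, h]

theorem wedge_eq_zero_of_coord {V : Type*} [AddCommGroup V] [Module ℝ V]
    (ℓ : Fin k → V →ₗ[ℝ] ℂ) (i : Fin k) (h : ℓ i = 0) : wedge ℓ = 0 :=
  (wedgeMultilinear V k).map_coord_zero i h

omit [Fintype ι] [DecidableEq ι] in
theorem sum_extend [Fintype ι] (g : ι → κ) (hg : Function.Injective g) (α : ι → ℕ) :
    ∑ j, Function.extend g α 0 j = ∑ i, α i := by
  rw [← Finset.sum_subset (Finset.subset_univ (Finset.univ.image g)), Finset.sum_image hg.injOn]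
  · simp [hg.extend_apply]
  · intro j _ hj
    rw [Function.extend_apply' _ _ _ (by simpa using hj), Pi.zero_apply]

omit [Fintype ι] [DecidableEq ι] [Fintype κ] [DecidableEq κ] in
theorem extend_eq_zero (g : ι → κ) (α : ι → ℕ) {j : κ} (hj : j ∉ Set.range g) :
    Function.extend g α 0 j = 0 := by
  rw [Function.extend_apply' _ _ _ hj, Pi.zero_apply]

omit [Fintype ι] [DecidableEq ι] [Fintype κ] [DecidableEq κ] in
theorem extend_comp_self (g : ι → κ) (hg : Function.Injective g) (β : κ → ℕ) (h : ∀ j, j ∉ Set.range g → β j = 0) :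
    Function.extend g (β ∘ g) 0 = β := by
  funext j
  by_cases hj : j ∈ Set.range g
  · obtain ⟨i, rfl⟩ := hj
    exact hg.extend_apply _ _ _
  · rw [extend_eq_zero g _ hj, h j hj]

omit [DecidableEq ι] [DecidableEq κ] in
theorem sum_covec_comp (f : Tangent ι →ₗ[ℝ] Tangent κ) (fs : Finset κ) :
    (∑ j ∈ fs, covec j) ∘ₗ f = ∑ j ∈ fs, covec j ∘ₗ f := by
  ext u
  simp only [LinearMap.comp_apply, LinearMap.sum_apply]

theorem sum_covec_image_comp_push (g : ι → κ) (hg : Function.Injective g) :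
    (∑ j ∈ Finset.univ.image g, covec j) ∘ₗ push g = 0 := by
  rw [sum_covec_comp, Finset.sum_image hg.injOn]
  simp only [covec_comp_push g hg]
  exact sum_covec

theorem pull_psiForm_extend (g : ι → κ) (hg : Function.Injective g) (α : ι → ℕ) (σ : Fin k → ι) :
    pull g (psiForm (Finset.univ.image g) (Function.extend g α 0) (g ∘ σ)) =
      monoMul α (dForm σ) := by
  rw [psiForm, pull_monoMul g hg fun j => extend_eq_zero g α, Function.extend_comp hg, pull_const]
  simp only [psi, LinearMap.sub_comp, LinearMap.smul_comp, sum_covec_image_comp_push g hg,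
    smul_zero, sub_zero, Function.comp_apply, covec_comp_push g hg]
  rfl

/-- Restriction undoes extension: the correction term in `psi` restricts to a multiple of the sum of
all dλ on the face, which is zero. -/
theorem pull_extGraph (fam : Family) {g : ι → κ} (hg : Function.Injective g) {x y}
    (h : (x, y) ∈ extGraph fam r k g) : pull g y = x := by
  have key : extGraph fam r k g ≤ LinearMap.eqLocus (pull g ∘ₗ LinearMap.snd ℂ _ _)
      (LinearMap.fst ℂ (StdForm ι k) (StdForm κ k)) := by
    cases fam
    · refine Submodule.span_le.2 ?_
      rintro _ ⟨α, σ, -, rfl⟩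
      exact pull_psiForm_extend g hg α σ
    · refine Submodule.span_le.2 ?_
      rintro _ ⟨α, ρ, -, rfl⟩
      change pull g (monoMul _ _) = monoMul _ _
      rw [pull_monoMul g hg fun j => extend_eq_zero g α, Function.extend_comp hg, pull_whitney g hg]
  exact key h

omit [DecidableEq ι] in
theorem pull_whitney_eq_zero (g : ι → κ) (ρ : Fin (k + 1) → κ) {i : Fin (k + 1)}
    (hi : ρ i ∉ Set.range g) : pull g (whitney ρ) = 0 := by
  funext x
  ext u
  rw [pull_apply, AlternatingMap.compLinearMap_apply, whitney_apply]
  refine Matrix.det_eq_zero_of_row_eq_zero i fun j => ?_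
  refine Fin.cases ?_ (fun j => ?_) j
  · simp only [Matrix.of_apply, Fin.cons_zero, map_apply_of_notMem g x hi, Complex.ofReal_zero]
  · simp [push_apply_of_notMem g _ hi]

/-- Take a vertex of `fs` outside the smaller face. If some exponent outside the smaller face is
positive, the monomial vanishes there; otherwise that vertex must be an index of the form. A
covector `psi` with exponent zero is just dλ, and both dλ and the Whitney form then restrict to
zero. -/
theorem pull_faceSpace (fam : Family) {g : ι → κ} (hg : Function.Injective g) {fs : Finset κ}
    (hfs : ¬ (fs : Set κ) ⊆ Set.range g) {y} (hy : y ∈ faceSpace fam r k fs) : pull g y = 0 := by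
  obtain ⟨j, hj, hjg⟩ := Set.not_subset.1 hfs
  have key : faceSpace fam r k fs ≤ LinearMap.ker (pull g) := by
    cases fam
    · refine Submodule.span_le.2 ?_
      rintro _ ⟨β, σ, -, h, rfl⟩
      change pull g _ = 0
      by_cases hβ : ∀ j, j ∉ Set.range g → β j = 0
      · obtain ⟨i, rfl⟩ := ((h j).1 hj).resolve_left (by simpa using hβ j hjg)
        rw [psiForm, pull_monoMul g hg hβ, pull_const, wedge_eq_zero_of_coord _ i]
        · exact map_zero _
        · rw [psi_of_eq_zero fs (hβ _ hjg), covec_comp_push_of_notMem g hjg]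
      · push Not at hβ
        obtain ⟨i, hi, hβi⟩ := hβ
        exact pull_monoMul_eq_zero g hi hβi _
    · refine Submodule.span_le.2 ?_
      rintro _ ⟨β, ρ, -, h, rfl⟩
      change pull g _ = 0
      by_cases hβ : ∀ j, j ∉ Set.range g → β j = 0
      · obtain ⟨i, rfl⟩ := ((h j).1 hj).resolve_left (by simpa using hβ j hjg)
        rw [pull_monoMul g hg hβ, pull_whitney_eq_zero g ρ hjg, map_zero]
      · push Not at hβ
        obtain ⟨i, hi, hβi⟩ := hβ
        exact pull_monoMul_eq_zero g hi hβi _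
  exact key hy

theorem psi_comp_push (π : Equiv.Perm κ) (fs : Finset κ) (β : κ → ℕ) (j : κ) :
    psi (fs.image π) β (π j) ∘ₗ push π = psi fs (β ∘ π) j := by
  have h : (∑ i ∈ fs.image π, covec i) ∘ₗ push π = ∑ i ∈ fs, covec i := by
    rw [sum_covec_comp, Finset.sum_image π.injective.injOn]
    simp only [covec_comp_push π π.injective]
  simp only [psi, LinearMap.sub_comp, LinearMap.smul_comp, covec_comp_push π π.injective, h,
    Function.comp_apply, Equiv.sum_comp π β]

/-- The hypothesis `hπ` says that `π` carries the face `g` onto the face `g'` and induces `πG` on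
the labels. The formulas for the extension involve exponents and vertex sets only, so they are
compatible with relabelling, without any sign. -/
theorem pull_mem_extGraph (fam : Family) {g g' : ι → κ} (hg : Function.Injective g)
    (hg' : Function.Injective g') {π : Equiv.Perm κ} {πG : Equiv.Perm ι} (hπ : g' ∘ πG = π ∘ g)
    {x y} (h : (x, y) ∈ extGraph fam r k g') : (pull πG x, pull π y) ∈ extGraph fam r k g := by
  have hσ : ∀ {m : ℕ} (σ : Fin m → ι), σ = πG ∘ (πG.symm ∘ σ) := fun σ => by ext; simp
  have hσ' : ∀ {m : ℕ} (σ : Fin m → ι), g' ∘ σ = π ∘ (g ∘ (πG.symm ∘ σ)) := fun σ => by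
    rw [← Function.comp_assoc, ← hπ, Function.comp_assoc, ← hσ]
  have him : Finset.univ.image g' = (Finset.univ.image g).image π := by
    rw [Finset.image_image, ← hπ, ← Finset.image_image]
    congr 1
    exact (Finset.image_univ_equiv πG).symm
  have hext : ∀ α : ι → ℕ, Function.extend g' α 0 ∘ π = Function.extend g (α ∘ πG) 0 := fun α => by
    funext j
    by_cases hj : j ∈ Set.range g
    · obtain ⟨i, rfl⟩ := hj
      rw [hg.extend_apply, Function.comp_apply, show π (g i) = g' (πG i) from
        (congrFun hπ i).symm, hg'.extend_apply, Function.comp_apply]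
    · rw [extend_eq_zero g _ hj, Function.comp_apply, extend_eq_zero g']
      rintro ⟨i, hi⟩
      refine hj ⟨πG.symm i, π.injective ?_⟩
      rw [← hi]
      simpa using (congrFun hπ (πG.symm i)).symm
  have key : extGraph fam r k g' ≤ (extGraph fam r k g).comap ((pull πG).prodMap (pull π)) := by
    cases fam
    · refine Submodule.span_le.2 ?_
      rintro _ ⟨α, σ, hα, rfl⟩
      refine Submodule.subset_span ⟨α ∘ πG, πG.symm ∘ σ, ?_, Prod.ext ?_ ?_⟩
      · exact (Equiv.sum_comp πG α).trans hα
      · change pull πG (monoMul _ _) = _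
        rw [pull_monoMul πG πG.injective (by simp), hσ σ, pull_dForm πG πG.injective, ← hσ σ]
      · change pull π (psiForm _ _ _) = _
        rw [psiForm, pull_monoMul π π.injective (by simp), pull_const, hσ' σ, him, hext, psiForm]
        simp only [Function.comp_apply, psi_comp_push, hext]
    · refine Submodule.span_le.2 ?_
      rintro _ ⟨α, σ, hα, rfl⟩
      refine Submodule.subset_span ⟨α ∘ πG, πG.symm ∘ σ, ?_, Prod.ext ?_ ?_⟩
      · rw [← hα]
        exact congrArg (· + 1) (Equiv.sum_comp πG α)
      · change pull πG (monoMul _ _) = _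
        rw [pull_monoMul πG πG.injective (by simp), hσ σ, pull_whitney πG πG.injective, ← hσ σ]
      · change pull π (monoMul _ _) = _
        rw [pull_monoMul π π.injective (by simp), hσ' σ, pull_whitney π π.injective, hext]
  exact key h

/-! ### The extension operators are well defined -/

omit [DecidableEq ι] [DecidableEq κ] in
theorem rename_monoPoly (g : ι → κ) (hg : Function.Injective g) (α : ι → ℕ) :
    MvPolynomial.rename g (monoPoly α) = monoPoly (Function.extend g α 0) := by
  rw [monoPoly, MvPolynomial.rename_monomial, monoPoly]
  congr 2
  ext j
  by_cases hj : j ∈ Set.range g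
  · obtain ⟨i, rfl⟩ := hj
    rw [Finsupp.mapDomain_apply hg]
    exact (hg.extend_apply α 0 i).symm
  · rw [Finsupp.mapDomain_of_notMem_range _ _ hj]
    exact (extend_eq_zero g α hj).symm

omit [Fintype ι] [Fintype κ] in
theorem rename_whitneyPoly (g : ι → κ) (hg : Function.Injective g) (ρ : Fin (k + 1) → ι)
    (μ : Fin k → ι) : MvPolynomial.rename g (whitneyPoly ρ μ) = whitneyPoly (g ∘ ρ) (g ∘ μ) := by
  simp only [whitneyPoly, map_sum, map_mul, MvPolynomial.rename_C, MvPolynomial.rename_X,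
    Function.comp_apply, Pi.single_apply, hg.eq_iff]

/-- The cone values of an extension are the cone polynomials on the face with the variables renamed,
and they vanish as soon as one vertex lies outside the face. Polynomials that vanish on the face are
zero, so the zero form extends only to zero. -/
theorem extGraph_trimmed_fst_zero [Nonempty ι] {g : ι → κ} (hg : Function.Injective g) {y}
    (h : (0, y) ∈ extGraph .trimmed r k g) : y = 0 := by
  have key : ∀ z ∈ extGraph .trimmed r k g,
      (∀ μ : Fin k → ι, ∃ p : MvPolynomial ι ℂ, p.IsHomogeneous r ∧
        (∀ x, coneVal μ x z.1 = MvPolynomial.eval (fun i => (x i : ℂ)) p) ∧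
        ∀ x, coneVal (g ∘ μ) x z.2 =
          MvPolynomial.eval (fun i => (x i : ℂ)) (MvPolynomial.rename g p)) ∧
      ∀ (μ : Fin k → κ) (j : Fin k), μ j ∉ Set.range g → ∀ x, coneVal μ x z.2 = 0 := by
    intro z hz
    refine Submodule.span_induction ?_ ?_ ?_ ?_ hz
    · rintro _ ⟨α, ρ, hα, rfl⟩
      refine ⟨fun μ => ⟨monoPoly α * whitneyPoly ρ μ,
        hα ▸ (monoPoly_isHomogeneous α).mul (whitneyPoly_isHomogeneous ρ μ), fun x => ?_,
        fun x => ?_⟩, fun μ j hj x => ?_⟩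
      · rw [coneVal_monoMul, map_mul, eval_monoPoly, eval_whitneyPoly]
      · rw [coneVal_monoMul, map_mul, rename_monoPoly g hg, rename_whitneyPoly g hg, map_mul,
          eval_monoPoly, eval_whitneyPoly]
      · rw [coneVal_monoMul, coneVal_whitney, Matrix.det_eq_zero_of_column_eq_zero j.succ, mul_zero]
        intro i
        simp only [Matrix.of_apply, Fin.cons_succ, Function.comp_apply]
        rw [Pi.single_apply, if_neg]
        exact fun h => hj ⟨_, h⟩
    · exact ⟨fun μ => ⟨0, MvPolynomial.isHomogeneous_zero _ _ _, by simp, by simp⟩, by simp⟩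
    · rintro a b - - ⟨ha, ha'⟩ ⟨hb, hb'⟩
      refine ⟨fun μ => ?_, fun μ j hj x => ?_⟩
      · obtain ⟨p, hp, hp1, hp2⟩ := ha μ
        obtain ⟨q, hq, hq1, hq2⟩ := hb μ
        refine ⟨p + q, hp.add hq, fun x => ?_, fun x => ?_⟩
        · rw [Prod.fst_add, map_add, map_add, hp1, hq1]
        · rw [Prod.snd_add, map_add, map_add, map_add, hp2, hq2]
      · rw [Prod.snd_add, map_add, ha' μ j hj, hb' μ j hj, add_zero]
    · rintro c a - ⟨ha, ha'⟩
      refine ⟨fun μ => ?_, fun μ j hj x => ?_⟩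
      · obtain ⟨p, hp, hp1, hp2⟩ := ha μ
        refine ⟨MvPolynomial.C c * p, by simpa using (MvPolynomial.isHomogeneous_C ι c).mul hp,
          fun x => ?_, fun x => ?_⟩
        · rw [Prod.smul_fst, map_smul, map_mul, MvPolynomial.eval_C, hp1, smul_eq_mul]
        · rw [Prod.smul_snd, map_smul, map_mul, MvPolynomial.rename_C, map_mul,
            MvPolynomial.eval_C, hp2, smul_eq_mul]
      · rw [Prod.smul_snd, map_smul, ha' μ j hj, smul_zero]
  obtain ⟨h1, h2⟩ := key _ h
  refine eq_of_coneVal fun μ _ x => ?_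
  rw [map_zero]
  by_cases hμ : ∃ j, μ j ∉ Set.range g
  · obtain ⟨j, hj⟩ := hμ
    exact h2 μ j hj x
  · push Not at hμ
    choose μ' hμ' using hμ
    obtain rfl : g ∘ μ' = μ := funext hμ'
    obtain ⟨p, hp, hp1, hp2⟩ := h1 μ'
    have hp0 : p = 0 := eq_zero_of_eval_stdSimplex hp fun x hx => by
      have := hp1 ⟨x, hx⟩
      rw [map_zero] at this
      exact this.symm
    rw [hp2, hp0, map_zero, map_zero]

/-- The linear map with matrix entries prescribed by `Ψ`, from the tangent space of a simplex to the
tangent space of a face. -/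
def retract (g : ι → κ) (α : ι → ℕ) : Tangent κ →ₗ[ℝ] Tangent ι :=
  if h : ∑ i, α i = 0 then 0 else
  (LinearMap.pi fun i => (LinearMap.proj (g i) - ((α i : ℝ) / ((∑ i, α i : ℕ) : ℝ)) •
    ∑ i, LinearMap.proj (g i) : (κ → ℝ) →ₗ[ℝ] ℝ) ∘ₗ (Tangent κ).subtype).codRestrict (Tangent ι)
      fun u => by
    have h' : ((∑ i, α i : ℕ) : ℝ) ≠ 0 := by exact_mod_cast h
    rw [LinearMap.mem_ker, LinearMap.sum_apply]
    simp only [LinearMap.proj_apply, LinearMap.pi_apply, LinearMap.comp_apply, LinearMap.sub_apply,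
      LinearMap.smul_apply, LinearMap.sum_apply, Finset.sum_sub_distrib, smul_eq_mul,
      ← Finset.sum_mul, ← Finset.sum_div]
    rw [← Nat.cast_sum, div_self h', one_mul, sub_self]

omit [DecidableEq ι] in
theorem covec_comp_retract (g : ι → κ) (hg : Function.Injective g) {α : ι → ℕ}
    (hα : ∑ i, α i ≠ 0) (i : ι) : covec i ∘ₗ retract g α =
      psi (Finset.univ.image g) (Function.extend g α 0) (g i) := by
  ext u
  rw [retract, dif_neg hα, psi, hg.extend_apply, sum_extend g hg, Finset.sum_image hg.injOn]
  simp only [LinearMap.comp_apply, covec_apply, LinearMap.codRestrict_apply, LinearMap.pi_apply,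
    LinearMap.sub_apply, LinearMap.smul_apply, LinearMap.sum_apply, LinearMap.proj_apply,
    Submodule.subtype_apply, smul_eq_mul]
  push_cast
  rfl

/-- Multiplication of a constant form by a monomial. -/
def monoConst (α : ι → ℕ) : (Tangent ι [⋀^Fin k]→ₗ[ℝ] ℂ) →ₗ[ℂ] StdForm ι k where
  toFun c := monoMul α fun _ => c
  map_add' c d := map_add (monoMul α) (fun _ => c) (fun _ => d)
  map_smul' a c := map_smul (monoMul α) a (fun _ => c)

/-- The pullback of alternating maps, as a linear map. -/
def compLinear {V W : Type*} [AddCommGroup V] [Module ℝ V] [AddCommGroup W] [Module ℝ W]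
    (f : W →ₗ[ℝ] V) : (V [⋀^Fin k]→ₗ[ℝ] ℂ) →ₗ[ℂ] (W [⋀^Fin k]→ₗ[ℝ] ℂ) where
  toFun c := c.compLinearMap f
  map_add' _ _ := rfl
  map_smul' _ _ := rfl

omit [DecidableEq ι] in
-- Distinct monomials of one degree are independent as functions on the simplex. Hence a homogeneous
-- form has only one expression as a sum of monomials with constant forms as coefficients.
theorem monoConst_independent [Nonempty ι]
    {F : (ι → ℕ) →₀ (Tangent ι [⋀^Fin k]→ₗ[ℝ] ℂ)}
    (hF : F ∈ Finsupp.supported (Tangent ι [⋀^Fin k]→ₗ[ℝ] ℂ) ℂ {α : ι → ℕ | ∑ i, α i = r})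
    (h : Finsupp.lsum ℂ (fun α => monoConst (k := k) α) F = 0) : F = 0 := by
  classical
  ext α u
  rw [Finsupp.lsum_apply, Finsupp.sum] at h
  have h0 : ∑ β ∈ F.support, MvPolynomial.C (F β u) * monoPoly β = 0 := by
    refine eq_zero_of_eval_stdSimplex (r := r) (MvPolynomial.IsHomogeneous.sum _ _ _
      fun β hβ => ?_) fun x hx => ?_
    · have h1 : ∑ i, β i = r := hF hβ
      have := (MvPolynomial.isHomogeneous_C ι (F β u)).mul (monoPoly_isHomogeneous β)
      rwa [zero_add, h1] at this
    · have h1 := congrArg (evalAt ⟨x, hx⟩ u) h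
      rw [map_sum, map_zero] at h1
      rw [map_sum, ← h1]
      refine Finset.sum_congr rfl fun β _ => ?_
      rw [map_mul, MvPolynomial.eval_C, mul_comm]
      exact congrArg (· * F β u) (eval_monoPoly β ⟨x, hx⟩)
  have h1 := congrArg (MvPolynomial.coeff (Finsupp.equivFunOnFinite.symm α)) h0
  rw [MvPolynomial.coeff_sum, MvPolynomial.coeff_zero] at h1
  simp only [MvPolynomial.coeff_C_mul, monoPoly, MvPolynomial.coeff_monomial,
    EmbeddingLike.apply_eq_iff_eq, mul_ite, mul_one, mul_zero, Finset.sum_ite_eq'] at h1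
  by_cases hα : α ∈ F.support
  · rw [if_pos hα] at h1
    exact h1
  · rw [Finsupp.notMem_support_iff.1 hα]
    rfl

/-- The covectors Ψ depend on the exponent but, for a fixed exponent, are pullbacks of the dλ along
one linear map `retract`. The extension therefore acts on the constant coefficient of each monomial
separately, and these coefficients are unique. -/
theorem extGraph_full_fst_zero [Nonempty ι] {g : ι → κ} (hg : Function.Injective g) (hr : r ≠ 0)
    {y} (h : (0, y) ∈ extGraph .full r k g) : y = 0 := by
  have key : extGraph .full r k g ≤ (Finsupp.supported (Tangent ι [⋀^Fin k]→ₗ[ℝ] ℂ) ℂ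
      {α : ι → ℕ | ∑ i, α i = r}).map
      ((Finsupp.lsum ℂ fun α => monoConst (k := k) α).prod (Finsupp.lsum ℂ fun α : ι → ℕ =>
        monoConst (Function.extend g α 0) ∘ₗ compLinear (k := k) (retract g α))) := by
    refine Submodule.span_le.2 ?_
    rintro _ ⟨α, σ, hα, rfl⟩
    refine ⟨Finsupp.single α (wedge fun i => covec (σ i)), ?_, Prod.ext ?_ ?_⟩
    · exact Finsupp.single_mem_supported ℂ _ hα
    · exact Finsupp.lsum_single _ _ _ _
    · refine (Finsupp.lsum_single _ _ _ _).trans ?_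
      change monoMul _ (fun _ => (wedge _).compLinearMap _) = _
      rw [wedge_compLinearMap]
      simp only [covec_comp_retract g hg (hα ▸ hr)]
      rfl
  obtain ⟨F, hF, hFz⟩ := key h
  have h0 := monoConst_independent hF (congrArg Prod.fst hFz)
  rw [h0, map_zero] at hFz
  exact (congrArg Prod.snd hFz).symm

theorem extGraph_fst_zero [Nonempty ι] (fam : Family) {g : ι → κ} (hg : Function.Injective g)
    (hr : r ≠ 0) {y} (h : (0, y) ∈ extGraph fam r k g) : y = 0 := by
  cases fam
  · exact extGraph_full_fst_zero hg hr h
  · exact extGraph_trimmed_fst_zero hg h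

end StdForm

namespace StdForm

variable {ι κ : Type*} [Fintype ι] [Fintype κ] [DecidableEq ι] [DecidableEq κ] {k l r s : ℕ}

/-! ### Geometric decomposition -/

theorem monoMul_wedge_mem_space (β : κ → ℕ) (hβ : ∑ i, β i = r) (ℓ : Fin k → Tangent κ →ₗ[ℝ] ℂ)
    (hℓ : ∀ i, ℓ i ∈ Submodule.span ℂ (Set.range (covec (ι := κ)))) :
    monoMul β (fun _ => wedge ℓ) ∈ space .full r k κ := by
  have h := Submodule.mem_map_of_mem (f := monoConst β) (wedge_mem_span hℓ)
  refine Submodule.map_span_le _ _ _ |>.2 ?_ h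
  rintro _ ⟨σ, rfl⟩
  exact Submodule.subset_span ⟨β, σ, hβ, rfl⟩

theorem covec_mem_span (i : κ) : covec i ∈ Submodule.span ℂ (Set.range (covec (ι := κ))) :=
  Submodule.subset_span ⟨i, rfl⟩

theorem psi_mem_span (fs : Finset κ) (β : κ → ℕ) (j : κ) :
    psi fs β j ∈ Submodule.span ℂ (Set.range (covec (ι := κ))) :=
  sub_mem (covec_mem_span j) (Submodule.smul_mem _ _ (sum_mem fun i _ => covec_mem_span i))

theorem faceSpace_le_space (fam : Family) (fs : Finset κ) :
    faceSpace fam r k fs ≤ space fam r k κ := by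
  cases fam
  · refine Submodule.span_le.2 ?_
    rintro _ ⟨β, σ, hβ, -, rfl⟩
    exact monoMul_wedge_mem_space β hβ _ fun i => psi_mem_span fs β _
  · refine Submodule.span_le.2 ?_
    rintro _ ⟨β, σ, hβ, -, rfl⟩
    exact Submodule.subset_span ⟨β, σ, hβ, rfl⟩

/-- Since `psi` is dλ outside `A` and all the dλ sum to zero, the correction term is itself minus
the sum of the `psi` outside `A`. -/
theorem covec_mem_span_psi {A : Finset κ} {α : κ → ℕ} (hA : ∀ j, j ∉ A → α j = 0) (i : κ) :
    covec i ∈ Submodule.span ℂ (Set.range (psi A α)) := by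
  have h1 : ∑ j ∈ A, covec j = -∑ j ∈ Aᶜ, psi A α j := by
    rw [eq_neg_iff_add_eq_zero, Finset.sum_congr rfl fun j hj =>
      psi_of_eq_zero A (hA j (Finset.mem_compl.1 hj)), Finset.sum_add_sum_compl]
    exact sum_covec
  have h2 : covec i = psi A α i + ((α i : ℂ) / ((∑ i, α i : ℕ) : ℂ)) • ∑ j ∈ A, covec j := by
    rw [psi, sub_add_cancel]
  rw [h2, h1]
  have h3 : ∀ j, psi A α j ∈ Submodule.span ℂ (Set.range (psi A α)) := fun j =>
    Submodule.subset_span ⟨j, rfl⟩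
  exact add_mem (h3 i) (Submodule.smul_mem _ _ (neg_mem (sum_mem fun j _ => h3 j)))

/-- Enlarging the vertex set in the correction term from `A` to `A ∪ im σ` multiplies the covectors
by a matrix `1 + c vᵀ`. Here `c` lives on the indices with `σ a ∈ A` and `v` on the others, so `v ⬝ᵥ
c = 0` and the determinant is 1. -/
theorem wedge_psi_union {A : Finset κ} {α : κ → ℕ} (hA : ∀ j, j ∉ A → α j = 0)
    {σ : Fin k → κ} (hσ : Function.Injective σ) :
    (wedge fun i => psi (A ∪ Finset.univ.image σ) α (σ i)) = wedge fun i => psi A α (σ i) := by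
  set c : Fin k → ℂ := fun a => -((α (σ a) : ℂ) / ((∑ i, α i : ℕ) : ℂ)) with hc
  set v : Fin k → ℂ := fun a => if σ a ∈ A then 0 else 1 with hv
  have hsum : ∑ j ∈ A ∪ Finset.univ.image σ, covec j =
      ∑ j ∈ A, covec j + ∑ a, v a • psi A α (σ a) := by
    rw [← Finset.union_sdiff_self_eq_union, Finset.sum_union Finset.disjoint_sdiff]
    congr 1
    have h1 : Finset.univ.image σ \ A = (Finset.univ.filter fun a => σ a ∉ A).image σ := by
      ext j
      simp only [Finset.mem_sdiff, Finset.mem_image, Finset.mem_univ, true_and, Finset.mem_filter]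
      constructor
      · rintro ⟨⟨a, rfl⟩, h⟩
        exact ⟨a, h, rfl⟩
      · rintro ⟨a, h, rfl⟩
        exact ⟨⟨a, rfl⟩, h⟩
    rw [h1, Finset.sum_image hσ.injOn, Finset.sum_filter]
    refine Finset.sum_congr rfl fun a _ => ?_
    simp only [hv]
    by_cases h : σ a ∈ A
    · rw [if_neg (not_not.2 h), if_pos h, zero_smul]
    · rw [if_pos h, if_neg h, one_smul, psi_of_eq_zero A (hA _ h)]
  ext u
  rw [wedge_apply, wedge_apply]
  have hM : (Matrix.of fun i j => psi (A ∪ Finset.univ.image σ) α (σ i) (u j)) =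
      (1 + Matrix.replicateCol Unit c * Matrix.replicateRow Unit v) *
        Matrix.of fun i j => psi A α (σ i) (u j) := by
    ext a b
    have h2 : psi (A ∪ Finset.univ.image σ) α (σ a) =
        psi A α (σ a) + c a • ∑ a', v a' • psi A α (σ a') := by
      rw [psi, hsum, psi]
      simp only [hc]
      module
    rw [Matrix.add_mul, Matrix.one_mul, Matrix.mul_assoc, Matrix.add_apply, Matrix.of_apply, h2]
    simp only [Matrix.of_apply, LinearMap.add_apply, LinearMap.smul_apply, LinearMap.sum_apply,
      Matrix.mul_apply, Matrix.replicateCol_apply, Matrix.replicateRow_apply, smul_eq_mul,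
      Finset.univ_unique, Finset.sum_singleton]
  rw [hM, Matrix.det_mul, Matrix.det_one_add_replicateCol_mul_replicateRow]
  have h0 : v ⬝ᵥ c = 0 := Finset.sum_eq_zero fun a _ => by
    simp only [hv, hc]
    split_ifs with h
    · rw [zero_mul]
    · simp [hA _ h]
  rw [h0, add_zero, one_mul]

theorem wedge_eq_zero_of_not_injective {V : Type*} [AddCommGroup V] [Module ℝ V]
    (e : κ → V →ₗ[ℝ] ℂ) {σ : Fin k → κ} (h : ¬ Function.Injective σ) :
    (wedge fun i => e (σ i)) = 0 := by
  simp only [Function.Injective, not_forall] at h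
  obtain ⟨i, j, hij, hne⟩ := h
  exact wedge_eq_zero_of_eq _ hne (by rw [hij])

theorem psiForm_eq_zero (fs : Finset κ) (β : κ → ℕ) {σ : Fin k → κ}
    (h : ¬ Function.Injective σ) : psiForm fs β σ = 0 := by
  rw [psiForm, wedge_eq_zero_of_not_injective _ h]
  exact map_zero _

/-- For full forms the alternators are first rewritten in the covectors `psi` of the support `A` of
the monomial. Each resulting term belongs to the face spanned by `A` and its indices, by
`wedge_psi_union`. -/
theorem space_le_iSup_faceSpace (fam : Family) :
    space fam r k κ ≤ ⨆ fs : Finset κ, faceSpace fam r k fs := by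
  cases fam
  · refine Submodule.span_le.2 ?_
    rintro _ ⟨α, σ, hα, rfl⟩
    set A : Finset κ := Finset.univ.filter fun j => α j ≠ 0 with hAdef
    have hA : ∀ j, j ∉ A → α j = 0 := fun j hj => by simpa [hAdef] using hj
    have h := Submodule.mem_map_of_mem (f := monoConst α)
      (wedge_mem_span fun i => covec_mem_span_psi hA (σ i))
    refine Submodule.map_span_le _ _ _ |>.2 ?_ h
    rintro _ ⟨τ, rfl⟩
    by_cases hτ : Function.Injective τ
    · refine Submodule.mem_iSup_of_mem (A ∪ Finset.univ.image τ)
        (Submodule.subset_span ⟨α, τ, hα, fun j => ?_, ?_⟩)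
      · simp [hAdef]
      · rw [psiForm, wedge_psi_union hA hτ]
        rfl
    · simp only [wedge_eq_zero_of_not_injective _ hτ, map_zero, zero_mem]
  · refine Submodule.span_le.2 ?_
    rintro _ ⟨α, ρ, hα, rfl⟩
    exact Submodule.mem_iSup_of_mem ((Finset.univ.filter fun j => α j ≠ 0) ∪ Finset.univ.image ρ)
      (Submodule.subset_span ⟨α, ρ, hα, fun j => by simp, rfl⟩)

theorem iSup_faceSpace (fam : Family) :
    ⨆ fs : Finset κ, faceSpace fam r k fs = space fam r k κ :=
  le_antisymm (iSup_le fun fs => faceSpace_le_space fam fs) (space_le_iSup_faceSpace fam)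

theorem exists_comp_eq {m : ℕ} {ι : Type*} [Fintype ι] {g : ι → κ} (hg : Function.Injective g)
    {β : κ → ℕ} {σ : Fin m → κ}
    (h : ∀ j, j ∈ Finset.univ.image g ↔ β j ≠ 0 ∨ j ∈ Set.range σ) :
    Function.extend g (β ∘ g) 0 = β ∧ ∃ τ : Fin m → ι, σ = g ∘ τ := by
  refine ⟨extend_comp_self g hg β fun j hj => ?_, ?_⟩
  · by_contra h0
    exact hj (by simpa using (h j).2 (Or.inl h0))
  · have h1 : ∀ i, ∃ a, g a = σ i := fun i => by simpa using (h (σ i)).2 (Or.inr ⟨i, rfl⟩)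
    choose τ hτ using h1
    exact ⟨τ, funext fun i => (hτ i).symm⟩

theorem exists_mem_extGraph (fam : Family) {g : ι → κ} (hg : Function.Injective g) {y}
    (hy : y ∈ faceSpace fam r k (Finset.univ.image g)) : ∃ x, (x, y) ∈ extGraph fam r k g := by
  have key : faceSpace fam r k (Finset.univ.image g) ≤
      (extGraph fam r k g).map (LinearMap.snd ℂ _ _) := by
    cases fam
    · refine Submodule.span_le.2 ?_
      rintro _ ⟨β, σ, hr, h, rfl⟩
      obtain ⟨h1, τ, rfl⟩ := exists_comp_eq hg h
      refine ⟨_, Submodule.subset_span ⟨β ∘ g, τ, ?_, rfl⟩, ?_⟩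
      · rw [← hr, ← sum_extend g hg, h1]
      · rw [h1]
        rfl
    · refine Submodule.span_le.2 ?_
      rintro _ ⟨β, σ, hr, h, rfl⟩
      obtain ⟨h1, τ, rfl⟩ := exists_comp_eq hg h
      refine ⟨_, Submodule.subset_span ⟨β ∘ g, τ, ?_, rfl⟩, ?_⟩
      · rw [← hr, ← sum_extend g hg, h1]
      · rw [h1]
        rfl
  obtain ⟨⟨x, y'⟩, h, rfl⟩ := key hy
  exact ⟨x, h⟩

theorem faceSpace_empty (fam : Family) (hr : r ≠ 0) : faceSpace fam r k (∅ : Finset κ) = ⊥ := by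
  refine (Submodule.eq_bot_iff _).2 fun y hy => ?_
  have key : faceSpace fam r k (∅ : Finset κ) ≤ ⊥ := by
    cases fam
    · refine Submodule.span_le.2 ?_
      rintro _ ⟨β, σ, rfl, h, rfl⟩
      refine (hr (Finset.sum_eq_zero fun j _ => ?_)).elim
      by_contra hj
      exact absurd ((h j).2 (Or.inl hj)) (Finset.notMem_empty j)
    · refine Submodule.span_le.2 ?_
      rintro _ ⟨β, ρ, -, h, rfl⟩
      exact absurd ((h _).2 (Or.inr ⟨0, rfl⟩)) (Finset.notMem_empty _)
  exact key hy

/-- A form in the contribution of `G` is the extension of its restriction to `G`, so it vanishes if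
that restriction does; contributions of faces not contained in `G` restrict to zero on `G`. -/
theorem iSupIndep_faceSpace (fam : Family) (hr : r ≠ 0) :
    iSupIndep fun fs : Finset κ => faceSpace fam r k fs := by
  refine iSupIndep_of_triangular (K := fun fs => LinearMap.ker
    (pull (k := k) (Subtype.val : {j // j ∈ fs} → κ))) (fun G G' h => ?_) fun G => ?_
  · intro y hy
    refine pull_faceSpace fam Subtype.val_injective (fun hs => h ?_) hy
    intro j hj
    simpa using hs hj
  · rw [Submodule.disjoint_def]
    intro y hy hy0
    rcases G.eq_empty_or_nonempty with rfl | ⟨j, hj⟩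
    · rwa [faceSpace_empty fam hr] at hy
    · have : Nonempty {j // j ∈ G} := ⟨⟨j, hj⟩⟩
      have hG : Finset.univ.image (Subtype.val : {j // j ∈ G} → κ) = G := by
        ext j
        simp
      rw [← hG] at hy
      obtain ⟨x, hx⟩ := exists_mem_extGraph fam Subtype.val_injective hy
      have hx0 : x = 0 := (pull_extGraph fam Subtype.val_injective hx).symm.trans hy0
      rw [hx0] at hx
      exact extGraph_fst_zero fam Subtype.val_injective hr hx

/-- There are no forms of degree larger than the dimension of the face. -/
theorem faceSpace_eq_bot_of_card_le (fam : Family) (hr : r ≠ 0) {fs : Finset κ}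
    (hk : fs.card ≤ k) : faceSpace fam r k fs = ⊥ := by
  rcases fs.eq_empty_or_nonempty with rfl | ⟨j, hj⟩
  · exact faceSpace_empty fam hr
  refine (Submodule.eq_bot_iff _).2 fun y hy => ?_
  have : Nonempty {j // j ∈ fs} := ⟨⟨j, hj⟩⟩
  have hG : Finset.univ.image (Subtype.val : {j // j ∈ fs} → κ) = fs := by
    ext j
    simp
  rw [← hG] at hy
  obtain ⟨x, hx⟩ := exists_mem_extGraph fam Subtype.val_injective hy
  have hx0 : x = 0 := eq_of_edgeVal fun τ hτ _ => by
    have := Fintype.card_le_of_injective τ hτ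
    simp only [Fintype.card_fin, Fintype.card_coe] at this
    omega
  rw [hx0] at hx
  exact extGraph_fst_zero fam Subtype.val_injective hr hx

omit [Fintype ι] [DecidableEq ι] in
theorem card_le_sum_add {fs : Finset κ} {β : κ → ℕ} {m : ℕ} {σ : Fin m → κ}
    (h : ∀ j, j ∈ fs ↔ β j ≠ 0 ∨ j ∈ Set.range σ) : fs.card ≤ (∑ j, β j) + m := by
  have h1 : fs = (Finset.univ.filter fun j => β j ≠ 0) ∪ Finset.univ.image σ := by
    ext j
    simp [h j]
  rw [h1]
  refine (Finset.card_union_le _ _).trans (add_le_add ?_ ?_)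
  · rw [Finset.card_eq_sum_ones]
    refine (Finset.sum_le_sum fun j hj => ?_).trans
      (Finset.sum_le_sum_of_subset (f := β) (Finset.filter_subset (fun j => β j ≠ 0) Finset.univ))
    have := (Finset.mem_filter.1 hj).2
    omega
  · simpa using Finset.card_image_le (s := Finset.univ) (f := σ)

theorem faceSpace_full_eq_bot {fs : Finset κ} (h : r + k < fs.card) :
    faceSpace .full r k fs = ⊥ := by
  refine (Submodule.span_eq_bot).2 ?_
  rintro _ ⟨β, σ, rfl, hβ, rfl⟩
  have := card_le_sum_add hβ
  omega

theorem faceSpace_trimmed_eq_bot {fs : Finset κ} (h : r + k < fs.card) :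
    faceSpace .trimmed r k fs = ⊥ := by
  refine (Submodule.span_eq_bot).2 ?_
  rintro _ ⟨β, σ, rfl, hβ, rfl⟩
  have := card_le_sum_add hβ
  omega

/-! ### Bases of the contributions of the faces -/

omit [Fintype ι] in
theorem sum_single_apply {m : ℕ} {c : Fin m → ι} (hc : Function.Injective c) (i : ι) :
    (∑ a, Pi.single (c a) 1 : ι → ℕ) i = if i ∈ Set.range c then 1 else 0 := by
  rw [Finset.sum_apply]
  split_ifs with h
  · obtain ⟨a, rfl⟩ := h
    rw [Finset.sum_eq_single a]
    · simp
    · intro b _ hb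
      rw [Pi.single_apply, if_neg]
      exact fun h => hb (hc h.symm)
    · simp
  · refine Finset.sum_eq_zero fun a _ => ?_
    rw [Pi.single_apply, if_neg]
    exact fun h' => h ⟨a, h'.symm⟩

theorem sum_sum_single {m : ℕ} (c : Fin m → ι) :
    ∑ i, (∑ a, Pi.single (c a) 1 : ι → ℕ) i = m := by
  simp only [Finset.sum_apply]
  rw [Finset.sum_comm]
  simp

theorem exists_eq_add_sum_single {m : ℕ} {c : Fin m → ι} (hc : Function.Injective c) {γ : ι → ℕ}
    (hγ : ∀ a, γ (c a) ≠ 0) : ∃ α : ι → ℕ, γ = α + ∑ a, Pi.single (c a) 1 := by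
  refine ⟨γ - ∑ a, Pi.single (c a) 1, (tsub_add_cancel_of_le fun i => ?_).symm⟩
  rw [sum_single_apply hc]
  split_ifs with h
  · obtain ⟨a, rfl⟩ := h
    exact Nat.one_le_iff_ne_zero.2 (hγ a)
  · exact Nat.zero_le _

theorem exists_equiv_of_inl {p q : ℕ} {σ : Fin p → Fin (p + q + 1)} (hσ : Function.Injective σ) :
    ∃ f : Fin p ⊕ Fin (q + 1) ≃ Fin (p + q + 1), (fun i => f (Sum.inl i)) = σ :=
  (exists_equiv_sum_inl card_aux' hσ).imp fun _ h => funext h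

theorem exists_equiv_of_inr {p q : ℕ} {ρ : Fin (q + 1) → Fin (p + q + 1)}
    (hρ : Function.Injective ρ) :
    ∃ f : Fin p ⊕ Fin (q + 1) ≃ Fin (p + q + 1), (fun i => f (Sum.inr i)) = ρ :=
  (exists_equiv_sum_inr card_aux' hρ).imp fun _ h => funext h

section Composite

variable {p q : ℕ}

/-- The composition of two relations that are linear subspaces. -/
def compGraph {M N P : Type*} [AddCommGroup M] [Module ℂ M] [AddCommGroup N] [Module ℂ N]
    [AddCommGroup P] [Module ℂ P] (G : Submodule ℂ (M × N)) (H : Submodule ℂ (N × P)) :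
    Submodule ℂ (M × P) where
  carrier := {z | ∃ y, (z.1, y) ∈ G ∧ (y, z.2) ∈ H}
  zero_mem' := ⟨0, G.zero_mem, H.zero_mem⟩
  add_mem' := by
    rintro a b ⟨y, h1, h2⟩ ⟨y', h1', h2'⟩
    exact ⟨y + y', G.add_mem h1 h1', H.add_mem h2 h2'⟩
  smul_mem' := by
    rintro c a ⟨y, h1, h2⟩
    exact ⟨c • y, G.smul_mem c h1, H.smul_mem c h2⟩

/-- The converse of a linear relation. -/
def swapGraph {M N : Type*} [AddCommGroup M] [Module ℂ M] [AddCommGroup N] [Module ℂ N]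
    (G : Submodule ℂ (M × N)) : Submodule ℂ (N × M) :=
  G.comap (LinearEquiv.prodComm ℂ N M : N × M →ₗ[ℂ] M × N)

theorem mem_swapGraph {M N : Type*} [AddCommGroup M] [Module ℂ M] [AddCommGroup N] [Module ℂ N]
    {G : Submodule ℂ (M × N)} {x : N} {y : M} : (x, y) ∈ swapGraph G ↔ (y, x) ∈ G := Iff.rfl

theorem graphImage_compGraph {M N P : Type*} [AddCommGroup M] [Module ℂ M] [AddCommGroup N]
    [Module ℂ N] [AddCommGroup P] [Module ℂ P] (G : Submodule ℂ (M × N))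
    (H : Submodule ℂ (N × P)) (A : Set M) :
    graphImage (compGraph G H) A = graphImage H (graphImage G A) := by
  ext z
  constructor
  · rintro ⟨x, hx, y, h1, h2⟩
    exact ⟨y, ⟨x, hx, h1⟩, h2⟩
  · rintro ⟨y, ⟨x, hx, h1⟩, h2⟩
    exact ⟨x, hx, y, h1, h2⟩

/-- The generators produced by I and J meet the support condition of `faceSpace` automatically: one
part of the enumeration occurs as indices, the complementary part in the added monomial. -/
theorem mem_image_iff_extend {g : Fin (p + q + 1) → κ} (hg : Function.Injective g)
    (f : Fin p ⊕ Fin (q + 1) ≃ Fin (p + q + 1)) (α : Fin (p + q + 1) → ℕ) (j : κ) :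
    (j ∈ Finset.univ.image g ↔
      Function.extend g (α + ∑ i, Pi.single (f (Sum.inl i)) 1) 0 j ≠ 0 ∨
        j ∈ Set.range (g ∘ fun i => f (Sum.inr i))) ∧
    (j ∈ Finset.univ.image g ↔
      Function.extend g (α + ∑ i, Pi.single (f (Sum.inr i)) 1) 0 j ≠ 0 ∨
        j ∈ Set.range (g ∘ fun i => f (Sum.inl i))) := by
  by_cases hj : j ∈ Set.range g
  · obtain ⟨i, rfl⟩ := hj
    obtain ⟨a, rfl⟩ := f.surjective i
    have hl : Function.Injective fun i => f (Sum.inl i) := f.injective.comp Sum.inl_injective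
    have hr : Function.Injective fun i => f (Sum.inr i) := f.injective.comp Sum.inr_injective
    rw [hg.extend_apply, hg.extend_apply, Pi.add_apply, Pi.add_apply, sum_single_apply hl,
      sum_single_apply hr]
    rcases a with a | a
    · simp [hg.eq_iff]
    · simp [hg.eq_iff]
  · rw [extend_eq_zero g _ hj, extend_eq_zero g _ hj]
    have h1 : j ∉ Finset.univ.image g := by simpa using hj
    have h2 : ∀ {m : ℕ} (c : Fin m → Fin (p + q + 1)), j ∉ Set.range (g ∘ c) := fun c h =>
      hj (Set.range_comp_subset_range _ _ h)
    simp only [h1, h2, ne_eq, not_true_eq_false, or_self, and_self]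

/-- Conversely, the support condition forces the monomial to be divisible by every barycentric
coordinate of the face that is not an index. -/
theorem exists_decomposition_inl {g : Fin (p + q + 1) → κ} (hg : Function.Injective g)
    {β : κ → ℕ} {ρ : Fin (q + 1) → κ} (hρ : Function.Injective ρ)
    (h : ∀ j, j ∈ Finset.univ.image g ↔ β j ≠ 0 ∨ j ∈ Set.range ρ) :
    ∃ (f : Fin p ⊕ Fin (q + 1) ≃ Fin (p + q + 1)) (α : Fin (p + q + 1) → ℕ),
      ρ = (g ∘ fun i => f (Sum.inr i)) ∧
      β = Function.extend g (α + ∑ i, Pi.single (f (Sum.inl i)) 1) 0 := by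
  obtain ⟨h1, τ, rfl⟩ := exists_comp_eq hg h
  obtain ⟨f, rfl⟩ := exists_equiv_of_inr (p := p) hρ.of_comp
  obtain ⟨α, hα⟩ := exists_eq_add_sum_single (c := fun i => f (Sum.inl i)) (γ := β ∘ g)
    (f.injective.comp Sum.inl_injective) fun a => by
      refine ((h (g (f (Sum.inl a)))).1 (Finset.mem_image_of_mem g (Finset.mem_univ _)))
        |>.resolve_right ?_
      rintro ⟨b, hb⟩
      simpa using f.injective (hg hb)
  exact ⟨f, α, rfl, by rw [← hα, h1]⟩

theorem exists_decomposition_inr {g : Fin (p + q + 1) → κ} (hg : Function.Injective g)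
    {β : κ → ℕ} {ρ : Fin p → κ} (hρ : Function.Injective ρ)
    (h : ∀ j, j ∈ Finset.univ.image g ↔ β j ≠ 0 ∨ j ∈ Set.range ρ) :
    ∃ (f : Fin p ⊕ Fin (q + 1) ≃ Fin (p + q + 1)) (α : Fin (p + q + 1) → ℕ),
      ρ = (g ∘ fun i => f (Sum.inl i)) ∧
      β = Function.extend g (α + ∑ i, Pi.single (f (Sum.inr i)) 1) 0 := by
  obtain ⟨h1, τ, rfl⟩ := exists_comp_eq hg h
  obtain ⟨f, rfl⟩ := exists_equiv_of_inl (q := q) hρ.of_comp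
  obtain ⟨α, hα⟩ := exists_eq_add_sum_single (c := fun i => f (Sum.inr i)) (γ := β ∘ g)
    (f.injective.comp Sum.inr_injective) fun a => by
      refine ((h (g (f (Sum.inr a)))).1 (Finset.mem_image_of_mem g (Finset.mem_univ _)))
        |>.resolve_right ?_
      rintro ⟨b, hb⟩
      simpa using f.injective (hg hb)
  exact ⟨f, α, rfl, by rw [← hα, h1]⟩

theorem generator_mem_starI_extGraph (f : Fin p ⊕ Fin (q + 1) ≃ Fin (p + q + 1))
    {α : Fin (p + q + 1) → ℕ} (hα : ∑ i, α i = s) (g : Fin (p + q + 1) → κ) :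
    (monoMul α (dForm fun i => f (Sum.inl i)), orderSign f •
      monoMul (Function.extend g (α + ∑ i, Pi.single (f (Sum.inl i)) 1) 0)
        (whitney (g ∘ fun i => f (Sum.inr i)))) ∈
      compGraph (starI s p q) (extGraph .trimmed (s + p + 1) q g) := by
  refine ⟨_, generator_mem_starI f hα, ?_⟩
  have h : (monoMul (α + ∑ i, Pi.single (f (Sum.inl i)) 1) (whitney fun i => f (Sum.inr i)),
      monoMul (Function.extend g (α + ∑ i, Pi.single (f (Sum.inl i)) 1) 0)
        (whitney (g ∘ fun i => f (Sum.inr i)))) ∈ extGraph .trimmed (s + p + 1) q g := by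
    refine Submodule.subset_span ⟨_, _, ?_, rfl⟩
    simp only [Pi.add_apply, Finset.sum_add_distrib, sum_sum_single, hα]
  exact Submodule.smul_mem _ (orderSign f) h

theorem generator_mem_starJ_extGraph (f : Fin p ⊕ Fin (q + 1) ≃ Fin (p + q + 1))
    {α : Fin (p + q + 1) → ℕ} (hα : (∑ i, α i) + 1 = s) (g : Fin (p + q + 1) → κ) :
    (orderSign f • monoMul α (whitney fun i => f (Sum.inr i)), psiForm (Finset.univ.image g)
      (Function.extend g (α + ∑ i, Pi.single (f (Sum.inr i)) 1) 0)
        (g ∘ fun i => f (Sum.inl i))) ∈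
      compGraph (swapGraph (starJ s p q)) (extGraph .full (s + q) p g) := by
  refine ⟨_, generator_mem_starJ f hα, Submodule.subset_span ⟨_, _, ?_, rfl⟩⟩
  simp only [Pi.add_apply, Finset.sum_add_distrib, sum_sum_single]
  omega

/-- The relation between the forms on a face and the trimmed forms on the simplex that belong to
this face. -/
def faceGraphI (s p q : ℕ) (g : Fin (p + q + 1) → κ) :
    Submodule ℂ (StdForm (Fin (p + q + 1)) p × StdForm κ q) :=
  compGraph (starI s p q) (extGraph .trimmed (s + p + 1) q g)

/-- The relation between the trimmed forms on a face and the forms on the simplex that belong to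
this face. -/
def faceGraphJ (s p q : ℕ) (g : Fin (p + q + 1) → κ) :
    Submodule ℂ (StdForm (Fin (p + q + 1)) q × StdForm κ p) :=
  compGraph (swapGraph (starJ s p q)) (extGraph .full (s + q) p g)

theorem faceGraphI_fst_zero {g : Fin (p + q + 1) → κ} (hg : Function.Injective g) {y}
    (h : (0, y) ∈ faceGraphI s p q g) : y = 0 := by
  obtain ⟨ω, h1, h2⟩ := h
  rw [starI_fst_zero h1] at h2
  exact extGraph_fst_zero .trimmed hg (by omega) h2

theorem exists_mem_faceGraphI {g : Fin (p + q + 1) → κ} (hg : Function.Injective g) {x}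
    (hx : x ∈ space .full s p (Fin (p + q + 1))) :
    ∃ y ∈ faceSpace .trimmed (s + p + 1) q (Finset.univ.image g), (x, y) ∈ faceGraphI s p q g := by
  refine Submodule.span_induction ?_ ⟨0, zero_mem _, zero_mem _⟩ ?_ ?_ hx
  · rintro _ ⟨α, σ, hα, rfl⟩
    by_cases hσ : Function.Injective σ
    · obtain ⟨f, rfl⟩ := exists_equiv_of_inl hσ
      refine ⟨_, Submodule.smul_mem _ _ (Submodule.subset_span
          ⟨_, _, ?_, fun j => (mem_image_iff_extend hg f α j).1, rfl⟩),
        generator_mem_starI_extGraph f hα g⟩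
      rw [sum_extend g hg]
      simp only [Pi.add_apply, Finset.sum_add_distrib, sum_sum_single, hα]
    · rw [dForm_eq_zero hσ, map_zero]
      exact ⟨0, zero_mem _, zero_mem _⟩
  · rintro a b - - ⟨y, hy, h⟩ ⟨y', hy', h'⟩
    exact ⟨y + y', add_mem hy hy', add_mem h h'⟩
  · rintro c a - ⟨y, hy, h⟩
    exact ⟨c • y, Submodule.smul_mem _ c hy, Submodule.smul_mem _ c h⟩

/-- Up to signs the generators on the face and those of the contribution correspond to each other,
so the relation is total in both directions. Injectivity: restriction undoes the extension, and then
`starI_snd_zero` applies. -/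
theorem isBasisOf_faceGraphI {A : Set (StdForm (Fin (p + q + 1)) p)}
    (hA : IsBasisOf A (space .full s p (Fin (p + q + 1)))) {g : Fin (p + q + 1) → κ}
    (hg : Function.Injective g) :
    IsBasisOf (graphImage (faceGraphI s p q g) A)
      (faceSpace .trimmed (s + p + 1) q (Finset.univ.image g)) := by
  refine hA.graphImage (fun y => faceGraphI_fst_zero hg) ?_
    (fun x => exists_mem_faceGraphI hg) (fun y hy => ?_)
  · rintro x ⟨ω, h1, h2⟩
    have h3 := pull_extGraph .trimmed hg h2
    rw [map_zero] at h3
    rw [← h3] at h1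
    exact starI_snd_zero h1
  · refine Submodule.span_induction ?_ ⟨0, zero_mem _, zero_mem _⟩ ?_ ?_ hy
    · rintro _ ⟨β, ρ, hβ, h, rfl⟩
      by_cases hρ : Function.Injective ρ
      · obtain ⟨f, α, rfl, rfl⟩ := exists_decomposition_inl hg hρ h
        have hα : ∑ i, α i = s := by
          simp only [sum_extend g hg, Pi.add_apply, Finset.sum_add_distrib, sum_sum_single] at hβ
          omega
        have h1 := Submodule.smul_mem _ (orderSign f) (generator_mem_starI_extGraph f hα g)
        rw [Prod.smul_mk, smul_smul, orderSign_mul_self, one_smul] at h1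
        exact ⟨_, Submodule.smul_mem _ _ (Submodule.subset_span ⟨_, _, hα, rfl⟩), h1⟩
      · rw [whitney_eq_zero hρ, map_zero]
        exact ⟨0, zero_mem _, zero_mem _⟩
    · rintro a b - - ⟨y, hy, h⟩ ⟨y', hy', h'⟩
      exact ⟨y + y', add_mem hy hy', add_mem h h'⟩
    · rintro c a - ⟨y, hy, h⟩
      exact ⟨c • y, Submodule.smul_mem _ c hy, Submodule.smul_mem _ c h⟩

theorem faceGraphJ_fst_zero {g : Fin (p + q + 1) → κ} (hg : Function.Injective g)
    (hr : s + q ≠ 0) {y} (h : (0, y) ∈ faceGraphJ s p q g) : y = 0 := by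
  obtain ⟨ω, h1, h2⟩ := h
  rw [mem_swapGraph] at h1
  rw [starJ_snd_zero h1] at h2
  exact extGraph_fst_zero .full hg hr h2

theorem exists_mem_faceGraphJ {g : Fin (p + q + 1) → κ} (hg : Function.Injective g) {x}
    (hx : x ∈ space .trimmed s q (Fin (p + q + 1))) :
    ∃ y ∈ faceSpace .full (s + q) p (Finset.univ.image g), (x, y) ∈ faceGraphJ s p q g := by
  refine Submodule.span_induction ?_ ⟨0, zero_mem _, zero_mem _⟩ ?_ ?_ hx
  · rintro _ ⟨α, ρ, hα, rfl⟩
    by_cases hρ : Function.Injective ρ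
    · obtain ⟨f, rfl⟩ := exists_equiv_of_inr (p := p) hρ
      have h1 := Submodule.smul_mem _ (orderSign f) (generator_mem_starJ_extGraph f hα g)
      rw [Prod.smul_mk, smul_smul, orderSign_mul_self, one_smul] at h1
      refine ⟨_, Submodule.smul_mem _ _ (Submodule.subset_span
          ⟨_, _, ?_, fun j => (mem_image_iff_extend hg f α j).2, rfl⟩), h1⟩
      rw [sum_extend g hg]
      simp only [Pi.add_apply, Finset.sum_add_distrib, sum_sum_single]
      omega
    · rw [whitney_eq_zero hρ, map_zero]
      exact ⟨0, zero_mem _, zero_mem _⟩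
  · rintro a b - - ⟨y, hy, h⟩ ⟨y', hy', h'⟩
    exact ⟨y + y', add_mem hy hy', add_mem h h'⟩
  · rintro c a - ⟨y, hy, h⟩
    exact ⟨c • y, Submodule.smul_mem _ c hy, Submodule.smul_mem _ c h⟩

theorem isBasisOf_faceGraphJ {A : Set (StdForm (Fin (p + q + 1)) q)}
    (hA : IsBasisOf A (space .trimmed s q (Fin (p + q + 1)))) {g : Fin (p + q + 1) → κ}
    (hg : Function.Injective g) (hr : s + q ≠ 0) :
    IsBasisOf (graphImage (faceGraphJ s p q g) A)
      (faceSpace .full (s + q) p (Finset.univ.image g)) := by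
  refine hA.graphImage (fun y => faceGraphJ_fst_zero hg hr) ?_
    (fun x => exists_mem_faceGraphJ hg) (fun y hy => ?_)
  · rintro x ⟨ω, h1, h2⟩
    rw [mem_swapGraph] at h1
    have h3 := pull_extGraph .full hg h2
    rw [map_zero] at h3
    rw [← h3] at h1
    exact starJ_fst_zero h1
  · refine Submodule.span_induction ?_ ⟨0, zero_mem _, zero_mem _⟩ ?_ ?_ hy
    · rintro _ ⟨β, σ, hβ, h, rfl⟩
      by_cases hσ : Function.Injective σ
      · obtain ⟨f, α, rfl, rfl⟩ := exists_decomposition_inr hg hσ h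
        have hα : (∑ i, α i) + 1 = s := by
          simp only [sum_extend g hg, Pi.add_apply, Finset.sum_add_distrib, sum_sum_single] at hβ
          omega
        exact ⟨_, Submodule.smul_mem _ _ (Submodule.subset_span ⟨_, _, hα, rfl⟩),
          generator_mem_starJ_extGraph f hα g⟩
      · rw [psiForm_eq_zero _ _ hσ]
        exact ⟨0, zero_mem _, zero_mem _⟩
    · rintro a b - - ⟨y, hy, h⟩ ⟨y', hy', h'⟩
      exact ⟨y + y', add_mem hy hy', add_mem h h'⟩
    · rintro c a - ⟨y, hy, h⟩
      exact ⟨c • y, Submodule.smul_mem _ c hy, Submodule.smul_mem _ c h⟩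

end Composite

end StdForm

section Transport

variable {E : Type*} [AddCommGroup E] [Module ℝ E] {n k : ℕ}

open StdForm

/-! ### Barycentric coordinates identify a simplex with the standard simplex -/

theorem bary_affineCombination (T : Affine.Simplex ℝ E n) {x : Fin (n + 1) → ℝ}
    (hx : ∑ i, x i = 1) (p : hull T) (hp : (p : E) = Finset.univ.affineCombination ℝ T.points x)
    (i : Fin (n + 1)) : (vertexBasis T).coord i p = x i := by
  have h : p = Finset.univ.affineCombination ℝ (vertexBasis T) x := by
    apply Subtype.ext
    rw [hp]
    exact (Finset.univ.map_affineCombination (vertexBasis T) x hx (hull T).subtype).symm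
  rw [h, AffineBasis.coord_apply_combination_of_mem _ (Finset.mem_univ i) hx]

/-- The point with given barycentric coordinates. -/
def baryPoint (T : Affine.Simplex ℝ E n) (x : stdSimplex ℝ (Fin (n + 1))) : T.closedInterior :=
  ⟨Finset.univ.affineCombination ℝ T.points x,
    (Affine.Simplex.affineCombination_mem_closedInterior_iff x.2.2).2 fun i =>
      ⟨x.2.1 i, stdSimplex.le_one x i⟩⟩

theorem bary_baryPoint (T : Affine.Simplex ℝ E n) (x : stdSimplex ℝ (Fin (n + 1)))
    (i : Fin (n + 1)) : bary T i (baryPoint T x) = x i :=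
  bary_affineCombination T x.2.2 _ rfl i

theorem baryPoint_surjective (T : Affine.Simplex ℝ E n) : Function.Surjective (baryPoint T) := by
  rintro ⟨p, w, hw, hwI, rfl⟩
  exact ⟨⟨w, fun i => (hwI i).1, hw⟩, rfl⟩

/-- The tangent vector with given differentials of the barycentric coordinates. -/
def baryVector (T : Affine.Simplex ℝ E n) : Tangent (Fin (n + 1)) →ₗ[ℝ] (hull T).direction :=
  (∑ i, (LinearMap.proj i : (Fin (n + 1) → ℝ) →ₗ[ℝ] ℝ).smulRight
    (vertexBasis T i -ᵥ vertexBasis T 0)) ∘ₗ (Tangent (Fin (n + 1))).subtype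

theorem coord_baryVector (T : Affine.Simplex ℝ E n) (u : Tangent (Fin (n + 1)))
    (i : Fin (n + 1)) : ((vertexBasis T).coord i).linear (baryVector T u) = u.1 i := by
  rw [baryVector, LinearMap.comp_apply, LinearMap.sum_apply, map_sum]
  simp only [LinearMap.smulRight_apply, map_smul, AffineMap.linearMap_vsub,
    AffineBasis.coord_apply, vsub_eq_sub, smul_eq_mul, mul_sub, Finset.sum_sub_distrib,
    ← Finset.sum_mul, LinearMap.proj_apply, Submodule.subtype_apply, sum_tangent]
  simp

theorem baryVector_surjective (T : Affine.Simplex ℝ E n) :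
    Function.Surjective (baryVector T) := by
  intro d
  have hsum : ∑ i, ((vertexBasis T).coord i).linear d = 0 := by
    have h1 := (vertexBasis T).sum_coord_apply_eq_one (d +ᵥ vertexBasis T 0)
    have h2 := (vertexBasis T).sum_coord_apply_eq_one (vertexBasis T 0)
    simp only [AffineMap.map_vadd, vadd_eq_add, Finset.sum_add_distrib] at h1
    rw [h2] at h1
    linarith
  refine ⟨⟨fun i => ((vertexBasis T).coord i).linear d, ?_⟩, ?_⟩
  · rw [LinearMap.mem_ker, LinearMap.sum_apply]
    exact hsum
  · apply vadd_right_cancel (vertexBasis T 0)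
    refine (vertexBasis T).ext_elem fun i => ?_
    rw [AffineMap.map_vadd, AffineMap.map_vadd, coord_baryVector]

theorem dbary_comp_baryVector (T : Affine.Simplex ℝ E n) (i : Fin (n + 1)) :
    dbary T i ∘ₗ baryVector T = covec i := by
  ext u
  exact congrArg Complex.ofReal (coord_baryVector T u i)

/-- The expression of a form in barycentric coordinates. -/
def toStd (T : Affine.Simplex ℝ E n) : Form T k →ₗ[ℂ] StdForm (Fin (n + 1)) k where
  toFun ω x := (ω (baryPoint T x)).compLinearMap (baryVector T)
  map_add' _ _ := rfl
  map_smul' _ _ := rfl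

theorem toStd_apply (T : Affine.Simplex ℝ E n) (ω : Form T k) (x : stdSimplex ℝ (Fin (n + 1))) :
    toStd T ω x = (ω (baryPoint T x)).compLinearMap (baryVector T) := rfl

theorem toStd_injective (T : Affine.Simplex ℝ E n) :
    Function.Injective (toStd (k := k) T) := by
  intro ω η h
  funext p
  obtain ⟨x, rfl⟩ := baryPoint_surjective T p
  ext d
  choose u hu using fun i => baryVector_surjective T (d i)
  obtain rfl : (fun i => baryVector T (u i)) = d := funext hu
  exact DFunLike.congr_fun (congrFun h x) u

theorem toStd_monomialMul (T : Affine.Simplex ℝ E n) (α : Fin (n + 1) → ℕ) (ω : Form T k) :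
    toStd T (monomialMul T α ω) = monoMul α (toStd T ω) := by
  funext x
  rw [toStd_apply, monomialMul, monoMul_apply, toStd_apply]
  simp only [bary_baryPoint]
  rfl

theorem toStd_constForm (T : Affine.Simplex ℝ E n) (ℓ : Fin k → (hull T).direction →ₗ[ℝ] ℂ) :
    toStd T (constForm T ℓ) = fun _ => wedge fun i => ℓ i ∘ₗ baryVector T :=
  funext fun _ => wedge_compLinearMap _ _

theorem toStd_dbaryForm (T : Affine.Simplex ℝ E n) (σ : Fin k → Fin (n + 1)) :
    toStd T (dbaryForm T σ) = dForm σ := by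
  rw [dbaryForm, toStd_constForm]
  simp only [dbary_comp_baryVector]
  rfl

theorem toStd_whitneyForm (T : Affine.Simplex ℝ E n) (ρ : Fin (k + 1) → Fin (n + 1)) :
    toStd T (whitneyForm T ρ) = whitney ρ := by
  rw [whitneyForm, map_sum]
  simp only [map_smul, toStd_monomialMul, toStd_dbaryForm]
  rfl

theorem extCovector_comp_baryVector (T : Affine.Simplex ℝ E n) (fs : Finset (Fin (n + 1)))
    (α : Fin (n + 1) → ℕ) (i : Fin (n + 1)) :
    extCovector T fs α i ∘ₗ baryVector T = psi fs α i := by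
  have h : (∑ j ∈ fs, dbary T j) ∘ₗ baryVector T = ∑ j ∈ fs, covec j := by
    ext u
    simp only [LinearMap.comp_apply, LinearMap.sum_apply, ← dbary_comp_baryVector T]
  rw [extCovector, LinearMap.sub_comp, LinearMap.smul_comp, h, dbary_comp_baryVector]
  rfl

/-! ### Transport of spaces and graphs -/

theorem psiForm_comp_perm {κ : Type*} [Fintype κ] [DecidableEq κ] (fs : Finset κ) (β : κ → ℕ)
    (σ : Fin k → κ) (s : Equiv.Perm (Fin k)) :
    psiForm fs β (σ ∘ s) = ((Equiv.Perm.sign s : ℤ) : ℂ) • psiForm fs β σ := by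
  rw [psiForm, psiForm, ← map_smul]
  exact congrArg (monoMul β) (funext fun _ => wedge_comp_perm (fun i => psi fs β (σ i)) s)

theorem map_polySpace (fam : Family) (r k : ℕ) (T : Affine.Simplex ℝ E n) :
    (polySpace fam r k T).map (toStd T) = space fam r k (Fin (n + 1)) := by
  refine le_antisymm ?_ ?_
  · cases fam
    · refine Submodule.map_span_le _ _ _ |>.2 ?_
      rintro _ ⟨α, σ, hα, rfl⟩
      exact Submodule.subset_span ⟨α, σ, hα, by rw [toStd_monomialMul, toStd_dbaryForm]⟩
    · refine Submodule.map_span_le _ _ _ |>.2 ?_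
      rintro _ ⟨α, ρ, hα, rfl⟩
      exact Submodule.subset_span ⟨α, ρ, hα, by rw [toStd_monomialMul, toStd_whitneyForm]⟩
  · cases fam
    · refine Submodule.span_le.2 ?_
      rintro _ ⟨α, σ, hα, rfl⟩
      refine alternating_mem (fun σ => monoMul α (dForm σ)) (fun s σ => ?_) (fun σ hσ => ?_)
        (fun σ => ?_) σ
      · rw [dForm_comp_perm, map_smul]
      · rw [dForm_eq_zero hσ, map_zero]
      · exact ⟨_, Submodule.subset_span ⟨α, σ, hα, rfl⟩, by
          rw [toStd_monomialMul, toStd_dbaryForm]⟩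
    · refine Submodule.span_le.2 ?_
      rintro _ ⟨α, σ, hα, rfl⟩
      refine alternating_mem (fun σ => monoMul α (whitney σ)) (fun s σ => ?_) (fun σ hσ => ?_)
        (fun σ => ?_) σ
      · rw [whitney_comp_perm, map_smul]
      · rw [whitney_eq_zero hσ, map_zero]
      · exact ⟨_, Submodule.subset_span ⟨α, σ, hα, rfl⟩, by
          rw [toStd_monomialMul, toStd_whitneyForm]⟩

theorem map_extGraph (fam : Family) (r k : ℕ) {m : ℕ} (T : Affine.Simplex ℝ E n)
    {fs : Finset (Fin (n + 1))} (h : fs.card = m + 1) :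
    (extGraph fam r k T h).map ((toStd (T.face h)).prodMap (toStd T)) =
      StdForm.extGraph fam r k (fs.orderEmbOfFin h) := by
  have himg : Finset.univ.image (fs.orderEmbOfFin h) = fs := fs.image_orderEmbOfFin_univ h
  have hinj := (fs.orderEmbOfFin h).injective
  have hfull : ∀ (α : Fin (m + 1) → ℕ) (σ : Fin k → Fin (m + 1)), (toStd T) (monomialMul T
      (extendIndex h α) (constForm T fun i => extCovector T fs (extendIndex h α)
        (fs.orderEmbOfFin h (σ i)))) = psiForm (Finset.univ.image (fs.orderEmbOfFin h))
          (Function.extend (fs.orderEmbOfFin h) α 0) (fs.orderEmbOfFin h ∘ σ) := fun α σ => by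
    rw [toStd_monomialMul, toStd_constForm]
    simp only [extCovector_comp_baryVector, himg]
    rfl
  refine le_antisymm ?_ ?_
  · cases fam
    · refine Submodule.map_span_le _ _ _ |>.2 ?_
      rintro _ ⟨α, σ, hα, rfl⟩
      exact Submodule.subset_span ⟨α, σ, hα, Prod.ext
        ((toStd_monomialMul _ _ _).trans (by rw [toStd_dbaryForm])) (hfull α σ)⟩
    · refine Submodule.map_span_le _ _ _ |>.2 ?_
      rintro _ ⟨α, ρ, hα, rfl⟩
      exact Submodule.subset_span ⟨α, ρ, hα, Prod.ext
        ((toStd_monomialMul _ _ _).trans (by rw [toStd_whitneyForm]))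
        ((toStd_monomialMul _ _ _).trans (by rw [toStd_whitneyForm]; rfl))⟩
  · cases fam
    · refine Submodule.span_le.2 ?_
      rintro _ ⟨α, σ, hα, rfl⟩
      refine alternating_mem (fun σ => (monoMul α (dForm σ),
        psiForm (Finset.univ.image (fs.orderEmbOfFin h)) (Function.extend (fs.orderEmbOfFin h) α 0)
          (fs.orderEmbOfFin h ∘ σ))) (fun s σ => ?_) (fun σ hσ => ?_) (fun σ => ?_) σ
      · rw [dForm_comp_perm, map_smul, ← Function.comp_assoc, psiForm_comp_perm]
        rfl
      · rw [dForm_eq_zero hσ, map_zero, psiForm_eq_zero]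
        · rfl
        · exact fun h => hσ h.of_comp
      · exact ⟨_, Submodule.subset_span ⟨α, σ, hα, rfl⟩, Prod.ext
          ((toStd_monomialMul _ _ _).trans (by rw [toStd_dbaryForm])) (hfull α σ)⟩
    · refine Submodule.span_le.2 ?_
      rintro _ ⟨α, ρ, hα, rfl⟩
      refine alternating_mem (fun ρ => (monoMul α (whitney ρ),
        monoMul (Function.extend (fs.orderEmbOfFin h) α 0) (whitney (fs.orderEmbOfFin h ∘ ρ))))
          (fun s σ => ?_) (fun σ hσ => ?_) (fun ρ => ?_) ρ
      · rw [whitney_comp_perm, map_smul, ← Function.comp_assoc, whitney_comp_perm, map_smul]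
        rfl
      · rw [whitney_eq_zero hσ, map_zero, whitney_eq_zero, map_zero]
        · rfl
        · exact fun h => hσ h.of_comp
      · exact ⟨_, Submodule.subset_span ⟨α, ρ, hα, rfl⟩, Prod.ext
          ((toStd_monomialMul _ _ _).trans (by rw [toStd_whitneyForm]))
          ((toStd_monomialMul _ _ _).trans (by rw [toStd_whitneyForm]; rfl))⟩

theorem exists_equiv_of_isCompl {p q : ℕ} (σ : Fin p ↪o Fin (p + q + 1))
    (ρ : Fin (q + 1) ↪o Fin (p + q + 1)) (h : IsCompl (Set.range σ) (Set.range ρ)) :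
    ∃ f : Fin p ⊕ Fin (q + 1) ≃ Fin (p + q + 1),
      (fun i => f (Sum.inl i)) = σ ∧ (fun i => f (Sum.inr i)) = ρ := by
  have hb : Function.Bijective (Sum.elim σ ρ) := by
    constructor
    · refine σ.injective.sumElim ρ.injective fun a b hab => ?_
      exact Set.disjoint_left.1 h.disjoint ⟨a, rfl⟩ ⟨b, hab.symm⟩
    · intro i
      rcases (h.codisjoint.top_le (Set.mem_univ i) : i ∈ Set.range σ ∪ Set.range ρ) with
        ⟨a, rfl⟩ | ⟨b, rfl⟩
      · exact ⟨Sum.inl a, rfl⟩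
      · exact ⟨Sum.inr b, rfl⟩
  exact ⟨Equiv.ofBijective _ hb, rfl, rfl⟩

theorem exists_orderEmb_compl {N a b : ℕ} (h : a + b = N) (σ : Fin a ↪o Fin N) :
    ∃ ρ : Fin b ↪o Fin N, IsCompl (Set.range σ) (Set.range ρ) := by
  have hc : (Finset.univ.image σ)ᶜ.card = b := by
    rw [Finset.card_compl, Finset.card_image_of_injective _ σ.injective, Fintype.card_fin,
      Finset.card_univ, Fintype.card_fin]
    omega
  refine ⟨(Finset.univ.image σ)ᶜ.orderEmbOfFin hc, ?_⟩
  rw [Finset.range_orderEmbOfFin]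
  simpa using isCompl_compl

theorem toStd_isoI_generator {p q : ℕ} (T : Affine.Simplex ℝ E (p + q))
    (α : Fin (p + q + 1) → ℕ) {σ : Fin p ↪o Fin (p + q + 1)}
    {ρ : Fin (q + 1) ↪o Fin (p + q + 1)} {f : Fin p ⊕ Fin (q + 1) ≃ Fin (p + q + 1)}
    (hσ : (fun i => f (Sum.inl i)) = σ) (hρ : (fun i => f (Sum.inr i)) = ρ) :
    (toStd T).prodMap (toStd T) (monomialMul T α (dbaryForm T σ),
      sortSign (Fin.append σ ρ) • monomialMul T (α + supp σ) (whitneyForm T ρ)) =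
    (monoMul α (dForm fun i => f (Sum.inl i)),
      orderSign f • monoMul (α + ∑ i, Pi.single (f (Sum.inl i)) 1)
        (whitney fun i => f (Sum.inr i))) := by
  have hs := sortSign_append f
  rw [hσ, hρ] at hs
  have hsupp : supp σ = ∑ i, Pi.single (f (Sum.inl i)) 1 := by
    rw [supp, ← hσ]
  rw [LinearMap.prodMap_apply, hs, map_smul, toStd_monomialMul, toStd_monomialMul,
    toStd_dbaryForm, toStd_whitneyForm, hsupp, ← hσ, ← hρ]

theorem toStd_isoJ_generator {p q : ℕ} (T : Affine.Simplex ℝ E (p + q))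
    (α : Fin (p + q + 1) → ℕ) {σ : Fin p ↪o Fin (p + q + 1)}
    {ρ : Fin (q + 1) ↪o Fin (p + q + 1)} {f : Fin p ⊕ Fin (q + 1) ≃ Fin (p + q + 1)}
    (hσ : (fun i => f (Sum.inl i)) = σ) (hρ : (fun i => f (Sum.inr i)) = ρ) :
    (toStd T).prodMap (toStd T) (monomialMul T (α + supp ρ) (dbaryForm T σ),
      sortSign (Fin.append σ ρ) • monomialMul T α (whitneyForm T ρ)) =
    (monoMul (α + ∑ i, Pi.single (f (Sum.inr i)) 1) (dForm fun i => f (Sum.inl i)),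
      orderSign f • monoMul α (whitney fun i => f (Sum.inr i))) := by
  have hs := sortSign_append f
  rw [hσ, hρ] at hs
  have hsupp : supp ρ = ∑ i, Pi.single (f (Sum.inr i)) 1 := by
    rw [supp, ← hρ]
  rw [LinearMap.prodMap_apply, hs, map_smul, toStd_monomialMul, toStd_monomialMul,
    toStd_dbaryForm, toStd_whitneyForm, hsupp, ← hσ, ← hρ]

/-- A relation contained in a single-valued one with no larger domain is all of it. This identifies
the spans of prescribed pairs with the intrinsic relations. -/
theorem eq_of_graph_le {M N : Type*} [AddCommGroup M] [Module ℂ M] [AddCommGroup N] [Module ℂ N]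
    {G H : Submodule ℂ (M × N)} (hle : G ≤ H)
    (h : ∀ x y, (x, y) ∈ H → ∃ y', (x, y') ∈ G) (hH : ∀ y, ((0 : M), y) ∈ H → y = 0) : G = H := by
  refine le_antisymm hle ?_
  rintro ⟨x, y⟩ hxy
  obtain ⟨y', hy'⟩ := h x y hxy
  have h0 := H.sub_mem hxy (hle hy')
  rw [Prod.mk_sub_mk, sub_self] at h0
  rwa [sub_eq_zero.1 (hH _ h0)]

theorem map_isoIGraph {p q : ℕ} (s : ℕ) (T : Affine.Simplex ℝ E (p + q)) :
    (isoIGraph T s p q).map ((toStd T).prodMap (toStd T)) = starI s p q := by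
  refine eq_of_graph_le ?_ (fun x y hxy => ?_) fun y => starI_fst_zero
  · refine Submodule.map_span_le _ _ _ |>.2 ?_
    rintro _ ⟨α, σ, ρ, hα, hσρ, rfl⟩
    obtain ⟨f, hσ, hρ⟩ := exists_equiv_of_isCompl σ ρ hσρ
    rw [toStd_isoI_generator T α hσ hρ]
    exact generator_mem_starI f hα
  · have hx := hxy.1
    change x ∈ _ at hx
    rw [← map_polySpace .full s p T] at hx
    obtain ⟨ω, hω, rfl⟩ := hx
    refine Submodule.span_induction ?_ ⟨0, by rw [map_zero]; exact zero_mem _⟩ ?_ ?_ hω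
    · rintro _ ⟨α, σ, hα, rfl⟩
      obtain ⟨ρ, hρ⟩ := exists_orderEmb_compl (b := q + 1) (by omega) σ
      exact ⟨_, _, Submodule.subset_span ⟨α, σ, ρ, hα, hρ, rfl⟩, rfl⟩
    · rintro a b - - ⟨y, h⟩ ⟨y', h'⟩
      exact ⟨y + y', by rw [map_add]; exact add_mem h h'⟩
    · rintro c a - ⟨y, h⟩
      exact ⟨c • y, by rw [map_smul]; exact Submodule.smul_mem _ c h⟩

theorem map_isoJGraph {p q : ℕ} (s : ℕ) (T : Affine.Simplex ℝ E (p + q)) :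
    (isoJGraph T s q p).map ((toStd T).prodMap (toStd T)) = starJ s p q := by
  -- The relation is read backwards because the polynomial condition in `starJ`, which fixes the
  -- domain, is imposed on the second component.
  have key : swapGraph ((isoJGraph T s q p).map ((toStd T).prodMap (toStd T))) =
      swapGraph (starJ s p q) := by
    refine eq_of_graph_le ?_ (fun y x hxy => ?_) fun y h => starJ_snd_zero h
    · refine Submodule.comap_mono (Submodule.map_span_le _ _ _ |>.2 ?_)
      rintro _ ⟨α, σ, ρ, hα, hσρ, rfl⟩
      obtain ⟨f, hσ, hρ⟩ := exists_equiv_of_isCompl σ ρ hσρ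
      rw [toStd_isoJ_generator T α hσ hρ]
      exact generator_mem_starJ f hα
    · have hy := (mem_swapGraph.1 hxy).1
      change y ∈ _ at hy
      rw [← map_polySpace .trimmed s q T] at hy
      obtain ⟨ω, hω, rfl⟩ := hy
      refine Submodule.span_induction ?_ ⟨0, by rw [map_zero]; exact zero_mem _⟩ ?_ ?_ hω
      · rintro _ ⟨α, ρ, hα, rfl⟩
        obtain ⟨σ, hσ⟩ := exists_orderEmb_compl (b := p) (by omega) ρ
        have hne : sortSign (Fin.append σ ρ) ≠ 0 := by
          obtain ⟨f, hfσ, hfρ⟩ := exists_equiv_of_isCompl σ ρ hσ.symm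
          rw [← hfσ, ← hfρ, sortSign_append]
          exact orderSign_ne_zero f
        have h1 := Submodule.smul_mem _ (sortSign (Fin.append σ ρ))⁻¹
          (Submodule.subset_span (s := {p' | _}) ⟨α, σ, ρ, hα, hσ.symm, rfl⟩ :
            _ ∈ isoJGraph T s q p)
        rw [Prod.smul_mk, smul_smul, inv_mul_cancel₀ hne, one_smul] at h1
        exact ⟨_, _, h1, rfl⟩
      · rintro a b - - ⟨y, h⟩ ⟨y', h'⟩
        exact ⟨y + y', by rw [map_add]; exact add_mem h h'⟩
      · rintro c a - ⟨y, h⟩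
        exact ⟨c • y, by rw [map_smul]; exact Submodule.smul_mem _ c h⟩
  exact SetLike.ext fun ⟨x, y⟩ => (SetLike.ext_iff.1 key (y, x) : _)

theorem image_graphImage {M N M' N' : Type*} [AddCommGroup M] [Module ℂ M] [AddCommGroup N]
    [Module ℂ N] [AddCommGroup M'] [Module ℂ M'] [AddCommGroup N'] [Module ℂ N']
    (G : Submodule ℂ (M × N)) (A : Set M) {Φ : M →ₗ[ℂ] M'} (hΦ : Function.Injective Φ)
    (Ψ : N →ₗ[ℂ] N') : Ψ '' graphImage G A = graphImage (G.map (Φ.prodMap Ψ)) (Φ '' A) := by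
  ext z
  constructor
  · rintro ⟨y, ⟨x, hx, hxy⟩, rfl⟩
    exact ⟨Φ x, ⟨x, hx, rfl⟩, (x, y), hxy, rfl⟩
  · rintro ⟨_, ⟨x, hx, rfl⟩, ⟨x', y⟩, hxy, h⟩
    rw [LinearMap.prodMap_apply, Prod.mk.injEq] at h
    obtain rfl := hΦ h.1
    exact ⟨y, ⟨x', hx, hxy⟩, h.2⟩

theorem image_graphInvImage {M N M' N' : Type*} [AddCommGroup M] [Module ℂ M] [AddCommGroup N]
    [Module ℂ N] [AddCommGroup M'] [Module ℂ M'] [AddCommGroup N'] [Module ℂ N']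
    (G : Submodule ℂ (M × N)) (A : Set N) (Φ : M →ₗ[ℂ] M') {Ψ : N →ₗ[ℂ] N'}
    (hΨ : Function.Injective Ψ) :
    Φ '' graphInvImage G A = graphInvImage (G.map (Φ.prodMap Ψ)) (Ψ '' A) := by
  ext z
  constructor
  · rintro ⟨x, ⟨y, hy, hxy⟩, rfl⟩
    exact ⟨Ψ y, ⟨y, hy, rfl⟩, (x, y), hxy, rfl⟩
  · rintro ⟨_, ⟨y, hy, rfl⟩, ⟨x, y'⟩, hxy, h⟩
    rw [LinearMap.prodMap_apply, Prod.mk.injEq] at h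
    obtain rfl := hΨ h.2
    exact ⟨x, ⟨y', hy, hxy⟩, h.1⟩

/-! ### The recursion on the standard simplex -/

/-- The recursively constructed bases, in barycentric coordinates. -/
def stdBasis (a b : ∀ m : ℕ, Affine.Simplex ℝ E m → ℝ) (fam : Family) (r k : ℕ)
    (T : Affine.Simplex ℝ E n) : Set (StdForm (Fin (n + 1)) k) :=
  toStd T '' recBasis a b fam r k T

variable (a b : ∀ m : ℕ, Affine.Simplex ℝ E m → ℝ)

theorem mem_stdBasis_full (r k : ℕ) (T : Affine.Simplex ℝ E n) (y : StdForm (Fin (n + 1)) k) :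
    y ∈ stdBasis a b .full (r + 1) k T ↔ ∃ (fs : Finset (Fin (n + 1))) (l s : ℕ)
      (h : fs.card = k + l + 1), s + l = r + 1 ∧
      y ∈ graphImage (faceGraphJ s k l (fs.orderEmbOfFin h))
        (stdBasis a b .trimmed s l (T.face h)) := by
  have hJ : ∀ {fs : Finset (Fin (n + 1))} {l s : ℕ} (h : fs.card = k + l + 1) (A),
      graphImage (faceGraphJ s k l (fs.orderEmbOfFin h)) A =
        graphImage (StdForm.extGraph .full (s + l) k (fs.orderEmbOfFin h))
          (graphInvImage (starJ s k l) A) :=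
    fun h A => graphImage_compGraph _ _ _
  simp only [hJ]
  rw [stdBasis, recBasis]
  simp only [Set.image_iUnion, Set.mem_iUnion]
  constructor
  · rintro ⟨m, fs, h, l, s, rfl, hs, hy⟩
    refine ⟨fs, l, s, h, hs, ?_⟩
    rw [hs]
    rwa [image_graphImage _ _ (toStd_injective _), map_extGraph,
      image_graphInvImage _ _ _ (toStd_injective _), map_isoJGraph] at hy
  · rintro ⟨fs, l, s, h, hs, hy⟩
    refine ⟨_, fs, h, l, s, rfl, hs, ?_⟩
    rw [hs] at hy
    rwa [image_graphImage _ _ (toStd_injective _), map_extGraph,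
      image_graphInvImage _ _ _ (toStd_injective _), map_isoJGraph]

theorem mem_stdBasis_trimmed (r k : ℕ) (T : Affine.Simplex ℝ E n) (y : StdForm (Fin (n + 1)) k) :
    y ∈ stdBasis a b .trimmed r k T ↔ ∃ (fs : Finset (Fin (n + 1))) (l s : ℕ)
      (h : fs.card = l + k + 1), s + l + 1 = r ∧
      y ∈ graphImage (faceGraphI s l k (fs.orderEmbOfFin h))
        (stdBasis a b .full s l (T.face h)) := by
  have hI : ∀ {fs : Finset (Fin (n + 1))} {l s : ℕ} (h : fs.card = l + k + 1) (A),
      graphImage (faceGraphI s l k (fs.orderEmbOfFin h)) A =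
        graphImage (StdForm.extGraph .trimmed (s + l + 1) k (fs.orderEmbOfFin h))
          (graphImage (starI s l k) A) :=
    fun h A => graphImage_compGraph _ _ _
  simp only [hI]
  rw [stdBasis, recBasis]
  simp only [Set.image_iUnion, Set.mem_iUnion]
  constructor
  · rintro ⟨m, fs, h, l, s, hm, hs, hy⟩
    obtain rfl : m = l + k := by omega
    refine ⟨fs, l, s, h, hs, ?_⟩
    rw [hs]
    rwa [image_graphImage _ _ (toStd_injective _), map_extGraph,
      image_graphImage _ _ (toStd_injective _), map_isoIGraph] at hy
  · rintro ⟨fs, l, s, h, hs, hy⟩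
    refine ⟨_, fs, h, l, s, add_comm k l, hs, ?_⟩
    rw [hs] at hy
    rwa [image_graphImage _ _ (toStd_injective _), map_extGraph,
      image_graphImage _ _ (toStd_injective _), map_isoIGraph]

end Transport

/-! ### Constant forms -/

theorem isBasisOf_range_of_dual {M J : Type*} [AddCommGroup M] [Module ℂ M] [Fintype J]
    [DecidableEq J] (v : J → M) (f : J → M →ₗ[ℂ] ℂ) {c : ℂ} (hc : c ≠ 0)
    (h : ∀ i j, f i (v j) = if i = j then c else 0) :
    IsBasisOf (Set.range v) (Submodule.span ℂ (Set.range v)) := by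
  refine ⟨LinearIndependent.linearIndepOn_id ?_, rfl⟩
  rw [Fintype.linearIndependent_iff]
  intro g hg i
  have := congrArg (f i) hg
  simp only [map_sum, map_smul, h, map_zero] at this
  simpa [hc] using this

theorem isBasisOf_singleton {M : Type*} [AddCommGroup M] [Module ℂ M] {v : M} (hv : v ≠ 0) :
    IsBasisOf {v} (Submodule.span ℂ {v}) :=
  ⟨LinearIndepOn.singleton hv, rfl⟩

theorem span_singleton_smul {M : Type*} [AddCommGroup M] [Module ℂ M] {v : M} {c : ℂ}
    (hc : c ≠ 0) : Submodule.span ℂ {c • v} = Submodule.span ℂ {v} :=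
  Submodule.span_singleton_smul_eq hc.isUnit v

namespace StdForm

variable {ι κ : Type*} [Fintype ι] [Fintype κ] {k l r s : ℕ}

/-- Linear combinations of the differentials of the barycentric coordinates. -/
def lin (c : ι → ℂ) : Tangent ι →ₗ[ℝ] ℂ := ∑ i, c i • covec i

theorem lin_apply (c : ι → ℂ) (u : Tangent ι) : lin c u = ∑ i, c i * (u.1 i : ℂ) := by
  simp [lin, LinearMap.sum_apply]

theorem lin_smul (z : ℂ) (c : ι → ℂ) : lin (z • c) = z • lin c := by
  simp [lin, Finset.smul_sum, smul_smul]

theorem lin_const (z : ℂ) : lin (fun _ : ι => z) = 0 := by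
  rw [lin, ← Finset.smul_sum, sum_covec, smul_zero]

theorem lin_comp_push (π : Equiv.Perm ι) (c : ι → ℂ) : lin c ∘ₗ push π = lin (c ∘ π) := by
  ext u
  rw [LinearMap.comp_apply, lin_apply, lin_apply, ← Equiv.sum_comp π]
  simp only [push_apply π π.injective, Function.comp_apply]

/-- The exterior product of linear combinations of the differentials of the barycentric
coordinates, as a constant form. -/
def constWedge (c : Fin k → ι → ℂ) : StdForm ι k := fun _ => wedge fun i => lin (c i)

theorem pull_constWedge (π : Equiv.Perm ι) (c : Fin k → ι → ℂ) :
    pull π (constWedge c) = constWedge fun i => c i ∘ π := by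
  unfold constWedge
  rw [pull_const]
  simp only [lin_comp_push]

/-- Constant forms. -/
def constant : (Tangent ι [⋀^Fin k]→ₗ[ℝ] ℂ) →ₗ[ℂ] StdForm ι k where
  toFun f _ := f
  map_add' _ _ := rfl
  map_smul' _ _ := rfl

theorem space_full_zero [DecidableEq ι] :
    space .full 0 k ι = Submodule.span ℂ (Set.range fun σ : Fin k → ι => dForm σ) := by
  refine congrArg (Submodule.span ℂ) (Set.ext fun ω => ?_)
  constructor
  · rintro ⟨α, σ, hα, rfl⟩
    refine ⟨σ, ?_⟩
    have h0 : α = 0 := funext fun i => (Finset.sum_eq_zero_iff.1 hα) i (Finset.mem_univ i)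
    funext x
    rw [monoMul_apply, h0]
    simp [mono]
  · rintro ⟨σ, rfl⟩
    refine ⟨0, σ, by simp, ?_⟩
    funext x
    rw [monoMul_apply]
    simp [mono]

theorem space_full_zero_eq_span [DecidableEq ι] {J : Type*} [Fintype J] (c : J → ι → ℂ)
    (h : ∀ i, covec i ∈ Submodule.span ℂ (Set.range fun j => lin (c j))) :
    space .full 0 k ι =
      Submodule.span ℂ (Set.range fun σ : Fin k → J => constWedge fun i => c (σ i)) := by
  rw [space_full_zero]
  refine le_antisymm (Submodule.span_le.2 ?_) (Submodule.span_le.2 ?_)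
  · rintro _ ⟨σ, rfl⟩
    have := Submodule.mem_map_of_mem (f := constant) (wedge_mem_span fun i => h (σ i))
    rw [Submodule.map_span, ← Set.range_comp] at this
    exact this
  · rintro _ ⟨σ, rfl⟩
    have h2 : ∀ i, lin (c (σ i)) ∈ Submodule.span ℂ (Set.range (covec (ι := ι))) := fun i =>
      sum_mem fun j _ => Submodule.smul_mem _ _ (Submodule.subset_span ⟨j, rfl⟩)
    have := Submodule.mem_map_of_mem (f := constant) (wedge_mem_span h2)
    rw [Submodule.map_span, ← Set.range_comp] at this
    exact this

theorem space_zero_zero [DecidableEq ι] :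
    space .full 0 0 ι = Submodule.span ℂ {dForm (Fin.elim0 : Fin 0 → ι)} := by
  rw [space_full_zero]
  congr 1
  ext ω
  constructor
  · rintro ⟨σ, rfl⟩
    exact congrArg dForm (Subsingleton.elim _ _)
  · rintro rfl
    exact ⟨_, rfl⟩

theorem dForm_elim0_ne_zero [Nonempty ι] : dForm (Fin.elim0 : Fin 0 → ι) ≠ 0 := by
  classical
  intro h
  obtain ⟨i⟩ := ‹Nonempty ι›
  have h1 := congrArg (evalAt (stdSimplex.vertex i) Fin.elim0) h
  rw [map_zero] at h1
  change dForm Fin.elim0 (stdSimplex.vertex i) Fin.elim0 = 0 at h1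
  rw [dForm_apply, Matrix.det_isEmpty] at h1
  exact one_ne_zero h1

theorem pull_dForm_elim0 (π : Equiv.Perm ι) :
    pull π (dForm (Fin.elim0 : Fin 0 → ι)) = dForm (Fin.elim0 : Fin 0 → ι) := by
  have h := pull_dForm π π.injective (Fin.elim0 : Fin 0 → ι)
  rwa [Subsingleton.elim (π ∘ Fin.elim0) (Fin.elim0 : Fin 0 → ι)] at h

theorem edgeVal_dForm_perm {n : ℕ} (σ : Fin n → Fin (n + 1)) (τ : Equiv.Perm (Fin (n + 1)))
    (x : stdSimplex ℝ (Fin (n + 1))) : edgeVal τ x (dForm σ) = ((Equiv.Perm.sign τ : ℤ) : ℂ) *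
      Matrix.det (Matrix.of fun i j : Fin (n + 1) =>
      (Fin.cons (fun _ => 1) (fun j => Pi.single (σ j) 1) : Fin (n + 1) → Fin (n + 1) → ℂ) j i) := by
  rw [edgeVal_dForm, ← Matrix.det_permute]
  rfl

theorem edgeVal_volume {n : ℕ} (τ : Equiv.Perm (Fin (n + 1)))
    (x : stdSimplex ℝ (Fin (n + 1))) :
    edgeVal τ x (dForm (Fin.succ : Fin n → _)) = ((Equiv.Perm.sign τ : ℤ) : ℂ) := by
  rw [edgeVal_dForm_perm, Matrix.det_of_isLowerTriangular]
  · rw [Fin.prod_univ_succ]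
    simp
  · intro i j hij
    rw [OrderDual.toDual_lt_toDual] at hij
    obtain ⟨j, rfl⟩ := Fin.exists_succ_eq.2 (Fin.ne_zero_of_lt hij)
    simp [Matrix.of_apply, hij.ne]

theorem exists_perm_of_injective {n : ℕ} {τ : Fin (n + 1) → Fin (n + 1)}
    (hτ : Function.Injective τ) : ∃ τ' : Equiv.Perm (Fin (n + 1)), τ = τ' :=
  ⟨Equiv.ofBijective τ (Finite.injective_iff_bijective.1 hτ), rfl⟩

theorem volume_ne_zero {n : ℕ} : dForm (Fin.succ : Fin n → Fin (n + 1)) ≠ 0 := by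
  intro h
  have h1 := edgeVal_volume (1 : Equiv.Perm (Fin (n + 1))) (stdSimplex.vertex 0)
  rw [h, map_zero] at h1
  simp at h1

/-- A form of top degree is determined by its values on the edges of the whole simplex taken in all
orders, and on the volume form these values are the signs of the orders. -/
theorem pull_volume {n : ℕ} (π : Equiv.Perm (Fin (n + 1))) :
    pull π (dForm (Fin.succ : Fin n → Fin (n + 1))) =
      ((Equiv.Perm.sign π : ℤ) : ℂ) • dForm (Fin.succ : Fin n → Fin (n + 1)) := by
  refine eq_of_edgeVal fun τ hτ x => ?_
  obtain ⟨τ, rfl⟩ := exists_perm_of_injective hτ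
  rw [edgeVal_pull, map_smul, edgeVal_volume]
  exact (edgeVal_volume (π * τ) _).trans (by simp)

theorem space_zero_top {n : ℕ} : space .full 0 n (Fin (n + 1)) =
    Submodule.span ℂ {dForm (Fin.succ : Fin n → Fin (n + 1))} := by
  rw [space_full_zero]
  refine le_antisymm (Submodule.span_le.2 ?_) (Submodule.span_mono ?_)
  · rintro _ ⟨σ, rfl⟩
    refine Submodule.mem_span_singleton.2 ⟨Matrix.det (Matrix.of fun i j : Fin (n + 1) =>
      (Fin.cons (fun _ => 1) (fun j => Pi.single (σ j) 1) : Fin (n + 1) → Fin (n + 1) → ℂ) j i),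
      eq_of_edgeVal fun τ hτ x => ?_⟩
    obtain ⟨τ, rfl⟩ := exists_perm_of_injective hτ
    rw [map_smul, edgeVal_volume, edgeVal_dForm_perm, smul_eq_mul, mul_comm]
  · rintro _ rfl
    exact ⟨_, rfl⟩

/-- The functional that combines the values of a one-form on the vectors from `x` to the
vertices. -/
def coneSum [DecidableEq ι] (x : stdSimplex ℝ ι) (d : ι → ℂ) : StdForm ι 1 →ₗ[ℂ] ℂ :=
  ∑ i, d i • evalAt x fun _ => edge x i

theorem coneSum_constWedge [DecidableEq ι] (x : stdSimplex ℝ ι) (c d : ι → ℂ) (hd : ∑ i, d i = 0) :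
    coneSum x d (constWedge fun _ => c) = ∑ i, d i * c i := by
  have h : ∀ i, evalAt x (fun _ => edge x i) (constWedge fun _ : Fin 1 => c) =
      c i - ∑ j, c j * ((x j : ℝ) : ℂ) := fun i => by
    change wedge _ _ = _
    rw [wedge_apply, Matrix.det_unique, Matrix.of_apply, lin_apply]
    simp only [edge_apply, Complex.ofReal_sub, mul_sub, Finset.sum_sub_distrib]
    congr 1
    rw [Finset.sum_eq_single i]
    · simp
    · intro j _ hj
      simp [hj]
    · simp
  rw [coneSum, LinearMap.sum_apply]
  simp only [LinearMap.smul_apply, h, smul_eq_mul, mul_sub, Finset.sum_sub_distrib,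
    ← Finset.sum_mul, hd, zero_mul, sub_zero]

end StdForm

open StdForm

theorem ξ₃_isPrimitiveRoot : IsPrimitiveRoot ξ₃ 3 := by
  have := Complex.isPrimitiveRoot_exp 3 (by norm_num)
  rwa [show (2 * Real.pi * Complex.I / (3 : ℕ) : ℂ) = 2 * Real.pi * Complex.I / 3 by norm_num]
    at this

theorem ξ₃_pow_mod (m : ℕ) : ξ₃ ^ (m % 3) = ξ₃ ^ m := by
  have := pow_mod_orderOf ξ₃ m
  rwa [← ξ₃_isPrimitiveRoot.eq_orderOf] at this

theorem ξ₃_sum : 1 + ξ₃ + ξ₃ ^ 2 = 0 := by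
  have := ξ₃_isPrimitiveRoot.geom_sum_eq_zero (by norm_num)
  simpa [Finset.sum_range_succ] using this

theorem ξ₃_ne_ofReal (x : ℝ) : ξ₃ ≠ x := by
  intro h
  have h1 := ξ₃_sum
  rw [h] at h1
  have h2 : 1 + x + x ^ 2 = 0 := by exact_mod_cast h1
  nlinarith [sq_nonneg (x + 1 / 2)]

/-- The coefficients of the constant basis one-forms on a triangle. -/
def triCoeff (j : Fin 2) (i : Fin 3) : ℂ := ξ₃ ^ (((j : ℕ) + 1) * i)

/-- The signs in the constant basis one-forms on a tetrahedron. -/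
def tetSign : Fin 3 → Fin 4 → ℤ := ![![1, -1, 1, -1], ![1, 1, -1, -1], ![1, -1, -1, 1]]

/-- The coefficients of the constant basis one-forms on a tetrahedron. -/
def tetCoeff (j : Fin 3) (i : Fin 4) : ℂ := tetSign j i

/-- The three increasing pairs of indices below three. -/
def tetPair : Fin 3 → Fin 2 → Fin 3 := ![![0, 1], ![0, 2], ![1, 2]]

section

variable {E : Type*} [AddCommGroup E] [Module ℝ E] {n k : ℕ}

theorem toStd_constForm_eq {T : Affine.Simplex ℝ E n} {ℓ : Fin k → (hull T).direction →ₗ[ℝ] ℂ}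
    {c : Fin k → Fin (n + 1) → ℂ} (h : ∀ i, ℓ i ∘ₗ baryVector T = lin (c i)) :
    toStd T (constForm T ℓ) = constWedge c := by
  rw [toStd_constForm]
  simp only [h]
  rfl

theorem dbary_baryVector (T : Affine.Simplex ℝ E n) (i : Fin (n + 1)) (u : Tangent (Fin (n + 1))) :
    dbary T i (baryVector T u) = (u.1 i : ℂ) :=
  DFunLike.congr_fun (dbary_comp_baryVector T i) u

theorem ψ_comp_baryVector (T : Affine.Simplex ℝ E 3) (j : Fin 3) :
    ψ T j ∘ₗ baryVector T = lin (tetCoeff j) := by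
  ext u
  rw [LinearMap.comp_apply, lin_apply, Fin.sum_univ_four]
  fin_cases j <;> simp [ψ, tetCoeff, tetSign, dbary_baryVector] <;> ring

variable (a b : ∀ m : ℕ, Affine.Simplex ℝ E m → ℝ)

theorem stdBasis_zero_zero (T : Affine.Simplex ℝ E n) :
    stdBasis a b .full 0 0 T = {(a n T : ℂ) • dForm Fin.elim0} := by
  rw [stdBasis, recBasis, constBasis, if_pos rfl, Set.image_singleton, map_smul,
    toStd_dbaryForm, Subsingleton.elim (fun _ : Fin 0 => (0 : Fin (n + 1))) Fin.elim0]

theorem stdBasis_zero_top (hn : n ≠ 0) (T : Affine.Simplex ℝ E n) :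
    stdBasis a b .full 0 n T = {(b n T : ℂ) • dForm Fin.succ} := by
  rw [stdBasis, recBasis, constBasis, if_neg hn, dif_pos rfl, Set.image_singleton, map_smul,
    toStd_dbaryForm]
  rfl

theorem stdBasis_triangle (T : Affine.Simplex ℝ E 2) :
    stdBasis a b .full 0 1 T = Set.range fun j => constWedge fun _ : Fin 1 => triCoeff j := by
  have h0 : toStd T (constForm T ![dbary T 0 + ξ₃ • dbary T 1 + ξ₃ ^ 2 • dbary T 2]) =
      constWedge fun _ => triCoeff 0 := toStd_constForm_eq fun i => by
    ext u
    rw [LinearMap.comp_apply, lin_apply, Fin.sum_univ_three]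
    simp [triCoeff, dbary_baryVector]
  have h1 : toStd T (constForm T ![dbary T 0 + ξ₃ ^ 2 • dbary T 1 + ξ₃ • dbary T 2]) =
      constWedge fun _ => triCoeff 1 := toStd_constForm_eq fun i => by
    have h4 : ξ₃ ^ 4 = ξ₃ := by
      rw [← ξ₃_pow_mod]
      norm_num
    ext u
    rw [LinearMap.comp_apply, lin_apply, Fin.sum_univ_three]
    simp [triCoeff, dbary_baryVector, h4]
  rw [stdBasis, recBasis, constBasis, if_neg one_ne_zero, dif_neg (by norm_num), middleConstBasis,
    Set.image_pair, h0, h1]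
  ext ω
  simp [Fin.exists_fin_two, eq_comm]

theorem stdBasis_tetrahedron_one (T : Affine.Simplex ℝ E 3) :
    stdBasis a b .full 0 1 T = Set.range fun j => constWedge fun _ : Fin 1 => tetCoeff j := by
  have h : ∀ j, toStd T (constForm T ![ψ T j]) = constWedge fun _ => tetCoeff j := fun j =>
    toStd_constForm_eq fun i => by
      rw [Subsingleton.elim i 0]
      exact ψ_comp_baryVector T j
  rw [stdBasis, recBasis, constBasis, if_neg one_ne_zero, dif_neg (by norm_num), middleConstBasis,
    Set.image_insert_eq, Set.image_pair, h, h, h]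
  ext ω
  simp [Fin.exists_fin_succ, eq_comm]

theorem stdBasis_tetrahedron_two (T : Affine.Simplex ℝ E 3) :
    stdBasis a b .full 0 2 T =
      Set.range fun j => constWedge fun i => tetCoeff (tetPair j i) := by
  have h : ∀ i j, toStd T (constForm T ![ψ T i, ψ T j]) = constWedge ![tetCoeff i, tetCoeff j] :=
    fun i j => toStd_constForm_eq fun m => by
      fin_cases m
      · exact ψ_comp_baryVector T i
      · exact ψ_comp_baryVector T j
  have h2 : ∀ j, (fun i => tetCoeff (tetPair j i)) =
      ![tetCoeff (tetPair j 0), tetCoeff (tetPair j 1)] := fun j => by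
    ext m : 1
    fin_cases m <;> rfl
  rw [stdBasis, recBasis, constBasis, if_neg two_ne_zero, dif_neg (by norm_num), middleConstBasis,
    Set.image_insert_eq, Set.image_pair, h, h, h]
  simp only [h2]
  ext ω
  simp [Fin.exists_fin_succ, eq_comm, tetPair]

/-! ### The constant bases are bases -/

theorem isBasisOf_zero_zero (ha : ∀ m F, a m F ≠ 0) (T : Affine.Simplex ℝ E n) :
    IsBasisOf (stdBasis a b .full 0 0 T) (space .full 0 0 (Fin (n + 1))) := by
  have h : ((a n T : ℝ) : ℂ) ≠ 0 := Complex.ofReal_ne_zero.2 (ha n T)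
  rw [stdBasis_zero_zero, space_zero_zero, ← span_singleton_smul h]
  exact isBasisOf_singleton (smul_ne_zero h dForm_elim0_ne_zero)

theorem isBasisOf_zero_top (hb : ∀ m F, b m F ≠ 0) (hn : n ≠ 0) (T : Affine.Simplex ℝ E n) :
    IsBasisOf (stdBasis a b .full 0 n T) (space .full 0 n (Fin (n + 1))) := by
  have h : ((b n T : ℝ) : ℂ) ≠ 0 := Complex.ofReal_ne_zero.2 (hb n T)
  rw [stdBasis_zero_top a b hn, space_zero_top, ← span_singleton_smul h]
  exact isBasisOf_singleton (smul_ne_zero h volume_ne_zero)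

theorem range_fin_one {J X : Type*} (f : (Fin 1 → J) → X) :
    Set.range f = Set.range fun j => f fun _ => j := by
  ext y
  constructor
  · rintro ⟨σ, rfl⟩
    exact ⟨σ 0, congrArg f (funext fun i => by rw [Subsingleton.elim i 0])⟩
  · rintro ⟨j, rfl⟩
    exact ⟨_, rfl⟩

theorem isBasisOf_triangle (T : Affine.Simplex ℝ E 2) :
    IsBasisOf (stdBasis a b .full 0 1 T) (space .full 0 1 (Fin 3)) := by
  have h3 := ξ₃_sum
  have hp : ∀ m q, m % 3 = q → ξ₃ ^ m = ξ₃ ^ q := fun m q h => by rw [← h, ξ₃_pow_mod]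
  have e3 := hp 3 0 rfl
  have e4 := hp 4 1 rfl
  have e5 := hp 5 2 rfl
  have e6 := hp 6 0 rfl
  have e8 := hp 8 2 rfl
  have hspan : ∀ i : Fin 3, covec i ∈
      Submodule.span ℂ (Set.range fun j => lin (triCoeff j)) := fun i => by
    -- Fourier inversion on the cyclic group of order three; the trivial character contributes
    -- nothing because the dλ sum to zero.
    have key : covec i = (ξ₃ ^ (2 * (i : ℕ)) / 3) • lin (triCoeff 0) +
        (ξ₃ ^ (i : ℕ) / 3) • lin (triCoeff 1) := by
      have h0 := lin_const (ι := Fin 3) (1 / 3)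
      rw [← add_zero (_ + _), ← h0]
      ext u
      simp only [LinearMap.add_apply, LinearMap.smul_apply, lin_apply, covec_apply,
        Fin.sum_univ_three, triCoeff, smul_eq_mul]
      fin_cases i <;> simp
      · linear_combination -((u.1 1 : ℂ) + u.1 2) / 3 * h3 - (u.1 2 : ℂ) / 3 * e4
      · linear_combination -(2 / 3 * (u.1 1 : ℂ)) * e3 - (u.1 0 : ℂ) / 3 * h3 -
          (u.1 2 : ℂ) / 3 * (h3 + e4 + e5)
      · linear_combination -(2 / 3 * (u.1 2 : ℂ)) * e6 - (u.1 0 : ℂ) / 3 * (h3 + e4) -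
          (u.1 1 : ℂ) / 3 * (h3 + e4 + e5)
    rw [key]
    exact add_mem (Submodule.smul_mem _ _ (Submodule.subset_span ⟨0, rfl⟩))
      (Submodule.smul_mem _ _ (Submodule.subset_span ⟨1, rfl⟩))
  rw [stdBasis_triangle, space_full_zero_eq_span triCoeff hspan, range_fin_one]
  -- The exponent `2 * ((j + 1) * i)` gives the conjugate characters; orthogonality yields the value
  -- 3.
  refine isBasisOf_range_of_dual _ (fun j => coneSum (stdSimplex.vertex 0)
    fun i => ξ₃ ^ (2 * (((j : ℕ) + 1) * i))) (c := 3) (by norm_num) fun i j => ?_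
  rw [coneSum_constWedge]
  · fin_cases i <;> fin_cases j <;> simp [triCoeff, Fin.sum_univ_three, ← pow_add]
    · linear_combination e3 + e6
    · linear_combination h3 + e4 + e8
    · linear_combination h3 + e5 + hp 10 1 rfl
    · linear_combination e6 + hp 12 0 rfl
  · fin_cases i <;> simp [Fin.sum_univ_three]
    · linear_combination h3 + e4
    · linear_combination h3 + e4 + e8

theorem tetSign_dot (i j : Fin 3) : ∑ m, tetSign i m * tetSign j m = if i = j then 4 else 0 := by
  revert i j
  decide

theorem tetCoeff_dot (i j : Fin 3) : ∑ m, tetCoeff i m * tetCoeff j m = if i = j then 4 else 0 := by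
  have := congrArg (Int.cast : ℤ → ℂ) (tetSign_dot i j)
  push_cast at this
  exact this

theorem tetSign_sum (j : Fin 3) : ∑ m, tetSign j m = 0 := by
  revert j
  decide

theorem covec_mem_span_tetCoeff (i : Fin 4) :
    covec i ∈ Submodule.span ℂ (Set.range fun j => lin (tetCoeff j)) := by
  -- The three sign vectors and the constant vector are an orthogonal basis of squared length 4, and
  -- the constant vector gives the zero covector.
  have key : covec i = ∑ j, (tetCoeff j i / 4) • lin (tetCoeff j) := by
    have h0 := lin_const (ι := Fin 4) (1 / 4)
    rw [← add_zero (Finset.sum _ _), ← h0]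
    ext u
    simp only [LinearMap.add_apply, LinearMap.smul_apply, lin_apply, covec_apply,
      Fin.sum_univ_four, tetCoeff, smul_eq_mul, Fin.sum_univ_three]
    fin_cases i <;> simp [tetSign] <;> ring
  rw [key]
  exact sum_mem fun j _ => Submodule.smul_mem _ _ (Submodule.subset_span ⟨j, rfl⟩)

theorem isBasisOf_tetrahedron_one (T : Affine.Simplex ℝ E 3) :
    IsBasisOf (stdBasis a b .full 0 1 T) (space .full 0 1 (Fin 4)) := by
  rw [stdBasis_tetrahedron_one, space_full_zero_eq_span tetCoeff covec_mem_span_tetCoeff,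
    range_fin_one]
  refine isBasisOf_range_of_dual _ (fun j => coneSum (stdSimplex.vertex 0) (tetCoeff j))
    (c := 4) (by norm_num) fun i j => ?_
  rw [coneSum_constWedge, tetCoeff_dot]
  have := congrArg (Int.cast : ℤ → ℂ) (tetSign_sum i)
  push_cast at this
  exact this

/-- The tangent vectors dual to the constant basis one-forms on a tetrahedron. -/
def tetVector (j : Fin 3) : Tangent (Fin 4) :=
  ⟨fun i => tetSign j i, by
    rw [LinearMap.mem_ker, LinearMap.sum_apply]
    have := congrArg (Int.cast : ℤ → ℝ) (tetSign_sum j)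
    push_cast at this
    exact this⟩

theorem lin_tetVector (i j : Fin 3) : lin (tetCoeff i) (tetVector j) = if i = j then 4 else 0 := by
  rw [lin_apply, ← tetCoeff_dot]
  simp [tetVector, tetCoeff]

theorem tetPair_cases : ∀ σ : Fin 2 → Fin 3, σ 0 = σ 1 ∨
    ∃ j, σ = tetPair j ∨ σ = tetPair j ∘ Equiv.swap 0 1 := by
  decide

theorem isBasisOf_tetrahedron_two (T : Affine.Simplex ℝ E 3) :
    IsBasisOf (stdBasis a b .full 0 2 T) (space .full 0 2 (Fin 4)) := by
  have hs : Submodule.span ℂ (Set.range fun σ : Fin 2 → Fin 3 =>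
      constWedge fun i => tetCoeff (σ i)) =
      Submodule.span ℂ (Set.range fun j => constWedge fun i => tetCoeff (tetPair j i)) := by
    refine le_antisymm (Submodule.span_le.2 ?_) (Submodule.span_mono ?_)
    · rintro _ ⟨σ, rfl⟩
      rcases tetPair_cases σ with h | ⟨j, rfl | rfl⟩
      · have : constWedge (fun i => tetCoeff (σ i)) = 0 :=
          funext fun x => wedge_eq_zero_of_eq _ (i := 0) (j := 1) (by decide)
            (congrArg (fun i => lin (tetCoeff i)) h)
        simp only [this]
        exact zero_mem _
      · exact Submodule.subset_span ⟨j, rfl⟩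
      · have : constWedge (fun i => tetCoeff ((tetPair j ∘ Equiv.swap 0 1) i)) =
            ((Equiv.Perm.sign (Equiv.swap (0 : Fin 2) 1) : ℤ) : ℂ) •
              constWedge fun i => tetCoeff (tetPair j i) :=
          funext fun x => wedge_comp_perm (fun i => lin (tetCoeff (tetPair j i))) _
        simp only [this]
        exact Submodule.smul_mem _ _ (Submodule.subset_span ⟨j, rfl⟩)
    · rintro _ ⟨j, rfl⟩
      exact ⟨_, rfl⟩
  rw [stdBasis_tetrahedron_two, space_full_zero_eq_span tetCoeff covec_mem_span_tetCoeff, hs]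
  -- `16` is the determinant of four times the identity of size two.
  refine isBasisOf_range_of_dual _ (fun j => evalAt (stdSimplex.vertex 0) fun i =>
    tetVector (tetPair j i)) (c := 16) (by norm_num) fun i j => ?_
  change wedge _ _ = _
  rw [wedge_apply, Matrix.det_fin_two]
  simp only [Matrix.of_apply, lin_tetVector]
  fin_cases i <;> fin_cases j <;> simp [tetPair] <;> norm_num

/-! ### The action of permutations on the constant bases -/

/-- The pullback along every permutation of the vertices maps the members of `A'` to multiples of
members of `A`, with factors from `U`. -/
def Permutes {ι : Type*} [Fintype ι] (U : Set ℂ) (A A' : Set (StdForm ι k)) : Prop :=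
  ∀ π : Equiv.Perm ι, ∀ ω ∈ A', ∃ χ ∈ U, ∃ η ∈ A, pull π ω = χ • η

/-- The sets of factors that admit all signs and all ratios of the numbers `a`, `b`. -/
structure IsFactorSet (U : Set ℂ) : Prop where
  one_mem : 1 ∈ U
  neg_mem : ∀ z ∈ U, -z ∈ U
  ratio_a : ∀ (n : ℕ) (T T' : Affine.Simplex ℝ E n), (a n T' : ℂ) / a n T ∈ U
  ratio_b : ∀ (n : ℕ) (T T' : Affine.Simplex ℝ E n), (b n T' : ℂ) / b n T ∈ U

variable {a b}

theorem IsFactorSet.sign_mul {U : Set ℂ} (hU : IsFactorSet a b U) (s : ℤˣ) {z : ℂ} (hz : z ∈ U) :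
    ((s : ℤ) : ℂ) * z ∈ U := by
  rcases Int.units_eq_one_or s with rfl | rfl
  · simpa using hz
  · simpa using hU.neg_mem z hz

variable (a b)

/-- The permutations of the vertices respect the bases of a given type. -/
def IsEquivariant (U : Set ℂ) (fam : Family) (r k n : ℕ) : Prop :=
  ∀ T T' : Affine.Simplex ℝ E n, Permutes U (stdBasis a b fam r k T) (stdBasis a b fam r k T')

variable {a b} {U : Set ℂ}

/-- Two simplices appear because a symmetry of a larger simplex carries one face to another, where
the normalization may differ; the ratio of the two constants enters the factor. -/
theorem isEquivariant_zero_zero (ha : ∀ m F, a m F ≠ 0) (hU : IsFactorSet a b U) (n : ℕ) :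
    IsEquivariant a b U .full 0 0 n := by
  intro T T' π ω hω
  rw [stdBasis_zero_zero, Set.mem_singleton_iff] at hω
  refine ⟨_, hU.ratio_a n T T', _, by rw [stdBasis_zero_zero]; rfl, ?_⟩
  rw [hω, map_smul, pull_dForm_elim0, smul_smul,
    div_mul_cancel₀ _ (Complex.ofReal_ne_zero.2 (ha n T))]

theorem isEquivariant_zero_top (hb : ∀ m F, b m F ≠ 0) (hU : IsFactorSet a b U) (hn : n ≠ 0) :
    IsEquivariant a b U .full 0 n n := by
  intro T T' π ω hω
  rw [stdBasis_zero_top a b hn, Set.mem_singleton_iff] at hω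
  refine ⟨_, hU.sign_mul (Equiv.Perm.sign π) (hU.ratio_b n T T'), _,
    by rw [stdBasis_zero_top a b hn]; rfl, ?_⟩
  rw [hω, map_smul, pull_volume, smul_smul, smul_smul, mul_assoc,
    div_mul_cancel₀ _ (Complex.ofReal_ne_zero.2 (hb n T)), mul_comm]

theorem constWedge_smul {ι : Type*} [Fintype ι] (e : Fin k → ℂ) (c : Fin k → ι → ℂ) :
    constWedge (fun i => e i • c i) = (∏ i, e i) • constWedge c := by
  funext x
  simp only [constWedge, lin_smul]
  exact (wedgeMultilinear (Tangent ι) k).map_smul_univ e fun i => lin (c i)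

/-- All permutations of three elements are affine maps of the integers modulo three, so they turn a
nontrivial character into a power of `ξ₃` times a nontrivial character. -/
theorem triangle_exponents : ∀ (π : Equiv.Perm (Fin 3)) (j : Fin 2), ∃ (j' : Fin 2) (c : Fin 3),
    ∀ i : Fin 3, (((j : ℕ) + 1) * (π i)) % 3 = (c + ((j' : ℕ) + 1) * i) % 3 := by
  decide

theorem isEquivariant_triangle (hU : ∀ m : ℕ, ξ₃ ^ m ∈ U) : IsEquivariant a b U .full 0 1 2 := by
  intro T T' π ω hω
  rw [stdBasis_triangle] at hω
  obtain ⟨j, rfl⟩ := hω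
  obtain ⟨j', c, h⟩ := triangle_exponents π j
  refine ⟨_, hU c, _, by rw [stdBasis_triangle]; exact ⟨j', rfl⟩, ?_⟩
  have : triCoeff j ∘ π = ξ₃ ^ (c : ℕ) • triCoeff j' := funext fun i => by
    rw [Function.comp_apply, triCoeff, ← ξ₃_pow_mod, h, ξ₃_pow_mod, pow_add]
    rfl
  rw [pull_constWedge, this, constWedge_smul, Fin.prod_univ_one]

/-- The sign vectors correspond, up to sign, to the three partitions of the vertices into two pairs,
and permutations of the vertices permute these partitions. -/
theorem tetrahedron_signs : ∀ (π : Equiv.Perm (Fin 4)) (j : Fin 3), ∃ (j' : Fin 3) (e : ℤˣ),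
    ∀ i : Fin 4, tetSign j (π i) = e * tetSign j' i := by
  decide

theorem tetCoeff_comp {π : Equiv.Perm (Fin 4)} {j j' : Fin 3} {e : ℤˣ}
    (h : ∀ i, tetSign j (π i) = e * tetSign j' i) : tetCoeff j ∘ π = ((e : ℤ) : ℂ) • tetCoeff j' :=
  funext fun i => by
    rw [Function.comp_apply, tetCoeff, h, Int.cast_mul]
    rfl

theorem isEquivariant_tetrahedron_one (hU : IsFactorSet a b U) :
    IsEquivariant a b U .full 0 1 3 := by
  intro T T' π ω hω
  rw [stdBasis_tetrahedron_one] at hω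
  obtain ⟨j, rfl⟩ := hω
  obtain ⟨j', e, h⟩ := tetrahedron_signs π j
  refine ⟨_, hU.sign_mul e hU.one_mem, _, by rw [stdBasis_tetrahedron_one]; exact ⟨j', rfl⟩, ?_⟩
  rw [pull_constWedge, tetCoeff_comp h, constWedge_smul, Fin.prod_univ_one, mul_one]

theorem isEquivariant_tetrahedron_two (hU : IsFactorSet a b U) :
    IsEquivariant a b U .full 0 2 3 := by
  intro T T' π ω hω
  rw [stdBasis_tetrahedron_two] at hω
  obtain ⟨j, rfl⟩ := hω
  choose f e h using tetrahedron_signs π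
  have hprod : ∏ i, ((e (tetPair j i) : ℤ) : ℂ) =
      (((∏ i, e (tetPair j i) : ℤˣ) : ℤ) : ℂ) := by
    push_cast
    rfl
  have hp : pull π (constWedge fun i => tetCoeff (tetPair j i)) =
      (((∏ i, e (tetPair j i) : ℤˣ) : ℤ) : ℂ) • constWedge fun i => tetCoeff (f (tetPair j i)) := by
    rw [pull_constWedge]
    simp only [tetCoeff_comp (h _)]
    rw [constWedge_smul, hprod]
  rcases tetPair_cases fun i => f (tetPair j i) with h0 | ⟨j', h1 | h1⟩
  -- This case is impossible: two orthogonal sign vectors would become parallel under a permutation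
  -- of their entries.
  · have hne : tetPair j 0 ≠ tetPair j 1 :=
      (by decide : ∀ j, tetPair j 0 ≠ tetPair j 1) j
    have h2 := tetSign_dot (tetPair j 0) (tetPair j 1)
    have h3 := tetSign_dot (f (tetPair j 0)) (f (tetPair j 0))
    have h4 : ∑ i, tetSign (tetPair j 0) (π i) * tetSign (tetPair j 1) (π i) =
        ((e (tetPair j 0) * e (tetPair j 1) : ℤˣ) : ℤ) *
          ∑ i, tetSign (f (tetPair j 0)) i * tetSign (f (tetPair j 0)) i := by
      rw [Finset.mul_sum]
      refine Finset.sum_congr rfl fun i _ => ?_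
      rw [h, h, ← h0, Units.val_mul]
      ring
    rw [← Equiv.sum_comp π, h4, h3, if_neg hne, if_pos rfl] at h2
    exact absurd h2 (mul_ne_zero (Units.ne_zero _) (by norm_num))
  · refine ⟨_, hU.sign_mul (∏ i, e (tetPair j i)) hU.one_mem, _,
      by rw [stdBasis_tetrahedron_two]; exact ⟨j', rfl⟩, ?_⟩
    rw [mul_one, hp]
    exact congrArg _ (congrArg (fun σ : Fin 2 → Fin 3 => constWedge fun i => tetCoeff (σ i)) h1)
  · refine ⟨_, hU.sign_mul (∏ i, e (tetPair j i)) (hU.neg_mem _ hU.one_mem), _,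
      by rw [stdBasis_tetrahedron_two]; exact ⟨j', rfl⟩, ?_⟩
    have h2 : constWedge (fun i => tetCoeff (f (tetPair j i))) =
        (-1 : ℂ) • constWedge fun i => tetCoeff (tetPair j' i) := by
      rw [show (-1 : ℂ) = ((Equiv.Perm.sign (Equiv.swap (0 : Fin 2) 1) : ℤ) : ℂ) by simp]
      refine Eq.trans ?_ (funext fun x =>
        wedge_comp_perm (fun i => lin (tetCoeff (tetPair j' i))) (Equiv.swap 0 1))
      exact congrArg (fun σ : Fin 2 → Fin 3 => constWedge fun i => tetCoeff (σ i)) h1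
    rw [hp, h2, smul_smul]

/-- Some permutation of the vertices multiplies some member of the basis by a nonreal factor. -/
def IsRotating (a b : ∀ m : ℕ, Affine.Simplex ℝ E m → ℝ) (fam : Family) (r k n : ℕ) : Prop :=
  ∀ T : Affine.Simplex ℝ E n, ∃ π : Equiv.Perm (Fin (n + 1)), ∃ ω ∈ stdBasis a b fam r k T,
    ∃ χ : ℂ, (∀ x : ℝ, χ ≠ x) ∧ pull π ω = χ • ω

theorem isRotating_triangle : IsRotating a b .full 0 1 2 := by
  intro T
  refine ⟨finRotate 3, _, by rw [stdBasis_triangle]; exact ⟨0, rfl⟩, ξ₃, ξ₃_ne_ofReal, ?_⟩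
  have h : triCoeff 0 ∘ finRotate 3 = ξ₃ • triCoeff 0 := funext fun i => by
    have := ξ₃_isPrimitiveRoot.pow_eq_one
    rw [Function.comp_apply, Pi.smul_apply, smul_eq_mul, triCoeff, triCoeff]
    fin_cases i
    · simp
    · simp [pow_two]
    · simp [← pow_succ', this]
  rw [pull_constWedge, h, constWedge_smul, Fin.prod_univ_one]

end

open StdForm

section

variable {E : Type*} [AddCommGroup E] [Module ℝ E] {n : ℕ}
  {a b : ∀ m : ℕ, Affine.Simplex ℝ E m → ℝ}

/-! ### The recursively constructed sets are bases -/

theorem isBasisOf_of_faces {fam : Family} {r k : ℕ} (hr : r ≠ 0)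
    {Q : Set (StdForm (Fin (n + 1)) k)} (B : Finset (Fin (n + 1)) → Set (StdForm (Fin (n + 1)) k))
    (hQ : ∀ y, y ∈ Q ↔ ∃ fs, y ∈ B fs) (hB : ∀ fs, IsBasisOf (B fs) (faceSpace fam r k fs)) :
    IsBasisOf Q (space fam r k (Fin (n + 1))) := by
  have hQ' : Q = ⋃ fs, B fs := Set.ext fun y => by rw [hQ, Set.mem_iUnion]
  rw [hQ', ← iSup_faceSpace]
  exact isBasisOf_iUnion hB (iSupIndep_faceSpace fam hr)

theorem isBasisOf_stdBasis_trimmed {r k : ℕ}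
    (h : ∀ l s, l + k ≤ n → s + l + 1 = r → ∀ F : Affine.Simplex ℝ E (l + k),
      IsBasisOf (stdBasis a b .full s l F) (space .full s l (Fin (l + k + 1))))
    (T : Affine.Simplex ℝ E n) :
    IsBasisOf (stdBasis a b .trimmed r k T) (space .trimmed r k (Fin (n + 1))) := by
  rcases Nat.eq_zero_or_pos r with rfl | hr
  · have h1 : stdBasis a b .trimmed 0 k T = ∅ := Set.eq_empty_iff_forall_notMem.2 fun y hy => by
      obtain ⟨_, l, s, _, h0, -⟩ := (mem_stdBasis_trimmed a b 0 k T y).1 hy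
      omega
    have h2 : space .trimmed 0 k (Fin (n + 1)) = ⊥ := Submodule.span_eq_bot.2 fun y hy => by
      obtain ⟨α, σ, h0, -⟩ := hy
      omega
    rw [h1, h2]
    exact isBasisOf_empty
  refine isBasisOf_of_faces hr.ne' (fun fs => {y | ∃ (l s : ℕ) (h : fs.card = l + k + 1),
    s + l + 1 = r ∧ y ∈ graphImage (faceGraphI s l k (fs.orderEmbOfFin h))
      (stdBasis a b .full s l (T.face h))}) (fun y => mem_stdBasis_trimmed a b r k T y) fun fs => ?_
  have hcard : fs.card ≤ n + 1 := (Finset.card_le_univ fs).trans (by simp)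
  -- Within these bounds the face determines `l` and `s`, and exactly one relation contributes;
  -- outside them both the set and the contribution of the face are trivial.
  by_cases h1 : k < fs.card ∧ fs.card ≤ r + k
  · obtain ⟨l, hl⟩ : ∃ l, fs.card = l + k + 1 := ⟨fs.card - k - 1, by omega⟩
    obtain ⟨s, rfl⟩ : ∃ s, r = s + l + 1 := ⟨r - l - 1, by omega⟩
    have h2 := isBasisOf_faceGraphI (h l s (by omega) rfl (T.face hl))
      (fs.orderEmbOfFin hl).injective
    rw [fs.image_orderEmbOfFin_univ hl] at h2
    convert h2 using 1
    ext y
    constructor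
    · rintro ⟨l', s', hl', hs', hy⟩
      obtain rfl : l' = l := by omega
      obtain rfl : s' = s := by omega
      exact hy
    · exact fun hy => ⟨l, s, hl, rfl, hy⟩
  · have h3 : faceSpace .trimmed r k fs = ⊥ := by
      rw [not_and_or] at h1
      rcases h1 with h1 | h1
      · exact faceSpace_eq_bot_of_card_le _ hr.ne' (not_lt.1 h1)
      · exact faceSpace_trimmed_eq_bot (not_le.1 h1)
    rw [h3]
    convert isBasisOf_empty
    refine Set.eq_empty_iff_forall_notMem.2 ?_
    rintro y ⟨l, s, h4, h5, -⟩
    omega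

theorem isBasisOf_stdBasis_full {r k : ℕ}
    (h : ∀ l s, k + l ≤ n → s + l = r + 1 → ∀ F : Affine.Simplex ℝ E (k + l),
      IsBasisOf (stdBasis a b .trimmed s l F) (space .trimmed s l (Fin (k + l + 1))))
    (T : Affine.Simplex ℝ E n) :
    IsBasisOf (stdBasis a b .full (r + 1) k T) (space .full (r + 1) k (Fin (n + 1))) := by
  refine isBasisOf_of_faces r.succ_ne_zero (fun fs => {y | ∃ (l s : ℕ) (h : fs.card = k + l + 1),
    s + l = r + 1 ∧ y ∈ graphImage (faceGraphJ s k l (fs.orderEmbOfFin h))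
      (stdBasis a b .trimmed s l (T.face h))}) (fun y => mem_stdBasis_full a b r k T y) fun fs => ?_
  have hcard : fs.card ≤ n + 1 := (Finset.card_le_univ fs).trans (by simp)
  -- The bound admits `s = 0`, where the trimmed space is zero and its basis is empty.
  by_cases h1 : k < fs.card ∧ fs.card ≤ r + 1 + k + 1
  · obtain ⟨l, hl⟩ : ∃ l, fs.card = k + l + 1 := ⟨fs.card - k - 1, by omega⟩
    obtain ⟨s, hs⟩ : ∃ s, s + l = r + 1 := ⟨r + 1 - l, by omega⟩
    have h2 := isBasisOf_faceGraphJ (h l s (by omega) hs (T.face hl))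
      (fs.orderEmbOfFin hl).injective (by omega)
    rw [fs.image_orderEmbOfFin_univ hl, hs] at h2
    convert h2 using 1
    ext y
    constructor
    · rintro ⟨l', s', hl', hs', hy⟩
      obtain rfl : l' = l := by omega
      obtain rfl : s' = s := by omega
      exact hy
    · exact fun hy => ⟨l, s, hl, hs, hy⟩
  · have h3 : faceSpace .full (r + 1) k fs = ⊥ := by
      rw [not_and_or] at h1
      rcases h1 with h1 | h1
      · exact faceSpace_eq_bot_of_card_le _ r.succ_ne_zero (not_lt.1 h1)
      · exact faceSpace_full_eq_bot (by omega)
    rw [h3]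
    convert isBasisOf_empty
    refine Set.eq_empty_iff_forall_notMem.2 ?_
    rintro y ⟨l, s, h4, h5, -⟩
    omega

theorem isBasisOf_stdBasis_zero (ha : ∀ m F, a m F ≠ 0) (hb : ∀ m F, b m F ≠ 0) {k : ℕ}
    (hk : k ≤ n) (hn : n ≤ 3) (T : Affine.Simplex ℝ E n) :
    IsBasisOf (stdBasis a b .full 0 k T) (space .full 0 k (Fin (n + 1))) := by
  rcases Nat.eq_zero_or_pos k with rfl | hk0
  · exact isBasisOf_zero_zero a b ha T
  rcases hk.eq_or_lt with rfl | hkn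
  · exact isBasisOf_zero_top a b hb hk0.ne' T
  obtain ⟨rfl, rfl⟩ | ⟨rfl, rfl⟩ | ⟨rfl, rfl⟩ :
      (k = 1 ∧ n = 2) ∨ (k = 1 ∧ n = 3) ∨ (k = 2 ∧ n = 3) := by omega
  · exact isBasisOf_triangle a b T
  · exact isBasisOf_tetrahedron_one a b T
  · exact isBasisOf_tetrahedron_two a b T

/-- Trimmed forms of degree r rest on full forms of smaller degree, while full forms of degree r may
rest on trimmed forms of the same degree, namely for `l = 0`. In each degree the trimmed case
therefore comes first. -/
theorem isBasisOf_stdBasis (ha : ∀ m F, a m F ≠ 0) (hb : ∀ m F, b m F ≠ 0) (r : ℕ) :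
    ∀ (fam : Family) {k n : ℕ}, k ≤ n → n ≤ 3 → ∀ T : Affine.Simplex ℝ E n,
      IsBasisOf (stdBasis a b fam r k T) (space fam r k (Fin (n + 1))) := by
  induction r using Nat.strong_induction_on with
  | _ r ih =>
    have ht : ∀ {k n : ℕ}, n ≤ 3 → ∀ T : Affine.Simplex ℝ E n,
        IsBasisOf (stdBasis a b .trimmed r k T) (space .trimmed r k (Fin (n + 1))) :=
      fun hn => isBasisOf_stdBasis_trimmed fun l s hl hs F =>
        ih s (by omega) .full (by omega) (hl.trans hn) F
    rintro (_ | _) k n hk hn T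
    · cases r with
      | zero => exact isBasisOf_stdBasis_zero ha hb hk hn T
      | succ r =>
        refine isBasisOf_stdBasis_full (fun l s hl hs F => ?_) T
        rcases (show s ≤ r + 1 by omega).eq_or_lt with rfl | hs'
        · exact ht (hl.trans hn) F
        · exact ih s hs' .trimmed (by omega) (hl.trans hn) F
    · exact ht hn T

/-! ### The action of permutations -/

theorem pull_mem_faceGraphI {p q s : ℕ} {κ : Type*} [Fintype κ] [DecidableEq κ]
    {g g' : Fin (p + q + 1) → κ} (hg : Function.Injective g) (hg' : Function.Injective g')
    {π : Equiv.Perm κ} {πG : Equiv.Perm (Fin (p + q + 1))} (hπ : g' ∘ πG = π ∘ g) {x y}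
    (h : (x, y) ∈ faceGraphI s p q g') :
    (pull πG x, ((Equiv.Perm.sign πG : ℤ) : ℂ) • pull π y) ∈ faceGraphI s p q g := by
  obtain ⟨z, h1, h2⟩ := h
  exact ⟨_, pull_mem_starI πG h1, Submodule.smul_mem _ _ (pull_mem_extGraph .trimmed hg hg' hπ h2)⟩

theorem pull_mem_faceGraphJ {p q s : ℕ} {κ : Type*} [Fintype κ] [DecidableEq κ]
    {g g' : Fin (p + q + 1) → κ} (hg : Function.Injective g) (hg' : Function.Injective g')
    {π : Equiv.Perm κ} {πG : Equiv.Perm (Fin (p + q + 1))} (hπ : g' ∘ πG = π ∘ g) {x y}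
    (h : (x, y) ∈ faceGraphJ s p q g') :
    (pull πG x, ((Equiv.Perm.sign πG : ℤ) : ℂ) • pull π y) ∈ faceGraphJ s p q g := by
  obtain ⟨z, h1, h2⟩ := h
  refine ⟨((Equiv.Perm.sign πG : ℤ) : ℂ) • pull πG z, ?_,
    Submodule.smul_mem _ _ (pull_mem_extGraph .full hg hg' hπ h2)⟩
  have h3 := Submodule.smul_mem _ ((Equiv.Perm.sign πG : ℤ) : ℂ) (pull_mem_starJ πG h1)
  rwa [Prod.smul_mk, smul_smul, intUnit_mul_self, one_smul] at h3

theorem exists_perm_comp_eq {ι κ : Type*} [Finite ι] {g g' : ι → κ} (hg : Function.Injective g)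
    (π : Equiv.Perm κ) (h : ∀ i, π (g i) ∈ Set.range g') :
    ∃ πG : Equiv.Perm ι, g' ∘ πG = π ∘ g := by
  choose f hf using h
  have hi : Function.Injective f := fun i j hij => hg (π.injective (by rw [← hf, ← hf, hij]))
  exact ⟨Equiv.ofBijective f (Finite.injective_iff_bijective.1 hi), funext hf⟩

theorem exists_face_of_perm {κ : Type*} [LinearOrder κ] {m : ℕ} (π : Equiv.Perm κ)
    (fs' : Finset κ) (h' : fs'.card = m) : ∃ (fs : Finset κ) (h : fs.card = m)
      (πG : Equiv.Perm (Fin m)), fs'.orderEmbOfFin h' ∘ πG = π ∘ fs.orderEmbOfFin h := by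
  have h : (fs'.image π.symm).card = m := by
    rw [Finset.card_image_of_injective _ π.symm.injective, h']
  refine ⟨fs'.image π.symm, h, exists_perm_comp_eq (RelEmbedding.injective _) π fun i => ?_⟩
  rw [Finset.range_orderEmbOfFin]
  obtain ⟨j, hj, hji⟩ := Finset.mem_image.1 ((fs'.image π.symm).orderEmbOfFin_mem h i)
  rwa [← hji, Equiv.apply_symm_apply]

variable {U : Set ℂ}

theorem exists_eq_smul_of_mem_graph {M N : Type*} [AddCommGroup M] [Module ℂ M] [AddCommGroup N]
    [Module ℂ N] (hU : IsFactorSet a b U) {C : Submodule ℂ (M × N)} {A : Set M} {χ : ℂ}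
    (hχ : χ ∈ U) (hχ0 : χ ≠ 0) (e : ℤˣ) {x : M} (hx : x ∈ A) {y : N}
    (h : (χ • x, ((e : ℤ) : ℂ) • y) ∈ C) : ∃ χ' ∈ U, ∃ η ∈ graphImage C A, y = χ' • η := by
  have he := intUnit_mul_self e
  refine ⟨_, hU.sign_mul e hχ, χ⁻¹ • ((e : ℤ) : ℂ) • y, ⟨x, hx, ?_⟩, ?_⟩
  · have := C.smul_mem χ⁻¹ h
    rwa [Prod.smul_mk, smul_smul, inv_mul_cancel₀ hχ0, one_smul] at this
  · rw [mul_smul, smul_smul χ, mul_inv_cancel₀ hχ0, one_smul, smul_smul, he, one_smul]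

/-- A permutation pulls the construction on a face of one simplex back to the construction on the
preimage face of the other. The factor changes only by the sign of the induced permutation. -/
theorem isEquivariant_trimmed (hU : IsFactorSet a b U) (hU0 : ∀ z ∈ U, z ≠ 0) {r k : ℕ}
    (h : ∀ l s, l + k ≤ n → s + l + 1 = r → IsEquivariant a b U .full s l (l + k)) :
    IsEquivariant a b U .trimmed r k n := by
  intro T T' π ω hω
  obtain ⟨fs', l, s, h', hs, x, hx, hxω⟩ := (mem_stdBasis_trimmed a b r k T' ω).1 hω
  obtain ⟨fs, h1, πG, hπ⟩ := exists_face_of_perm π fs' h'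
  have hcard : fs.card ≤ n + 1 := (Finset.card_le_univ fs).trans (by simp)
  obtain ⟨χ, hχ, x', hx', hxx⟩ := h l s (by omega) hs (T.face h1) (T'.face h') πG x hx
  have h2 := pull_mem_faceGraphI (RelEmbedding.injective _) (RelEmbedding.injective _) hπ hxω
  rw [hxx] at h2
  obtain ⟨χ', hχ', η, hη, he⟩ := exists_eq_smul_of_mem_graph hU hχ (hU0 χ hχ) _ hx' h2
  exact ⟨χ', hχ', η, (mem_stdBasis_trimmed a b r k T η).2 ⟨fs, l, s, h1, hs, hη⟩, he⟩

theorem isEquivariant_full (hU : IsFactorSet a b U) (hU0 : ∀ z ∈ U, z ≠ 0) {r k : ℕ}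
    (h : ∀ l s, k + l ≤ n → s + l = r + 1 → IsEquivariant a b U .trimmed s l (k + l)) :
    IsEquivariant a b U .full (r + 1) k n := by
  intro T T' π ω hω
  obtain ⟨fs', l, s, h', hs, x, hx, hxω⟩ := (mem_stdBasis_full a b r k T' ω).1 hω
  obtain ⟨fs, h1, πG, hπ⟩ := exists_face_of_perm π fs' h'
  have hcard : fs.card ≤ n + 1 := (Finset.card_le_univ fs).trans (by simp)
  obtain ⟨χ, hχ, x', hx', hxx⟩ := h l s (by omega) hs (T.face h1) (T'.face h') πG x hx
  have h2 := pull_mem_faceGraphJ (RelEmbedding.injective _) (RelEmbedding.injective _) hπ hxω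
  rw [hxx] at h2
  obtain ⟨χ', hχ', η, hη, he⟩ := exists_eq_smul_of_mem_graph hU hχ (hU0 χ hχ) _ hx' h2
  exact ⟨χ', hχ', η, (mem_stdBasis_full a b r k T η).2 ⟨fs, l, s, h1, hs, hη⟩, he⟩

theorem isEquivariant_zero (ha : ∀ m F, a m F ≠ 0) (hb : ∀ m F, b m F ≠ 0)
    (hU : IsFactorSet a b U) {k : ℕ} (hk : k ≤ n) (hn : n ≤ 3)
    (htri : k = 1 → n = 2 → ∀ m : ℕ, ξ₃ ^ m ∈ U) : IsEquivariant a b U .full 0 k n := by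
  rcases Nat.eq_zero_or_pos k with rfl | hk0
  · exact isEquivariant_zero_zero ha hU n
  rcases hk.eq_or_lt with rfl | hkn
  · exact isEquivariant_zero_top hb hU hk0.ne'
  obtain ⟨rfl, rfl⟩ | ⟨rfl, rfl⟩ | ⟨rfl, rfl⟩ :
      (k = 1 ∧ n = 2) ∨ (k = 1 ∧ n = 3) ∨ (k = 2 ∧ n = 3) := by omega
  · exact isEquivariant_triangle (htri rfl rfl)
  · exact isEquivariant_tetrahedron_one hU
  · exact isEquivariant_tetrahedron_two hU

/-! ### Rotations -/

/-- By single-valuedness a multiple of `x` is related only to the same multiple of `y`. The factor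
survives up to sign and stays nonreal. -/
theorem pull_eq_smul_of_mem_graph {M N : Type*} [AddCommGroup M] [Module ℂ M] [AddCommGroup N]
    [Module ℂ N] {C : Submodule ℂ (M × N)} (hC : ∀ y, ((0 : M), y) ∈ C → y = 0) {χ : ℂ}
    (hχ : ∀ z : ℝ, χ ≠ z) (e : ℤˣ) {x : M} {y y' : N} (h : (x, y) ∈ C)
    (h' : (χ • x, ((e : ℤ) : ℂ) • y') ∈ C) : ∃ χ' : ℂ, (∀ z : ℝ, χ' ≠ z) ∧ y' = χ' • y := by
  have h0 := C.sub_mem h' (C.smul_mem χ h)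
  rw [Prod.smul_mk, Prod.mk_sub_mk, sub_self] at h0
  have h1 := sub_eq_zero.1 (hC _ h0)
  refine ⟨((e : ℤ) : ℂ) * χ, fun z hz => ?_, ?_⟩
  · rcases Int.units_eq_one_or e with rfl | rfl
    · exact hχ z (by simpa using hz)
    · refine hχ (-z) ?_
      rw [Complex.ofReal_neg, ← hz]
      simp
  · rw [mul_smul, ← h1, smul_smul, intUnit_mul_self, one_smul]

theorem IsRotating.trimmed (ha : ∀ m F, a m F ≠ 0) (hb : ∀ m F, b m F ≠ 0) {l k s : ℕ}
    (h : IsRotating a b .full s l (l + k)) (hl : l + k ≤ n) (hn : n ≤ 3) :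
    IsRotating a b .trimmed (s + l + 1) k n := by
  intro T
  obtain ⟨fs, -, hfs⟩ := Finset.exists_subset_card_eq (s := (Finset.univ : Finset (Fin (n + 1))))
    (n := l + k + 1) (by simpa using hl)
  obtain ⟨πG, x, hx, χ, hχ, hxχ⟩ := h (T.face hfs)
  have hg := (fs.orderEmbOfFin hfs).injective
  have hxs := (isBasisOf_stdBasis ha hb s .full (Nat.le_add_right l k) (hl.trans hn) _).subset hx
  obtain ⟨y, -, hy⟩ := exists_mem_faceGraphI hg hxs
  -- The permutation of the face acts on the simplex by fixing the remaining vertices.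
  have hπ : fs.orderEmbOfFin hfs ∘ πG =
      πG.viaFintypeEmbedding (fs.orderEmbOfFin hfs).toEmbedding ∘ fs.orderEmbOfFin hfs :=
    funext fun i => (πG.viaFintypeEmbedding_apply_image (fs.orderEmbOfFin hfs).toEmbedding i).symm
  have h2 := pull_mem_faceGraphI hg hg hπ hy
  rw [hxχ] at h2
  obtain ⟨χ', hχ', he⟩ := pull_eq_smul_of_mem_graph (fun y => faceGraphI_fst_zero hg) hχ _ hy h2
  exact ⟨_, y, (mem_stdBasis_trimmed a b _ k T y).2 ⟨fs, l, s, hfs, rfl, x, hx, hy⟩, χ', hχ', he⟩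

theorem IsRotating.full (ha : ∀ m F, a m F ≠ 0) (hb : ∀ m F, b m F ≠ 0) {l k s r : ℕ}
    (h : IsRotating a b .trimmed s l (k + l)) (hl : k + l ≤ n) (hn : n ≤ 3) (hr : s + l = r + 1) :
    IsRotating a b .full (r + 1) k n := by
  intro T
  obtain ⟨fs, -, hfs⟩ := Finset.exists_subset_card_eq (s := (Finset.univ : Finset (Fin (n + 1))))
    (n := k + l + 1) (by simpa using hl)
  obtain ⟨πG, x, hx, χ, hχ, hxχ⟩ := h (T.face hfs)
  have hg := (fs.orderEmbOfFin hfs).injective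
  have hxs := (isBasisOf_stdBasis ha hb s .trimmed (Nat.le_add_left l k) (hl.trans hn) _).subset hx
  obtain ⟨y, -, hy⟩ := exists_mem_faceGraphJ hg hxs
  have hπ : fs.orderEmbOfFin hfs ∘ πG =
      πG.viaFintypeEmbedding (fs.orderEmbOfFin hfs).toEmbedding ∘ fs.orderEmbOfFin hfs :=
    funext fun i => (πG.viaFintypeEmbedding_apply_image (fs.orderEmbOfFin hfs).toEmbedding i).symm
  have h2 := pull_mem_faceGraphJ hg hg hπ hy
  rw [hxχ] at h2
  obtain ⟨χ', hχ', he⟩ :=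
    pull_eq_smul_of_mem_graph (fun y => faceGraphJ_fst_zero hg (by omega)) hχ _ hy h2
  exact ⟨_, y, (mem_stdBasis_full a b r k T y).2 ⟨fs, l, s, hfs, hr, x, hx, hy⟩, χ', hχ', he⟩

end

section

variable {E : Type*} [AddCommGroup E] [Module ℝ E] {a b : ∀ m : ℕ, Affine.Simplex ℝ E m → ℝ}
  {U : Set ℂ}

/-! ### Equivariance in the various degrees -/

theorem isEquivariant_all (ha : ∀ m F, a m F ≠ 0) (hb : ∀ m F, b m F ≠ 0)
    (hU : IsFactorSet a b U) (hU0 : ∀ z ∈ U, z ≠ 0) (hξ : ∀ m : ℕ, ξ₃ ^ m ∈ U) (r : ℕ) :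
    ∀ (fam : Family) {k n : ℕ}, k ≤ n → n ≤ 3 → IsEquivariant a b U fam r k n := by
  induction r using Nat.strong_induction_on with
  | _ r ih =>
    have ht : ∀ {k n : ℕ}, n ≤ 3 → IsEquivariant a b U .trimmed r k n := fun hn =>
      isEquivariant_trimmed hU hU0 fun l s hl hs => ih s (by omega) .full (by omega) (hl.trans hn)
    rintro (_ | _) k n hk hn
    · cases r with
      | zero => exact isEquivariant_zero ha hb hU hk hn fun _ _ => hξ
      | succ r =>
        refine isEquivariant_full hU hU0 fun l s hl hs => ?_
        rcases (show s ≤ r + 1 by omega).eq_or_lt with rfl | hs'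
        · exact ht (hl.trans hn)
        · exact ih s hs' .trimmed (by omega) (hl.trans hn)
    · exact ht hn

section Real

variable (ha : ∀ m F, a m F ≠ 0) (hb : ∀ m F, b m F ≠ 0) (hU : IsFactorSet a b U)
  (hU0 : ∀ z ∈ U, z ≠ 0)

include ha hb hU hU0

/-- Degree 0 on the simplex leads to the top degree on each face, and the top degree leads to
functions on the simplex itself. The recursion never leaves the extreme degrees, so it never meets
the one-forms on a triangle. -/
theorem isEquivariant_extreme (r : ℕ) :
    ∀ (fam : Family) {k n : ℕ}, k = 0 ∨ k = n → n ≤ 3 → IsEquivariant a b U fam r k n := by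
  induction r using Nat.strong_induction_on with
  | _ r ih =>
    have ht : ∀ {k n : ℕ}, k = 0 ∨ k = n → n ≤ 3 → IsEquivariant a b U .trimmed r k n :=
      fun hk hn => isEquivariant_trimmed hU hU0 fun l s hl hs =>
        ih s (by omega) .full (by omega) (hl.trans hn)
    rintro (_ | _) k n hk hn
    · cases r with
      | zero => exact isEquivariant_zero ha hb hU (by omega) hn (by omega)
      | succ r =>
        refine isEquivariant_full hU hU0 fun l s hl hs => ?_
        rcases (show s ≤ r + 1 by omega).eq_or_lt with rfl | hs'
        · exact ht (by omega) (hl.trans hn)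
        · exact ih s hs' .trimmed (by omega) (hl.trans hn)
    · exact ht hk hn

theorem isEquivariant_triangle_full {r : ℕ} (h : IsEquivariant a b U .trimmed r 1 2) :
    IsEquivariant a b U .full (r + 1) 1 2 := by
  refine isEquivariant_full hU hU0 fun l s hl hs => ?_
  obtain rfl | rfl : l = 0 ∨ l = 1 := by omega
  · exact isEquivariant_extreme ha hb hU hU0 s _ (by omega) (by omega)
  · obtain rfl : s = r := by omega
    exact h

theorem isEquivariant_triangle_trimmed {r : ℕ}
    (h : ∀ s, s + 2 = r → IsEquivariant a b U .full s 1 2) :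
    IsEquivariant a b U .trimmed r 1 2 := by
  refine isEquivariant_trimmed hU hU0 fun l s hl hs => ?_
  obtain rfl | rfl : l = 0 ∨ l = 1 := by omega
  · exact isEquivariant_extreme ha hb hU hU0 s _ (by omega) (by omega)
  · exact h s (by omega)

/-- Apart from extreme degrees, full one-forms of degree r+1 depend only on trimmed ones of degree
r, and trimmed ones of degree r only on full ones of degree r-2. A chain reaches the constant
one-forms only from full degrees divisible by three or trimmed degrees congruent to two. -/
theorem isEquivariant_triangle_of_mod (r : ℕ) :
    (r % 3 ≠ 0 → IsEquivariant a b U .full r 1 2) ∧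
      (r % 3 ≠ 2 → IsEquivariant a b U .trimmed r 1 2) := by
  induction r using Nat.strong_induction_on with
  | _ r ih =>
    refine ⟨fun hr => ?_, fun hr => isEquivariant_triangle_trimmed ha hb hU hU0 fun s hs =>
      (ih s (by omega)).1 (by omega)⟩
    cases r with
    | zero => exact absurd rfl hr
    | succ r => exact isEquivariant_triangle_full ha hb hU hU0 ((ih r (by omega)).2 (by omega))

theorem isEquivariant_tetrahedron_full_one {r : ℕ} (h0 : r % 3 ≠ 2)
    (h : ∀ s, s + 1 = r → IsEquivariant a b U .trimmed s 2 3) :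
    IsEquivariant a b U .full (r + 1) 1 3 := by
  refine isEquivariant_full hU hU0 fun l s hl hs => ?_
  obtain rfl | rfl | rfl : l = 0 ∨ l = 1 ∨ l = 2 := by omega
  · exact isEquivariant_extreme ha hb hU hU0 s _ (by omega) (by omega)
  · obtain rfl : s = r := by omega
    exact (isEquivariant_triangle_of_mod ha hb hU hU0 s).2 h0
  · exact h s (by omega)

theorem isEquivariant_tetrahedron_trimmed_one {r : ℕ} (h0 : r % 3 ≠ 2)
    (h : ∀ s, s + 3 = r → IsEquivariant a b U .full s 2 3) :
    IsEquivariant a b U .trimmed r 1 3 := by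
  refine isEquivariant_trimmed hU hU0 fun l s hl hs => ?_
  obtain rfl | rfl | rfl : l = 0 ∨ l = 1 ∨ l = 2 := by omega
  · exact isEquivariant_extreme ha hb hU hU0 s _ (by omega) (by omega)
  · exact (isEquivariant_triangle_of_mod ha hb hU hU0 s).1 (by omega)
  · exact h s (by omega)

theorem isEquivariant_tetrahedron_full_two {r : ℕ} (h : IsEquivariant a b U .trimmed r 1 3) :
    IsEquivariant a b U .full (r + 1) 2 3 := by
  refine isEquivariant_full hU hU0 fun l s hl hs => ?_
  obtain rfl | rfl : l = 0 ∨ l = 1 := by omega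
  · exact isEquivariant_extreme ha hb hU hU0 s _ (by omega) (by omega)
  · obtain rfl : s = r := by omega
    exact h

theorem isEquivariant_tetrahedron_trimmed_two {r : ℕ}
    (h : ∀ s, s + 2 = r → IsEquivariant a b U .full s 1 3) :
    IsEquivariant a b U .trimmed r 2 3 := by
  refine isEquivariant_trimmed hU hU0 fun l s hl hs => ?_
  obtain rfl | rfl : l = 0 ∨ l = 1 := by omega
  · exact isEquivariant_extreme ha hb hU hU0 s _ (by omega) (by omega)
  · exact h s (by omega)

/-- The listed positive degrees are not divisible by 3, which settles the triangular faces. The list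
is also closed under subtracting 4 as long as the result is nonnegative, which settles the interior.
-/
theorem isEquivariant_full_one (r : ℕ) (hr : r = 0 ∨ r = 1 ∨ r = 2 ∨ r = 4 ∨ r = 5 ∨ r = 8) :
    IsEquivariant a b U .full r 1 3 := by
  induction r using Nat.strong_induction_on with
  | _ r ih =>
    cases r with
    | zero => exact isEquivariant_tetrahedron_one hU
    | succ r =>
      refine isEquivariant_tetrahedron_full_one ha hb hU hU0 (by omega) fun s hs =>
        isEquivariant_tetrahedron_trimmed_two ha hb hU hU0 fun t ht =>
          ih t (by omega) (by omega)

theorem isEquivariant_trimmed_two (r : ℕ) (hr : r = 0 ∨ r = 1 ∨ r = 2 ∨ r = 3 ∨ r = 4 ∨ r = 6 ∨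
    r = 7 ∨ r = 10) : IsEquivariant a b U .trimmed r 2 3 :=
  isEquivariant_tetrahedron_trimmed_two ha hb hU hU0 fun s hs =>
    isEquivariant_full_one ha hb hU hU0 s (by omega)

theorem isEquivariant_trimmed_one (r : ℕ) (hr : r = 0 ∨ r = 1 ∨ r = 3 ∨ r = 4 ∨ r = 7) :
    IsEquivariant a b U .trimmed r 1 3 := by
  induction r using Nat.strong_induction_on with
  | _ r ih =>
    refine isEquivariant_tetrahedron_trimmed_one ha hb hU hU0 (by omega) fun s hs => ?_
    cases s with
    | zero => exact isEquivariant_tetrahedron_two hU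
    | succ s =>
      exact isEquivariant_tetrahedron_full_two ha hb hU hU0 (ih s (by omega) (by omega))

theorem isEquivariant_full_two (r : ℕ) (hr : r = 0 ∨ r = 1 ∨ r = 2 ∨ r = 4 ∨ r = 5 ∨ r = 8) :
    IsEquivariant a b U .full r 2 3 := by
  cases r with
  | zero => exact isEquivariant_tetrahedron_two hU
  | succ r =>
    exact isEquivariant_tetrahedron_full_two ha hb hU hU0
      (isEquivariant_trimmed_one ha hb hU hU0 r (by omega))

end Real

/-! ### Rotations in the various degrees -/

section Rotating

variable (ha : ∀ m F, a m F ≠ 0) (hb : ∀ m F, b m F ≠ 0)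

include ha hb

theorem isRotating_triangle_trimmed {r : ℕ} (h : IsRotating a b .full r 1 2) :
    IsRotating a b .trimmed (r + 2) 1 2 :=
  IsRotating.trimmed ha hb (l := 1) (k := 1) h le_rfl (by norm_num)

theorem isRotating_triangle_full (j : ℕ) : IsRotating a b .full (3 * j) 1 2 := by
  induction j with
  | zero => exact isRotating_triangle
  | succ j ih =>
    change IsRotating a b .full (3 * j + 2 + 1) 1 2
    exact IsRotating.full ha hb (l := 1) (k := 1) (isRotating_triangle_trimmed ha hb ih) le_rfl
      (by norm_num) (by omega)

/-- A positive multiple of three gets its rotation from a triangular face. Any other degree outside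
the list is at least 7, and subtracting 4 leads to another degree outside the list. -/
theorem isRotating_full_one (r : ℕ)
    (hr : r ≠ 0 ∧ r ≠ 1 ∧ r ≠ 2 ∧ r ≠ 4 ∧ r ≠ 5 ∧ r ≠ 8) : IsRotating a b .full r 1 3 := by
  induction r using Nat.strong_induction_on with
  | _ r ih =>
    obtain ⟨j, rfl⟩ | ⟨s, rfl, hs⟩ : (∃ j, r = 3 * j + 3) ∨ (∃ s, r = s + 4 ∧
        (s ≠ 0 ∧ s ≠ 1 ∧ s ≠ 2 ∧ s ≠ 4 ∧ s ≠ 5 ∧ s ≠ 8)) := by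
      by_cases h : r % 3 = 0
      · exact Or.inl ⟨r / 3 - 1, by omega⟩
      · exact Or.inr ⟨r - 4, by omega, by omega⟩
    · exact IsRotating.full ha hb (l := 1) (k := 1)
        (isRotating_triangle_trimmed ha hb (isRotating_triangle_full ha hb j)) (by norm_num)
        le_rfl (by omega)
    · refine IsRotating.full ha hb (l := 2) (k := 1) (s := s + 2) ?_ le_rfl le_rfl (by omega)
      exact IsRotating.trimmed ha hb (l := 1) (k := 2) (ih s (by omega) hs) le_rfl le_rfl

theorem isRotating_trimmed_two (r : ℕ) (hr : r ≠ 0 ∧ r ≠ 1 ∧ r ≠ 2 ∧ r ≠ 3 ∧ r ≠ 4 ∧ r ≠ 6 ∧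
    r ≠ 7 ∧ r ≠ 10) : IsRotating a b .trimmed r 2 3 := by
  obtain ⟨s, rfl⟩ : ∃ s, r = s + 2 := ⟨r - 2, by omega⟩
  exact IsRotating.trimmed ha hb (l := 1) (k := 2) (isRotating_full_one ha hb s (by omega))
    le_rfl le_rfl

/-- Here the triangular faces account for the degrees congruent to two modulo three; every other
excluded degree descends by 4 to an excluded one. -/
theorem isRotating_trimmed_one (r : ℕ) (hr : r ≠ 0 ∧ r ≠ 1 ∧ r ≠ 3 ∧ r ≠ 4 ∧ r ≠ 7) :
    IsRotating a b .trimmed r 1 3 := by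
  induction r using Nat.strong_induction_on with
  | _ r ih =>
    obtain ⟨j, rfl⟩ | ⟨s, rfl, hs⟩ : (∃ j, r = 3 * j + 2) ∨ (∃ s, r = s + 4 ∧
        (s ≠ 0 ∧ s ≠ 1 ∧ s ≠ 3 ∧ s ≠ 4 ∧ s ≠ 7)) := by
      by_cases h : r % 3 = 2
      · exact Or.inl ⟨r / 3, by omega⟩
      · exact Or.inr ⟨r - 4, by omega, by omega⟩
    · exact IsRotating.trimmed ha hb (l := 1) (k := 1) (isRotating_triangle_full ha hb j)
        (by norm_num) le_rfl
    · refine IsRotating.trimmed ha hb (l := 2) (k := 1) (s := s + 1) ?_ le_rfl le_rfl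
      exact IsRotating.full ha hb (l := 1) (k := 2) (ih s (by omega) hs) le_rfl le_rfl (by omega)

theorem isRotating_full_two (r : ℕ)
    (hr : r ≠ 0 ∧ r ≠ 1 ∧ r ≠ 2 ∧ r ≠ 4 ∧ r ≠ 5 ∧ r ≠ 8) : IsRotating a b .full r 2 3 := by
  obtain ⟨s, rfl⟩ : ∃ s, r = s + 1 := ⟨r - 1, by omega⟩
  exact IsRotating.full ha hb (l := 1) (k := 2) (isRotating_trimmed_one ha hb s (by omega))
    le_rfl le_rfl (by omega)

end Rotating

end

open StdForm

section Symmetries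

variable {E : Type*} [AddCommGroup E] [Module ℝ E] {n k : ℕ} {T : Affine.Simplex ℝ E n}

/-! ### The symmetries of a simplex permute its vertices -/

theorem affine_apply_eq_sum (f : hull T →ᵃ[ℝ] ℝ) (p : hull T) :
    f p = ∑ j, (vertexBasis T).coord j p * f (vertexBasis T j) := by
  conv_lhs => rw [← (vertexBasis T).affineCombination_coord_eq_self p]
  rw [Finset.map_affineCombination _ _ _ ((vertexBasis T).sum_coord_apply_eq_one p),
    Finset.affineCombination_eq_linear_combination _ _ _ ((vertexBasis T).sum_coord_apply_eq_one p)]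
  rfl

theorem mem_closedInterior_iff (p : hull T) :
    (p : E) ∈ T.closedInterior ↔ ∀ i, 0 ≤ (vertexBasis T).coord i p := by
  constructor
  · intro hp i
    obtain ⟨x, hx⟩ := baryPoint_surjective T ⟨p, hp⟩
    have h := bary_baryPoint T x i
    rw [hx] at h
    change (vertexBasis T).coord i p = x i at h
    rw [h]
    exact x.2.1 i
  · intro h
    have h1 := (vertexBasis T).affineCombination_coord_eq_self p
    have h2 := (vertexBasis T).sum_coord_apply_eq_one p
    have h3 : p = ⟨baryPoint T ⟨fun i => (vertexBasis T).coord i p, h, h2⟩,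
        T.setInterior_subset_affineSpan (baryPoint T _).2⟩ :=
      (vertexBasis T).ext_elem fun i =>
        (bary_baryPoint T ⟨fun i => (vertexBasis T).coord i p, h, h2⟩ i).symm
    rw [h3]
    exact (baryPoint T _).2

/-- Extremality of the vertices: the preimage of a vertex is a convex combination of vertices, and
some vertex `m` has positive weight. For `i ≠ j` the i-th coordinate of the image is zero and a sum
of nonnegative terms, so it already vanishes at the image of `m`. -/
theorem exists_apply_eq_vertex {S : hull T ≃ᵃ[ℝ] hull T} (hS : IsSymmetry T S)
    (j : Fin (n + 1)) : ∃ m, S (vertexBasis T m) = vertexBasis T j := by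
  have hv : ∀ (m : Fin (n + 1)) i, 0 ≤ (vertexBasis T).coord i (vertexBasis T m) := fun m i => by
    rw [AffineBasis.coord_apply]
    split_ifs <;> norm_num
  have hw : ∀ i, 0 ≤ (vertexBasis T).coord i (S.symm (vertexBasis T j)) := by
    rw [← mem_closedInterior_iff, ← hS, S.apply_symm_apply, mem_closedInterior_iff]
    exact hv j
  have hSv : ∀ m i, 0 ≤ (vertexBasis T).coord i (S (vertexBasis T m)) := fun m => by
    rw [← mem_closedInterior_iff, hS, mem_closedInterior_iff]
    exact hv m
  obtain ⟨m, -, hm⟩ : ∃ m ∈ Finset.univ,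
      (vertexBasis T).coord m (S.symm (vertexBasis T j)) ≠ 0 := by
    by_contra! h0
    have h1 := (vertexBasis T).sum_coord_apply_eq_one (S.symm (vertexBasis T j))
    rw [Finset.sum_eq_zero h0] at h1
    exact zero_ne_one h1
  have hzero : ∀ i, i ≠ j → (vertexBasis T).coord i (S (vertexBasis T m)) = 0 := fun i hi => by
    have h1 := affine_apply_eq_sum (((vertexBasis T).coord i).comp S.toAffineMap)
      (S.symm (vertexBasis T j))
    simp only [AffineMap.comp_apply, AffineEquiv.coe_toAffineMap, S.apply_symm_apply,
      AffineBasis.coord_apply, if_neg hi] at h1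
    have h2 := (Finset.sum_eq_zero_iff_of_nonneg
      fun m _ => mul_nonneg (hw m) (hSv m i)).1 h1.symm m (Finset.mem_univ m)
    exact (mul_eq_zero.1 h2).resolve_left hm
  refine ⟨m, (vertexBasis T).ext_elem fun i => ?_⟩
  rw [AffineBasis.coord_apply]
  split_ifs with hi
  · subst hi
    rw [← (vertexBasis T).sum_coord_apply_eq_one (S (vertexBasis T m)),
      Finset.sum_eq_single i (fun i' _ h => hzero i' h) fun h => (h (Finset.mem_univ i)).elim]
  · exact hzero i hi

theorem IsSymmetry.exists_perm {S : hull T ≃ᵃ[ℝ] hull T} (hS : IsSymmetry T S) :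
    ∃ π : Equiv.Perm (Fin (n + 1)), ∀ j, S (vertexBasis T j) = vertexBasis T (π j) := by
  choose f hf using exists_apply_eq_vertex hS
  have hi : Function.Injective f := fun i j h => (vertexBasis T).ind.injective (by
    change vertexBasis T i = vertexBasis T j
    rw [← hf i, ← hf j, h])
  refine ⟨(Equiv.ofBijective f (Finite.injective_iff_bijective.1 hi)).symm, fun j => ?_⟩
  rw [← hf (Equiv.symm _ j)]
  congr 2
  exact ((Equiv.ofBijective f (Finite.injective_iff_bijective.1 hi)).apply_symm_apply j).symm

theorem coord_apply_of_perm {S : hull T ≃ᵃ[ℝ] hull T} {π : Equiv.Perm (Fin (n + 1))}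
    (hπ : ∀ j, S (vertexBasis T j) = vertexBasis T (π j)) (i : Fin (n + 1)) :
    ((vertexBasis T).coord (π i)).comp S.toAffineMap = (vertexBasis T).coord i := by
  ext p
  rw [affine_apply_eq_sum, affine_apply_eq_sum ((vertexBasis T).coord i)]
  refine Finset.sum_congr rfl fun j _ => ?_
  simp only [AffineMap.comp_apply, AffineEquiv.coe_toAffineMap, hπ, AffineBasis.coord_apply,
    π.injective.eq_iff]

theorem exists_symmetry (T : Affine.Simplex ℝ E n) (π : Equiv.Perm (Fin (n + 1))) :
    ∃ S : hull T ≃ᵃ[ℝ] hull T, IsSymmetry T S ∧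
      ∀ j, S (vertexBasis T j) = vertexBasis T (π j) := by
  -- The edge vectors at the vertex 0 are sent to the corresponding edge vectors at the vertex `π
  -- 0`.
  let L : (hull T).direction ≃ₗ[ℝ] (hull T).direction :=
    ((vertexBasis T).basisOf 0).equiv (((vertexBasis T).reindex π.symm).basisOf 0) (Equiv.refl _)
  let S : hull T ≃ᵃ[ℝ] hull T := AffineEquiv.mk'
    (fun p => L (p -ᵥ vertexBasis T 0) +ᵥ vertexBasis T (π 0)) L (vertexBasis T 0)
    (fun p => by simp)
  have hS : ∀ j, S (vertexBasis T j) = vertexBasis T (π j) := fun j => by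
    change L (vertexBasis T j -ᵥ vertexBasis T 0) +ᵥ vertexBasis T (π 0) = _
    by_cases hj : j = 0
    · subst hj
      simp
    · have h := ((vertexBasis T).basisOf 0).equiv_apply ⟨j, hj⟩
        (((vertexBasis T).reindex π.symm).basisOf 0) (Equiv.refl _)
      rw [AffineBasis.basisOf_apply, AffineBasis.basisOf_apply] at h
      rw [show L (vertexBasis T j -ᵥ vertexBasis T 0) = _ from h]
      simp
  refine ⟨S, fun p => ?_, hS⟩
  rw [mem_closedInterior_iff, mem_closedInterior_iff, ← π.forall_congr_right]
  refine forall_congr' fun i => ?_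
  rw [← coord_apply_of_perm hS i]
  rfl

theorem direction_ext {d d' : (hull T).direction}
    (h : ∀ i, ((vertexBasis T).coord i).linear d = ((vertexBasis T).coord i).linear d') :
    d = d' := by
  apply vadd_right_cancel (vertexBasis T 0)
  refine (vertexBasis T).ext_elem fun i => ?_
  rw [AffineMap.map_vadd, AffineMap.map_vadd, h]

/-- This translates the geometric notion of invariance into permutations of barycentric coordinates,
at points as well as for tangent vectors. -/
theorem toStd_pullback {S : hull T ≃ᵃ[ℝ] hull T} (hS : IsSymmetry T S)
    {π : Equiv.Perm (Fin (n + 1))} (hπ : ∀ j, S (vertexBasis T j) = vertexBasis T (π j))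
    (ω : Form T k) : toStd T (pullback hS ω) = pull π (toStd T ω) := by
  have hpoint : ∀ x h, (⟨S ⟨baryPoint T x, T.setInterior_subset_affineSpan (baryPoint T x).2⟩, h⟩ :
      T.closedInterior) = baryPoint T (stdSimplex.map π x) := fun x h => by
    apply Subtype.ext
    refine congrArg (Subtype.val : hull T → E) ((vertexBasis T).ext_elem
      (q₂ := ⟨baryPoint T (stdSimplex.map π x), T.setInterior_subset_affineSpan
        (baryPoint T _).2⟩) fun i => ?_)
    obtain ⟨i, rfl⟩ := π.surjective i
    refine Eq.trans ?_ (bary_baryPoint T (stdSimplex.map π x) (π i)).symm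
    rw [map_apply π π.injective, ← bary_baryPoint T x i, bary, ← coord_apply_of_perm hπ i]
    rfl
  have hvector : (S.linear : (hull T).direction →ₗ[ℝ] (hull T).direction) ∘ₗ baryVector T =
      baryVector T ∘ₗ push π := LinearMap.ext fun u => by
    refine direction_ext fun i => ?_
    obtain ⟨i, rfl⟩ := π.surjective i
    have h := DFunLike.congr_fun (congrArg AffineMap.linear (coord_apply_of_perm hπ i))
      (baryVector T u)
    rw [coord_baryVector] at h
    rw [LinearMap.comp_apply, LinearMap.comp_apply, coord_baryVector, push_apply π π.injective]
    exact h
  funext x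
  ext u
  rw [toStd_apply, pull_apply, toStd_apply]
  simp only [pullback, AlternatingMap.compLinearMap_apply, hpoint]
  congr 1
  funext i
  exact DFunLike.congr_fun hvector (u i)

end Symmetries

open StdForm

/-! ### Injectivity of pullbacks and uniqueness of factors -/

theorem StdForm.pull_perm_injective {ι : Type*} [Fintype ι] {k : ℕ} (π : Equiv.Perm ι) :
    Function.Injective (pull (k := k) π) := by
  classical
  intro ω η h
  refine eq_of_coneVal fun μ _ x => ?_
  have hx : stdSimplex.map π (stdSimplex.map π.symm x) = x := by
    ext i
    obtain ⟨j, rfl⟩ := π.surjective i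
    rw [map_apply π π.injective]
    conv_lhs => rw [← π.symm_apply_apply j]
    rw [map_apply π.symm π.symm.injective]
  have h1 := congrArg (coneVal (fun j => π.symm (μ j)) (stdSimplex.map π.symm x)) h
  simp only [coneVal_pull, Equiv.apply_symm_apply, hx] at h1
  exact h1

theorem IsBasisOf.eq_of_smul_eq_smul {M : Type*} [AddCommGroup M] [Module ℂ M] {Q : Set M}
    {W : Submodule ℂ M} (hQ : IsBasisOf Q W) {x y : M} (hx : x ∈ Q) (hy : y ∈ Q) {c d : ℂ}
    (hc : c ≠ 0) (h : c • x = d • y) : x = y ∧ c = d := by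
  have hxy : x = y := congrArg Subtype.val
    (LinearIndependent.eq_of_smul_apply_eq_smul_apply hQ.1 c d ⟨x, hx⟩ ⟨y, hy⟩ hc h)
  subst hxy
  have h0 : x ≠ 0 := hQ.1.ne_zero hx
  exact ⟨rfl, smul_left_injective ℂ h0 h⟩

section Invariance

variable {E : Type*} [AddCommGroup E] [Module ℝ E] {a b : ∀ m : ℕ, Affine.Simplex ℝ E m → ℝ}
  {n k r : ℕ} {fam : Family} {T : Affine.Simplex ℝ E n} {U : Set ℂ}

/-! ### Invariance of the bases -/

theorem isBasisOf_recBasis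
    (h : IsBasisOf (stdBasis a b fam r k T) (space fam r k (Fin (n + 1)))) :
    IsBasisOf (recBasis a b fam r k T) (polySpace fam r k T) := by
  have hinj := toStd_injective (k := k) T
  refine ⟨LinearIndepOn.of_comp (toStd T)
    ((linearIndepOn_iff_image hinj.injOn).2 h.1), Submodule.map_injective_of_injective hinj ?_⟩
  rw [Submodule.map_span, map_polySpace]
  exact h.2

theorem finite_multiindices (N r : ℕ) : {α : Fin N → ℕ | ∑ i, α i ≤ r}.Finite :=
  (Set.finite_Iic fun _ : Fin N => r).subset fun _ hα i =>
    (Finset.single_le_sum (fun _ _ => Nat.zero_le _) (Finset.mem_univ i)).trans hα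

theorem exists_finite_span_polySpace (fam : Family) (r k : ℕ) (T : Affine.Simplex ℝ E n) :
    ∃ A : Set (Form T k), A.Finite ∧ polySpace fam r k T = Submodule.span ℂ A := by
  cases fam
  · refine ⟨_, Set.Finite.subset (((finite_multiindices (n + 1) r).prod
      (Set.finite_univ (α := Fin k ↪o Fin (n + 1)))).image
        fun p => monomialMul T p.1 (dbaryForm T p.2)) ?_, rfl⟩
    rintro _ ⟨α, σ, hα, rfl⟩
    exact ⟨(α, σ), ⟨hα.le, Set.mem_univ _⟩, rfl⟩
  · refine ⟨_, Set.Finite.subset (((finite_multiindices (n + 1) r).prod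
      (Set.finite_univ (α := Fin (k + 1) ↪o Fin (n + 1)))).image
        fun p => monomialMul T p.1 (whitneyForm T p.2)) ?_, rfl⟩
    rintro _ ⟨α, σ, hα, rfl⟩
    exact ⟨(α, σ), ⟨(Nat.le_succ _).trans hα.le, Set.mem_univ _⟩, rfl⟩

theorem IsBasisOf.finite {Q : Set (Form T k)} (h : IsBasisOf Q (polySpace fam r k T)) :
    Q.Finite := by
  obtain ⟨A, hA, hspan⟩ := exists_finite_span_polySpace fam r k T
  have := hA.to_subtype
  have hQ : Finite Q := by
    refine LinearIndependent.finite_of_le_span_finite _ h.1 A ?_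
    rintro _ ⟨⟨ω, hω⟩, rfl⟩
    rw [← hspan]
    exact h.subset hω
  exact Set.toFinite Q

theorem IsEquivariant.exists_pullback_eq (h : IsEquivariant a b U fam r k n)
    {S : hull T ≃ᵃ[ℝ] hull T} (hS : IsSymmetry T S) {ω : Form T k}
    (hω : ω ∈ recBasis a b fam r k T) :
    ∃ χ ∈ U, ∃ η ∈ recBasis a b fam r k T, pullback hS ω = χ • η := by
  obtain ⟨π, hπ⟩ := hS.exists_perm
  obtain ⟨χ, hχ, _, ⟨η, hη, rfl⟩, he⟩ := h T T π _ ⟨ω, hω, rfl⟩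
  exact ⟨χ, hχ, η, hη, toStd_injective T (by rw [toStd_pullback hS hπ, he, map_smul])⟩

theorem IsEquivariant.isInvariantUpTo (h : IsEquivariant a b U fam r k n) (hU0 : ∀ z ∈ U, z ≠ 0)
    (hB : IsBasisOf (recBasis a b fam r k T) (polySpace fam r k T)) :
    IsInvariantUpTo U (recBasis a b fam r k T) := by
  have hfin := hB.finite
  refine ⟨hfin, fun S hS => ?_⟩
  obtain ⟨π, hπ⟩ := hS.exists_perm
  choose χ hχ η hη he using fun ω : recBasis a b fam r k T => h.exists_pullback_eq hS ω.2
  -- If two basis forms went to multiples of the same form, cross multiplication and injectivity of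
  -- the pullback would make them proportional, hence equal.
  have hi : Function.Injective fun ω => (⟨η ω, hη ω⟩ : recBasis a b fam r k T) := by
    intro ω ω' hω
    have h1 : η ω = η ω' := congrArg Subtype.val hω
    have h2 : pull π (toStd T (χ ω' • (ω : Form T k))) =
        pull π (toStd T (χ ω • (ω' : Form T k))) := by
      simp only [map_smul, ← toStd_pullback hS hπ, he, h1, smul_smul, mul_comm]
    exact Subtype.ext (hB.eq_of_smul_eq_smul ω.2 ω'.2 (hU0 _ (hχ ω'))
      (toStd_injective T (pull_perm_injective π h2))).1
  have := hfin.to_subtype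
  exact ⟨Equiv.ofBijective _ (Finite.injective_iff_bijective.1 hi), χ, hχ, he⟩

/-- Linear independence makes the factor and its target unique, so a form multiplied by a nonreal
number cannot also be a real multiple of a basis form. -/
theorem IsRotating.not_isRInvariant (h : IsRotating a b fam r k n)
    (hB : IsBasisOf (recBasis a b fam r k T) (polySpace fam r k T)) :
    ¬ IsRInvariant (recBasis a b fam r k T) := by
  rintro ⟨-, hinv⟩
  obtain ⟨π, _, ⟨ω, hω, rfl⟩, χ, hχ, he⟩ := h T
  obtain ⟨S, hS, hπ⟩ := exists_symmetry T π
  obtain ⟨τ, χ', hχ', h1⟩ := hinv S hS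
  obtain ⟨x, hx0, hx⟩ := hχ' ⟨ω, hω⟩
  have h2 : χ' ⟨ω, hω⟩ • (τ ⟨ω, hω⟩ : Form T k) = χ • ω := by
    rw [← h1]
    exact toStd_injective T (by rw [toStd_pullback hS hπ, he, map_smul])
  have h3 := (hB.eq_of_smul_eq_smul (τ ⟨ω, hω⟩).2 hω
    (by rw [hx]; exact Complex.ofReal_ne_zero.2 hx0) h2).2
  exact hχ x (by rw [← h3, hx])

/-- Equivariance supplies one relation with a unit factor; by independence every other relation for
the same form has the same factor. -/
theorem IsEquivariant.hasUnitFactors (h : IsEquivariant a b {z | ‖z‖ = 1} fam r k n)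
    (hB : IsBasisOf (recBasis a b fam r k T) (polySpace fam r k T)) :
    HasUnitFactors (recBasis a b fam r k T) := by
  intro S hS ω hω η hη χ he
  obtain ⟨χ', hχ', η', hη', he'⟩ := h.exists_pullback_eq hS hω
  have h0 : χ' ≠ 0 := fun h0 => by
    subst h0
    exact zero_ne_one (norm_zero.symm.trans hχ')
  rw [← (hB.eq_of_smul_eq_smul hη' hη h0 (he'.symm.trans he)).2]
  exact hχ'

/-! ### The sets of factors -/

theorem isFactorSet_ne_zero (ha : ∀ m F, a m F ≠ 0) (hb : ∀ m F, b m F ≠ 0) :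
    IsFactorSet a b {z | z ≠ 0} where
  one_mem := one_ne_zero
  neg_mem _ hz := neg_ne_zero.2 hz
  ratio_a n T T' := div_ne_zero (Complex.ofReal_ne_zero.2 (ha n T'))
    (Complex.ofReal_ne_zero.2 (ha n T))
  ratio_b n T T' := div_ne_zero (Complex.ofReal_ne_zero.2 (hb n T'))
    (Complex.ofReal_ne_zero.2 (hb n T))

theorem isFactorSet_real (ha : ∀ m F, a m F ≠ 0) (hb : ∀ m F, b m F ≠ 0) :
    IsFactorSet a b {z | ∃ x : ℝ, x ≠ 0 ∧ z = x} where
  one_mem := ⟨1, one_ne_zero, by simp⟩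
  neg_mem := by
    rintro _ ⟨x, hx, rfl⟩
    exact ⟨-x, neg_ne_zero.2 hx, by simp⟩
  ratio_a n T T' := ⟨_, div_ne_zero (ha n T') (ha n T), by push_cast; rfl⟩
  ratio_b n T T' := ⟨_, div_ne_zero (hb n T') (hb n T), by push_cast; rfl⟩

theorem isFactorSet_unit (h : ∀ m F, |a m F| = 1 ∧ |b m F| = 1) :
    IsFactorSet a b {z | ‖z‖ = 1} where
  one_mem := norm_one
  neg_mem z hz := (norm_neg z).trans hz
  ratio_a n T T' := by simp [(h n _).1]
  ratio_b n T T' := by simp [(h n _).2]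

end Invariance

end FEEC

end

/-! ### The main theorem -/

theorem mainTheorem1 {E : Type*} [AddCommGroup E] [Module ℝ E]
    (a b : ∀ m : ℕ, Affine.Simplex ℝ E m → ℝ)
    (ha : ∀ (m : ℕ) (F : Affine.Simplex ℝ E m), a m F ≠ 0)
    (hb : ∀ (m : ℕ) (F : Affine.Simplex ℝ E m), b m F ≠ 0)
    (T : Affine.Simplex ℝ E 3) (r : ℕ) :
    -- the constructed sets are bases
    (∀ k ∈ ({1, 2} : Set ℕ), ∀ fam : Family,
      IsBasisOf (recBasis a b fam r k T) (polySpace fam r k T)) ∧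
    -- they are `ℂ`-invariant
    (∀ k ∈ ({1, 2} : Set ℕ), ∀ fam : Family, IsCInvariant (recBasis a b fam r k T)) ∧
    -- the degrees with `ℝ`-invariance
    (IsRInvariant (recBasis a b .full r 1 T) ↔ r ∈ ({0, 1, 2, 4, 5, 8} : Set ℕ)) ∧
    (IsRInvariant (recBasis a b .trimmed r 1 T) ↔ r ∈ ({0, 1, 3, 4, 7} : Set ℕ)) ∧
    (IsRInvariant (recBasis a b .full r 2 T) ↔ r ∈ ({0, 1, 2, 4, 5, 8} : Set ℕ)) ∧
    (IsRInvariant (recBasis a b .trimmed r 2 T) ↔ r ∈ ({0, 1, 2, 3, 4, 6, 7, 10} : Set ℕ)) ∧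
    -- with normalized constant functions and volume forms, all the factors are complex units
    ((∀ (m : ℕ) (F : Affine.Simplex ℝ E m), |a m F| = 1 ∧ |b m F| = 1) →
      ∀ k ∈ ({1, 2} : Set ℕ), ∀ fam : Family, HasUnitFactors (recBasis a b fam r k T)) := by
  have hB : ∀ (fam : Family) {k : ℕ}, k ≤ 3 →
      IsBasisOf (recBasis a b fam r k T) (polySpace fam r k T) := fun fam _ hk =>
    isBasisOf_recBasis (isBasisOf_stdBasis ha hb r fam hk le_rfl T)
  have hk : ∀ k ∈ ({1, 2} : Set ℕ), k ≤ 3 := by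
    rintro _ (rfl | rfl) <;> norm_num
  have hR := isFactorSet_real ha hb
  have hR0 : ∀ z ∈ {z : ℂ | ∃ x : ℝ, x ≠ 0 ∧ z = x}, z ≠ 0 := by
    rintro _ ⟨x, hx, rfl⟩
    exact Complex.ofReal_ne_zero.2 hx
  refine ⟨fun k hk' fam => hB fam (hk k hk'), fun k hk' fam => ?_, ⟨fun h => ?_, fun h => ?_⟩,
    ⟨fun h => ?_, fun h => ?_⟩, ⟨fun h => ?_, fun h => ?_⟩, ⟨fun h => ?_, fun h => ?_⟩,
    fun hab k hk' fam => ?_⟩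
  · exact (isEquivariant_all ha hb (isFactorSet_ne_zero ha hb) (fun _ hz => hz)
      (fun m => pow_ne_zero m (ξ₃_isPrimitiveRoot.ne_zero (by norm_num))) r fam (hk k hk')
      le_rfl).isInvariantUpTo (fun _ hz => hz) (hB fam (hk k hk'))
  · by_contra hr
    refine (isRotating_full_one ha hb r ?_).not_isRInvariant (hB .full (by norm_num)) h
    simpa only [Set.mem_insert_iff, Set.mem_singleton_iff, not_or] using hr
  · exact (isEquivariant_full_one ha hb hR hR0 r h).isInvariantUpTo hR0 (hB .full (by norm_num))
  · by_contra hr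
    refine (isRotating_trimmed_one ha hb r ?_).not_isRInvariant (hB .trimmed (by norm_num)) h
    simpa only [Set.mem_insert_iff, Set.mem_singleton_iff, not_or] using hr
  · exact (isEquivariant_trimmed_one ha hb hR hR0 r h).isInvariantUpTo hR0
      (hB .trimmed (by norm_num))
  · by_contra hr
    refine (isRotating_full_two ha hb r ?_).not_isRInvariant (hB .full (by norm_num)) h
    simpa only [Set.mem_insert_iff, Set.mem_singleton_iff, not_or] using hr
  · exact (isEquivariant_full_two ha hb hR hR0 r h).isInvariantUpTo hR0 (hB .full (by norm_num))
  · by_contra hr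
    refine (isRotating_trimmed_two ha hb r ?_).not_isRInvariant (hB .trimmed (by norm_num)) h
    simpa only [Set.mem_insert_iff, Set.mem_singleton_iff, not_or] using hr
  · exact (isEquivariant_trimmed_two ha hb hR hR0 r h).isInvariantUpTo hR0
      (hB .trimmed (by norm_num))
  · have hU := isFactorSet_unit hab
    have hU0 : ∀ z ∈ {z : ℂ | ‖z‖ = 1}, z ≠ 0 := fun z hz => norm_ne_zero_iff.1 (by
      rw [show ‖z‖ = 1 from hz]
      exact one_ne_zero)
    have hξ : ∀ m : ℕ, ξ₃ ^ m ∈ {z : ℂ | ‖z‖ = 1} := fun m => by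
      change ‖ξ₃ ^ m‖ = 1
      rw [norm_pow, ξ₃_isPrimitiveRoot.norm'_eq_one (by norm_num), one_pow]
    exact (isEquivariant_all ha hb hU hU0 hξ r fam (hk k hk') le_rfl).hasUnitFactors
      (hB fam (hk k hk'))
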